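/- **Setting.** Let $\lambda$ be the security parameter, $d\ge 0$, $k\ge 1$, $B\ge 1$ integers, $D=2^dB$, and $\mathbb G$ a finite abelian group whose elements are written as strings of $\lceil\log_2|\mathbb G|\rceil$ bits, with a map $\mathrm{convert}:\{0,1\}^{\lceil\log_2|\mathbb G|\rceil}\to\mathbb G$. For distinct $\alpha^0,\dots,\alpha^{k-1}\in\{0,1\}^d$ and $\beta^0,\dots,\beta^{k-1}\in\mathbb G^B$ the $k$-block-sparse function $f_{\alpha,\beta}:\{0,1\}^d\times[B]\to\mathbb G$ is given by $f_{\alpha,\beta}(\alpha^\ell,j)=\beta^\ell_j$ and $f_{\alpha,\beta}(x,j)=0$ for $x\notin\{\alpha^0,\dots,\alpha^{k-1}\}$. Let $G:\{0,1\}^\lambda\to\{0,1\}^{2(\lambda+2)}$ and $G':\{0,1\}^\lambda\to\{0,1\}^{B\lceil\log_2|\mathbb G|\rceil}$, and let $\rho_i:\{0,1\}^{i-1}\to[3k]^2$, $1\le i\le d+1$, be public, independent, uniformly random hash functions. **The scheme.** Every server $b\in\{0,1\}$ holds, at each node $x$ of the binary tree of depth $d$, a seed $s^b(x)\in\{0,1\}^\lambda$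 and two bits $u^b(x),q^b(x)$. At the root the seeds are uniform, $u^0=q^0=0$, and $(u^1,q^1)=(1,0)$ or $(0,1)$ according to a public bit $g\in\{0,1\}$. Layer $i\le d$ has $3k$ correction words $(c_a,m_a(0),p_a(0),m_a(1),p_a(1))$, $a\in[3k]$, with $c_a\in\{0,1\}^\lambda$ and bits $m_a(j),p_a(j)$; layer $d+1$ has $3k$ correction words $c_a\in\mathbb G^B$. A key is a root seed followed by all correction words. *Eval.* To pass from a node $x$ of depth $i-1<d$ to its children, with $(a_0,a_1)=\rho_i(x)$, server $b$ parses $G(s^b(x))$ as a seed and two bits for each child $x\|j$ and adds (XOR) $u^b(x)\,(c_{a_0},m_{a_0}(j),p_{a_0}(j))$ and $q^b(x)\,(c_{a_1},m_{a_1}(j),p_{a_1}(j))$. At a leaf $x$, with $(a_0,a_1)=\rho_{d+1}(x)$, its share of the value at $(x,j)$ is $(-1)^b\big(\mathrm{convert}(G'(s^b(x))_j)+u^b(x)c_{a_0}(j)+q^b(x)c_{a_1}(j)\big)$, where $G'(\cdot)_j$ is the $j$-th block of $\lceil\log_2|\mathbb G|\rceil$ bits. *Gen.* For each $i\le d+1$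 cuckoo hashing computes a choice $g_i(x)\in\{0,1\}$ for each $(i-1)$-bit prefix $x$ of the points $\alpha^\ell$ such that the locations $\rho_i(x)[g_i(x)]$ are pairwise distinct, and $g=g_1(\text{root})$. If this is impossible for some $i$, Gen produces keys for the zero function instead (a zero block at one arbitrary point). Otherwise, in layer $i\le d$, for each such prefix $x$, the correction word at $\rho_i(x)[g_i(x)]$ is chosen as follows. If exactly one child of $x$ is a prefix of some $\alpha^\ell$, $c$ is the XOR of the two servers' expanded seeds of the other child; if both are, $c$ is uniformly random. The bits $m(j)$ and $p(j)$ are the XORs of the two servers' expanded first and second bits of $x\|j$, plus $1+g_{i+1}(x\|j)$ and $g_{i+1}(x\|j)$ respectively if $x\|j$ is a prefix of some $\alpha^\ell$. In layer $d+1$ the word at $\rho_{d+1}(\alpha^\ell)[g_{d+1}(\alpha^\ell)]$ is $\pm\big(\beta^\ell_j-\mathrm{convert}(G'(s^0(\alpha^\ell))_j)+\mathrm{convert}(G'(s^1(\alpha^\ell))_j)\big)_j$, with sign $-$ iff the bit of server $1$ selected by $g_{d+1}$ ($u^1$ or $q^1$) at $\alpha^\ell$ is $1$. All other correction words are uniformly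 random. Both keys contain the same correction words. **Theorem.** There is an absolute constant $C$ such that for all parameters as above: 1. (Correctness.) For every $f_{\alpha,\beta}$ and every input $(x,j)$, the two servers' outputs of Eval add up to $f_{\alpha,\beta}(x,j)$ with probability at least $1-C\,d/k$ over the hash functions and Gen; that is, the correctness error is $\tilde O(1/k)$, where $\tilde O$ hides a factor logarithmic in the number $2^d$ of blocks. 2. (Key size.) Besides the root seed of $\lambda$ bits, a key consists of $3kd(\lambda+4)+3kB\lceil\log_2|\mathbb G|\rceil$ bits. 3. (Gen.) On the seeds of each of the two servers, Gen invokes $G$ at most $kd$ times and $G'$ at most $k$ times; it uses a number of further operations polynomial in $k,d,B$. 4. (Eval.) Eval at one input invokes $G$ at most $d$ times and $G'$ once, and uses $O(d+B)$ further operations. The outputs at all $D$ inputs can be computed with at most $2^d$ invocations of $G$, $2^d$ invocations of $G'$, and $O(D)$ further operations. An operation is one table access, hash evaluation, comparison, conversion, (conditional) XOR of bits or seeds, or group operation. 5. (Security.) Let $d,k,B$ and $\lceil\log_2|\mathbb G|\rceil$ be polynomially bounded functions of $\lambda$, let the group operations and $\mathrm{convert}$ be computable by polynomial-size circuits, and let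 $\mathrm{convert}$ map a uniform string to a pseudorandom group element (indistinguishable from a uniform one). If $G$ and $G'$ are pseudorandom generators, then for each server $b$, each choice of the public hash functions and all $k$-block-sparse functions (one for each $\lambda$), the key of server $b$ together with $g$ is computationally indistinguishable from a uniformly random key (uniform bits and uniform group elements) together with the fixed bit $g=0$. Efficiency and indistinguishability refer to non-uniform polynomial-size Boolean circuits. -/

import Mathlib

/-! ## Bit strings, uniform probability, Boolean circuits, computational indistinguishability -/

/-- Bit strings of length `n`. -/
abbrev Bits (n : ℕ) : Type := Fin n → Bool

/-- Probability of the event `p` under the uniform distribution on the finite sample space `Ω`. -/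
noncomputable def prob {Ω : Type} (p : Ω → Prop) : ℝ :=
  (Nat.card {ω : Ω // p ω} : ℝ) / (Nat.card Ω : ℝ)

/-- Boolean circuits with `m` outputs over `n` available wires, in topological order: either stop and
select the output wires, or add one more wire carrying a constant or the NAND of two earlier wires. -/
inductive Circuit (m : ℕ) : ℕ → Type
  | out {n : ℕ} (o : Fin m → Fin n) : Circuit m n
  | const {n : ℕ} (b : Bool) (C : Circuit m (n + 1)) : Circuit m n
  | nand {n : ℕ} (i j : Fin n) (C : Circuit m (n + 1)) : Circuit m n

namespace Circuit

/-- The function computed by a circuit. -/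
def eval {m : ℕ} : {n : ℕ} → Circuit m n → Bits n → Bits m
  | _, out o, x => fun i => x (o i)
  | _, const b C, x => C.eval (Fin.snoc (α := fun _ => Bool) x b)
  | _, nand i j C, x => C.eval (Fin.snoc (α := fun _ => Bool) x (!(x i && x j)))

/-- The number of gates. -/
def size {m : ℕ} : {n : ℕ} → Circuit m n → ℕ
  | _, out _ => 0
  | _, const _ C => C.size + 1
  | _, nand _ _ C => C.size + 1

end Circuit

/-- `f` is bounded by a polynomial in the security parameter. -/
def PolyBounded (f : ℕ → ℕ) : Prop :=
  ∃ p : Polynomial ℕ, ∀ l, f l ≤ p.eval l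

/-- Negligible functions of the security parameter. -/
def Negligible (f : ℕ → ℝ) : Prop :=
  Asymptotics.SuperpolynomialDecay Filter.atTop (fun l : ℕ => (l : ℝ)) f

/-- A family of functions on bit strings that is computed by polynomial-size circuits. -/
def PolySize {n m : ℕ → ℕ} (F : ∀ l, Bits (n l) → Bits (m l)) : Prop :=
  ∃ C : ∀ l, Circuit (m l) (n l),
    PolyBounded (fun l => (C l).size) ∧ ∀ l x, (C l).eval x = F l x

/-- Computational indistinguishability of two ensembles of random bit strings, given as functions
`X l`, `Y l` on uniformly distributed sample spaces, against (non-uniform) polynomial-size circuits. -/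
def CompIndist {n : ℕ → ℕ} {Ω Ω' : ℕ → Type}
    (X : ∀ l, Ω l → Bits (n l)) (Y : ∀ l, Ω' l → Bits (n l)) : Prop :=
  ∀ A : ∀ l, Circuit 1 (n l), PolyBounded (fun l => (A l).size) →
    Negligible (fun l =>
      |prob (fun ω => (A l).eval (X l ω) 0 = true) - prob (fun ω => (A l).eval (Y l ω) 0 = true)|)

/-- Pseudorandom generators `{0,1}^l → {0,1}^(m l)`: efficiently computable, with output on a uniform
seed indistinguishable from a uniform string. -/
def IsPRG {m : ℕ → ℕ} (G : ∀ l, Bits l → Bits (m l)) : Prop :=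
  PolySize (n := fun l => l) G ∧ CompIndist G (fun l (w : Bits (m l)) => w)

/-! ## The output group -/

/-- `⌈log₂ |𝔾|⌉`. -/
abbrev glen (Gr : Type) [Fintype Gr] : ℕ := Nat.clog 2 (Fintype.card Gr)

/-- How group elements are written as, and obtained from, strings of `⌈log₂ |𝔾|⌉` bits. -/
structure GroupRep (Gr : Type) [Fintype Gr] where
  /-- representation of a group element -/
  enc : Gr → Bits (glen Gr)
  enc_injective : Function.Injective enc
  /-- the map turning a string into a group element -/
  convert : Bits (glen Gr) → Gr

/-- The group operations and `convert` are efficiently computable on the representations, which have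
polynomial length. -/
def EfficientGroup (Gr : ℕ → Type) [∀ l, AddCommGroup (Gr l)] [∀ l, Fintype (Gr l)]
    (R : ∀ l, GroupRep (Gr l)) : Prop :=
  PolyBounded (fun l => glen (Gr l)) ∧
  (∃ C : ∀ l, Circuit (glen (Gr l)) (glen (Gr l) + glen (Gr l)),
    PolyBounded (fun l => (C l).size) ∧
    ∀ l a b, (C l).eval (Fin.append ((R l).enc a) ((R l).enc b)) = (R l).enc (a + b)) ∧
  (∃ C : ∀ l, Circuit (glen (Gr l)) (glen (Gr l)),
    PolyBounded (fun l => (C l).size) ∧ ∀ l a, (C l).eval ((R l).enc a) = (R l).enc (-a)) ∧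
  PolySize (fun l w => (R l).enc ((R l).convert w))

/-- `convert` turns a uniform string into a pseudorandom group element. -/
def PseudorandomConvert (Gr : ℕ → Type) [∀ l, Fintype (Gr l)] (R : ∀ l, GroupRep (Gr l)) : Prop :=
  CompIndist (fun l (w : Bits (glen (Gr l))) => (R l).enc ((R l).convert w))
    (fun l (a : Gr l) => (R l).enc a)

/-! ## Programs with counted generator calls and counted elementary operations -/

/-- Programs that have access to two generators (`S → W` and `S → V`) only through calls. Each call
is labelled by the server whose seed is expanded. `op` marks one elementary operation. -/
inductive Prog (S W V α : Type) : Type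
  | ret (a : α) : Prog S W V α
  | callG (b : Bool) (s : S) (next : W → Prog S W V α) : Prog S W V α
  | callG' (b : Bool) (s : S) (next : V → Prog S W V α) : Prog S W V α
  | op (next : Prog S W V α) : Prog S W V α

namespace Prog

variable {S W V α β : Type}

/-- Sequential composition. -/
def bind : Prog S W V α → (α → Prog S W V β) → Prog S W V β
  | ret a, f => f a
  | callG b s next, f => callG b s (fun w => (next w).bind f)
  | callG' b s next, f => callG' b s (fun v => (next v).bind f)
  | op next, f => op (next.bind f)

instance : Monad (Prog S W V) where
  pure := ret
  bind := bind

/-- One elementary operation with result `a`: reading or writing a table entry, evaluating a hash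
function, comparing two items, one (conditional) XOR of bits or of seeds, one group operation,
one conversion of a string to a group element. -/
def prim (a : α) : Prog S W V α := op (ret a)

/-- One call of the first generator. -/
def expand (b : Bool) (s : S) : Prog S W V W := callG b s ret

/-- One call of the second generator. -/
def expandBlock (b : Bool) (s : S) : Prog S W V V := callG' b s ret

/-- Result of a program. -/
def run (G : S → W) (G' : S → V) : Prog S W V α → α
  | ret a => a
  | callG _ s next => (next (G s)).run G G'
  | callG' _ s next => (next (G' s)).run G G'
  | op next => next.run G G'

/-- Number of calls of the first generator on seeds of server `c`. -/
def callsG (G : S → W) (G' : S → V) (c : Bool) : Prog S W V α → ℕ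
  | ret _ => 0
  | callG b s next => (next (G s)).callsG G G' c + (if b = c then 1 else 0)
  | callG' _ s next => (next (G' s)).callsG G G' c
  | op next => next.callsG G G' c

/-- Number of calls of the second generator on seeds of server `c`. -/
def callsG' (G : S → W) (G' : S → V) (c : Bool) : Prog S W V α → ℕ
  | ret _ => 0
  | callG _ s next => (next (G s)).callsG' G G' c
  | callG' b s next => (next (G' s)).callsG' G G' c + (if b = c then 1 else 0)
  | op next => next.callsG' G G' c

/-- Number of elementary operations. -/
def ops (G : S → W) (G' : S → V) : Prog S W V α → ℕ
  | ret _ => 0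
  | callG _ s next => (next (G s)).ops G G'
  | callG' _ s next => (next (G' s)).ops G G'
  | op next => next.ops G G' + 1

/-- Run a program for every index in `Fin n` and collect the results. -/
def forFin : (n : ℕ) → (Fin n → Prog S W V α) → Prog S W V (Fin n → α)
  | 0, _ => ret Fin.elim0
  | n + 1, f => do
    let a ← f 0
    let r ← forFin n (fun i => f i.succ)
    ret (Fin.cons (α := fun _ => α) a r)

/-- Membership in a list by successive comparisons. -/
def mem {X : Type} [DecidableEq X] (a : X) : List X → Prog S W V Bool
  | [] => ret false
  | b :: l => do
    let e ← prim (decide (a = b))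
    if e then ret true else mem a l

/-- Remove repetitions from a list. -/
def dedup {X : Type} [DecidableEq X] : List X → Prog S W V (List X)
  | [] => ret []
  | a :: l => do
    let r ← dedup l
    let e ← mem a r
    ret (if e then r else a :: r)

/-- Test that a list has no repetitions. -/
def nodup {X : Type} [DecidableEq X] : List X → Prog S W V Bool
  | [] => ret true
  | a :: l => do
    let e ← mem a l
    if e then ret false else nodup l

/-! ### Cuckoo hashing with two hash functions

Given the pairs of hash values `h x false`, `h x true` of the items `x` of a list, find a choice
`g x` for each item such that the locations `h x (g x)` are pairwise distinct. A partial assignment is a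
list of triples (item, choice, location). -/

variable {X : Type} [DecidableEq X] {n : ℕ}

/-- If `y` is unassigned and one of its two locations is taken, assign it to the other one. -/
def forceItem (h : X → Bool → Fin n) (P : List (X × Bool × Fin n)) (y : X) :
    Prog S W V (List (X × Bool × Fin n)) := do
  let assigned ← mem y (P.map (fun e => e.1))
  if assigned then ret P else do
    let a0 ← prim (h y false)
    let a1 ← prim (h y true)
    let o0 ← mem a0 (P.map (fun e => e.2.2))
    if o0 then ret ((y, true, a1) :: P) else do
      let o1 ← mem a1 (P.map (fun e => e.2.2))
      if o1 then ret ((y, false, a0) :: P) else ret P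

/-- `forceItem` for all items, repeated a given number of times. -/
def propagate (h : X → Bool → Fin n) (L : List X) :
    ℕ → List (X × Bool × Fin n) → Prog S W V (List (X × Bool × Fin n))
  | 0, P => ret P
  | r + 1, P => do
    let P' ← L.foldlM (forceItem h) P
    propagate h L r P'

/-- Assign `x`, if it is not assigned yet, to its first location and otherwise to its second one,
moving all items that are displaced; fail if both lead to a collision. -/
def insertItem (h : X → Bool → Fin n) (L : List X) (st : Option (List (X × Bool × Fin n))) (x : X) :
    Prog S W V (Option (List (X × Bool × Fin n))) :=
  match st with
  | none => ret none
  | some P => do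
    let assigned ← mem x (P.map (fun e => e.1))
    if assigned then ret (some P) else do
      let a0 ← prim (h x false)
      let P0 ← propagate h L L.length ((x, false, a0) :: P)
      let ok0 ← nodup (P0.map (fun e => e.2.2))
      if ok0 then ret (some P0) else do
        let a1 ← prim (h x true)
        let P1 ← propagate h L L.length ((x, true, a1) :: P)
        let ok1 ← nodup (P1.map (fun e => e.2.2))
        ret (if ok1 then some P1 else none)

/-- The choice function `g` for the items of `L`, or `none` if cuckoo hashing fails. -/
def cuckoo (h : X → Bool → Fin n) (L : List X) : Prog S W V (Option (X → Bool)) := do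
  let res ← L.foldlM (insertItem h L) (some [])
  match res with
  | none => ret none
  | some P => do
    let g ← P.foldlM (fun t e => prim (Function.update t e.1 e.2.1)) (fun _ => false)
    ret (some g)

end Prog

/-! ## The scheme

Parameters: security parameter `lam`, tree depth `d`, sparsity `k`, block size `B`, output group `Gr`.
Server `0` is `false`, server `1` is `true`. A tree node of depth `i` is an element of `Bits i`. The
input domain is `Bits d × Fin B`. There are `3 * k` correction words per layer. -/

namespace DPF

open Prog

/-- The `k`-block-sparse function with value `β ℓ j` at `(α ℓ, j)` and `0` elsewhere (the `α ℓ` being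
pairwise distinct). -/
def blockSparse {d k B : ℕ} {Gr : Type} [AddCommGroup Gr]
    (α : Fin k → Bits d) (β : Fin k → Fin B → Gr) (x : Bits d) (j : Fin B) : Gr :=
  ∑ ℓ : Fin k, if α ℓ = x then β ℓ j else 0

/-- The public hash functions: for each depth `i ≤ d`, two hash values for every node of depth `i`. -/
abbrev Hash (k d : ℕ) : Type := (i : Fin (d + 1)) → Bits i → Bool → Fin (3 * k)

/-- A correction word `(c, m, p)` of an upper layer: seed correction `c`, and bit corrections `m j`,
`p j` for the two children `j`. -/
abbrev CWord (lam : ℕ) : Type := Bits lam × (Bool → Bool) × (Bool → Bool)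

/-- A key: root seed, correction words of the layers `1, …, d`, correction words of the last layer. -/
abbrev Key (lam d k B : ℕ) (Gr : Type) : Type :=
  Bits lam × (Fin d → Fin (3 * k) → CWord lam) × (Fin (3 * k) → Fin B → Gr)

/-- The random choices of key generation: two root seeds and, for every correction word, the random
value used for those of its parts that are not determined by the shared function. -/
abbrev Tape (lam d k B : ℕ) (Gr : Type) : Type :=
  Bits lam × Bits lam × (Fin d → Fin (3 * k) → CWord lam) × (Fin (3 * k) → Fin B → Gr)

/-- What a server holds at a node: a seed and two control bits (`(s, u, q)` for server `0` and
`(t, v, r)` for server `1`). -/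
structure Node (lam : ℕ) where
  seed : Bits lam
  u : Bool
  q : Bool

/-- Programs with access to `G : {0,1}^lam → {0,1}^(2(lam+2))` and
`G' : {0,1}^lam → {0,1}^(B⌈log₂|𝔾|⌉)`. -/
abbrev P (lam B : ℕ) (Gr : Type) [Fintype Gr] (α : Type) : Type :=
  Prog (Bits lam) (Bits (2 * (lam + 2))) (Bits (B * glen Gr)) α

section Parsing

variable {lam : ℕ}

/-- Position `t` in the half of the output of `G` that belongs to child `j`. -/
def halfPos (j : Bool) (t : Fin (lam + 2)) : Fin (2 * (lam + 2)) :=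
  finProdFinEquiv (finTwoEquiv.symm j, t)

/-- Seed part of child `j`: the first `lam` bits of its half. -/
def childSeed (w : Bits (2 * (lam + 2))) (j : Bool) : Bits lam :=
  fun t => w (halfPos j (Fin.castAdd 2 t))

/-- First control bit of child `j`. -/
def childU (w : Bits (2 * (lam + 2))) (j : Bool) : Bool := w (halfPos j (Fin.natAdd lam 0))

/-- Second control bit of child `j`. -/
def childQ (w : Bits (2 * (lam + 2))) (j : Bool) : Bool := w (halfPos j (Fin.natAdd lam 1))

/-- The `j`-th block of `n` bits of a string of `B * n` bits. -/
def chunk {B n : ℕ} (w : Bits (B * n)) (j : Fin B) : Bits n := fun t => w (finProdFinEquiv (j, t))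

/-- The prefix of length `i`. -/
def pre {d : ℕ} (i : ℕ) (h : i ≤ d) (x : Bits d) : Bits i := fun t => x (Fin.castLE h t)

/-- Append one bit. -/
def app {i : ℕ} (x : Bits i) (j : Bool) : Bits (i + 1) := Fin.snoc (α := fun _ => Bool) x j

end Parsing

section Encoding

/-- Concatenation of `a` strings of length `b`. -/
def flatten {a b : ℕ} (f : Fin a → Bits b) : Bits (a * b) :=
  fun t => f (finProdFinEquiv.symm t).1 (finProdFinEquiv.symm t).2

/-- `c ‖ m(0) ‖ p(0) ‖ m(1) ‖ p(1)`. -/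
def encodeCW {lam : ℕ} (w : CWord lam) : Bits (lam + 4) :=
  Fin.append w.1 ![w.2.1 false, w.2.2 false, w.2.1 true, w.2.2 true]

/-- Length of the correction words of all layers. -/
abbrev cwLen (lam d k B : ℕ) (Gr : Type) [Fintype Gr] : ℕ :=
  d * ((3 * k) * (lam + 4)) + (3 * k) * (B * glen Gr)

/-- A key as a bit string: root seed followed by the correction words of all layers. -/
def encodeKey {lam d k B : ℕ} {Gr : Type} [Fintype Gr] (R : GroupRep Gr)
    (κ : Key lam d k B Gr) : Bits (lam + cwLen lam d k B Gr) :=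
  Fin.append κ.1 (Fin.append
    (flatten (fun i => flatten (fun a => encodeCW (κ.2.1 i a))))
    (flatten (fun a => flatten (fun j => R.enc (κ.2.2 a j)))))

end Encoding

section Scheme

variable {lam d k B : ℕ} {Gr : Type} [AddCommGroup Gr] [Fintype Gr]

/-- The corrected node of child `j`: the expansion `w` of a node `nd` with the two correction words of
that node applied according to its control bits. -/
def correctChild (w : Bits (2 * (lam + 2))) (nd : Node lam) (c0 c1 : CWord lam) (j : Bool) :
    P lam B Gr (Node lam) := do
  let s ← prim (fun t => xor (childSeed w j t) (nd.u && c0.1 t))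
  let s ← prim (fun t => xor (s t) (nd.q && c1.1 t))
  let u ← prim (xor (childU w j) (nd.u && c0.2.1 j))
  let u ← prim (xor u (nd.q && c1.2.1 j))
  let q ← prim (xor (childQ w j) (nd.u && c0.2.2 j))
  let q ← prim (xor q (nd.q && c1.2.2 j))
  ret ⟨s, u, q⟩

/-! ### Key generation -/

/-- The distinct prefixes of length `i` of the given points. -/
def prefixes (pts : List (Bits d)) (i : ℕ) (h : i ≤ d) : P lam B Gr (List (Bits i)) :=
  Prog.dedup (pts.map (pre i h))

/-- Cuckoo hashing in the layers of depth `< n`; `none` if it fails in one of them. -/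
def assignments (ρ : Hash k d) (pts : List (Bits d)) :
    (n : ℕ) → n ≤ d + 1 → P lam B Gr (Option ((i : ℕ) → Bits i → Bool))
  | 0, _ => ret (some (fun _ _ => false))
  | n + 1, h => do
    let prev ← assignments ρ pts n (Nat.le_of_succ_le h)
    match prev with
    | none => ret none
    | some g => do
      let L ← prefixes pts n (Nat.le_of_succ_le_succ h)
      let res ← Prog.cuckoo (ρ ⟨n, h⟩) L
      match res with
      | none => ret none
      | some gn => ret (some (Function.update g n gn))

/-- The correction word of the node `x` with expansions `w false`, `w true`. The flag `has j` tells
whether the child `j` is a prefix of a shared point, `rnd` is a random seed. -/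
def correctionWord {i : ℕ} (x : Bits i) (w : Bool → Bits (2 * (lam + 2))) (has : Bool → Bool)
    (gnext : Bits (i + 1) → Bool) (rnd : Bits lam) : P lam B Gr (CWord lam) := do
  let c ← prim (if has false && has true then rnd
    else if has false then fun t => xor (childSeed (w false) true t) (childSeed (w true) true t)
    else fun t => xor (childSeed (w false) false t) (childSeed (w true) false t))
  let bit (j : Bool) : P lam B Gr (Bool × Bool) := do
    let m ← prim (xor (childU (w false) j) (childU (w true) j))
    let p ← prim (xor (childQ (w false) j) (childQ (w true) j))
    let m ← prim (xor m (has j && !gnext (app x j)))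
    let p ← prim (xor p (has j && gnext (app x j)))
    ret (m, p)
  let b0 ← bit false
  let b1 ← bit true
  ret (c, (fun j => if j then b1.1 else b0.1), (fun j => if j then b1.2 else b0.2))

/-- One layer: from the values of both servers at the nodes `L` of depth `i`, compute the correction
words (starting from a table of random ones) and the values at the nodes `L'` of depth `i + 1`. -/
def genNext {i : ℕ} (ρ : Bits i → Bool → Fin (3 * k)) (g : Bits i → Bool)
    (gnext : Bits (i + 1) → Bool) (L : List (Bits i)) (L' : List (Bits (i + 1)))
    (rnd : Fin (3 * k) → CWord lam) (st : Bits i → Bool → Node lam) :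
    P lam B Gr ((Fin (3 * k) → CWord lam) × (Bits (i + 1) → Bool → Node lam)) := do
  let E ← L.foldlM (fun (E : Bits i → Bool → Bits (2 * (lam + 2))) x => do
    let w0 ← expand false (st x false).seed
    let w1 ← expand true (st x true).seed
    prim (Function.update E x (fun b => if b then w1 else w0))) (fun _ _ _ => false)
  let cw ← L.foldlM (fun (cw : Fin (3 * k) → CWord lam) x => do
    let a ← prim (ρ x (g x))
    let h0 ← Prog.mem (app x false) L'
    let h1 ← Prog.mem (app x true) L'
    let word ← correctionWord x (E x) (fun j => if j then h1 else h0) gnext (rnd a).1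
    prim (Function.update cw a word)) rnd
  let st' ← L.foldlM (fun (st' : Bits (i + 1) → Bool → Node lam) x => do
    let c0 ← prim (cw (ρ x false))
    let c1 ← prim (cw (ρ x true))
    let child (j : Bool) (st' : Bits (i + 1) → Bool → Node lam) :
        P lam B Gr (Bits (i + 1) → Bool → Node lam) := do
      let has ← Prog.mem (app x j) L'
      if has then do
        let n0 ← correctChild (E x false) (st x false) c0 c1 j
        let n1 ← correctChild (E x true) (st x true) c0 c1 j
        prim (Function.update st' (app x j) (fun b => if b then n1 else n0))
      else ret st'
    let st' ← child false st'
    child true st') (fun _ _ => ⟨fun _ => false, false, false⟩)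
  ret (cw, st')

/-- The layers `1, …, n`: correction words (those of later layers still random) and the values of both
servers at the nodes of depth `n`. The root has equal control bits except for the one selected by `g`. -/
def genLayers (ρ : Hash k d) (g : (i : ℕ) → Bits i → Bool) (pts : List (Bits d))
    (ω : Tape lam d k B Gr) : (n : ℕ) → n ≤ d →
    P lam B Gr ((Fin d → Fin (3 * k) → CWord lam) × (Bits n → Bool → Node lam))
  | 0, _ => do
    let sel ← prim (g 0 Fin.elim0)
    let s0 ← prim ω.1
    let t0 ← prim ω.2.1
    ret (ω.2.2.1, fun _ b => if b then ⟨t0, !sel, sel⟩ else ⟨s0, false, false⟩)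
  | n + 1, h => do
    let prev ← genLayers ρ g pts ω n (Nat.le_of_succ_le h)
    let L ← prefixes pts n (Nat.le_of_succ_le h)
    let L' ← prefixes pts (n + 1) h
    let rnd ← forFin (3 * k) (fun a => prim (prev.1 ⟨n, h⟩ a))
    let res ← genNext (ρ ⟨n, Nat.lt_succ_of_lt h⟩) (g n) (g (n + 1)) L L' rnd prev.2
    let cw ← prim (Function.update prev.1 ⟨n, h⟩ res.1)
    ret (cw, res.2)

/-- The last layer: the correction words (starting from a table of random ones) that turn the expanded
leaf seeds of the given points into shares of the given blocks. -/
def genLast (R : GroupRep Gr) (ρ : Bits d → Bool → Fin (3 * k)) (g : Bits d → Bool)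
    (items : List (Bits d × (Fin B → Gr))) (rnd : Fin (3 * k) → Fin B → Gr)
    (st : Bits d → Bool → Node lam) : P lam B Gr (Fin (3 * k) → Fin B → Gr) :=
  items.foldlM (fun cw e => do
    let x := e.1
    let w0 ← expandBlock false (st x false).seed
    let w1 ← expandBlock true (st x true).seed
    let sel ← prim (g x)
    let a ← prim (ρ x sel)
    let sign ← prim (if sel then (st x true).q else (st x true).u)
    let word ← forFin B (fun j => do
      let s ← prim (R.convert (chunk w0 j))
      let t ← prim (R.convert (chunk w1 j))
      let γ ← prim (e.2 j - s)
      let γ ← prim (γ + t)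
      prim (if sign then -γ else γ))
    prim (Function.update cw a word)) rnd

/-- Key generation for given points, blocks and assignment of correction words. The results are the keys
of the two servers and the choice made for the root. -/
def genWith (R : GroupRep Gr) (ρ : Hash k d) (g : (i : ℕ) → Bits i → Bool)
    (items : List (Bits d × (Fin B → Gr))) (ω : Tape lam d k B Gr) :
    P lam B Gr ((Bool → Key lam d k B Gr) × Bool) := do
  let layers ← genLayers ρ g (items.map (fun e => e.1)) ω d le_rfl
  let rnd ← forFin (3 * k) (fun a => forFin B (fun j => prim (ω.2.2.2 a j)))
  let last ← genLast R (ρ ⟨d, Nat.lt_succ_self d⟩) (g d) items rnd layers.2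
  let sel ← prim (g 0 Fin.elim0)
  ret (fun b => (if b then ω.2.1 else ω.1, layers.1, last), sel)

/-- `Gen`. If cuckoo hashing fails in some layer, keys for the zero function are generated: those for a
zero block at an arbitrary single point, for which every assignment is free of collisions. -/
def gen (R : GroupRep Gr) (ρ : Hash k d) (α : Fin k → Bits d) (β : Fin k → Fin B → Gr)
    (ω : Tape lam d k B Gr) : P lam B Gr ((Bool → Key lam d k B Gr) × Bool) := do
  let g ← assignments ρ (List.ofFn α) (d + 1) le_rfl
  match g with
  | some g => genWith R ρ g (List.ofFn (fun ℓ => (α ℓ, β ℓ))) ω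
  | none => genWith R ρ (fun _ _ => false) [(fun _ => false, 0)] ω

/-! ### Evaluation -/

/-- The root node of server `b`; `sel` is the public choice for the root. -/
def root (b sel : Bool) (κ : Key lam d k B Gr) : Node lam := ⟨κ.1, b && !sel, b && sel⟩

/-- The output block of server `b` at a leaf `x` with value `nd`. -/
def leafBlock (R : GroupRep Gr) (ρ : Hash k d) (b : Bool) (κ : Key lam d k B Gr) (x : Bits d)
    (nd : Node lam) : P lam B Gr (Fin B → Gr) := do
  let a0 ← prim (ρ ⟨d, Nat.lt_succ_self d⟩ x false)
  let a1 ← prim (ρ ⟨d, Nat.lt_succ_self d⟩ x true)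
  let w ← expandBlock b nd.seed
  forFin B (fun j => do
    let y ← prim (R.convert (chunk w j))
    let y ← prim (if nd.u then y + κ.2.2 a0 j else y)
    let y ← prim (if nd.q then y + κ.2.2 a1 j else y)
    prim (if b then -y else y))

/-- The expansion of a node `x` of depth `i < d` with value `nd`, and its two correction words. -/
def expandNode (ρ : Hash k d) (b : Bool) (κ : Key lam d k B Gr) (i : ℕ) (h : i < d) (x : Bits i)
    (nd : Node lam) : P lam B Gr (Bits (2 * (lam + 2)) × CWord lam × CWord lam) := do
  let a0 ← prim (ρ ⟨i, Nat.lt_succ_of_lt h⟩ x false)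
  let a1 ← prim (ρ ⟨i, Nat.lt_succ_of_lt h⟩ x true)
  let c0 ← prim (κ.2.1 ⟨i, h⟩ a0)
  let c1 ← prim (κ.2.1 ⟨i, h⟩ a1)
  let w ← expand b nd.seed
  ret (w, c0, c1)

/-- The value of server `b` at the node of depth `i` on the path to `x`. -/
def evalPath (ρ : Hash k d) (b sel : Bool) (κ : Key lam d k B Gr) (x : Bits d) :
    (i : ℕ) → i ≤ d → P lam B Gr (Node lam)
  | 0, _ => ret (root b sel κ)
  | i + 1, h => do
    let nd ← evalPath ρ b sel κ x i (Nat.le_of_succ_le h)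
    let e ← expandNode ρ b κ i h (pre i (Nat.le_of_succ_le h) x) nd
    correctChild e.1 nd e.2.1 e.2.2 (x ⟨i, h⟩)

/-- `Eval`: the share of server `b` of the value at `(x, j)`. -/
def eval (R : GroupRep Gr) (ρ : Hash k d) (b sel : Bool) (κ : Key lam d k B Gr) (x : Bits d)
    (j : Fin B) : P lam B Gr Gr := do
  let nd ← evalPath ρ b sel κ x d le_rfl
  let blk ← leafBlock R ρ b κ x nd
  ret (blk j)

/-- All output blocks below the node `x` of depth `i`, where `m = d - i` layers remain. -/
def evalSub (R : GroupRep Gr) (ρ : Hash k d) (b : Bool) (κ : Key lam d k B Gr) :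
    (m i : ℕ) → i + m = d → Bits i → Node lam → P lam B Gr (Bits m → Fin B → Gr)
  | 0, i, h, x, nd => do
    let blk ← leafBlock R ρ b κ (fun t => x (Fin.cast h.symm t)) nd
    ret (fun _ => blk)
  | m + 1, i, h, x, nd => do
    let e ← expandNode ρ b κ i (by omega) x nd
    let n0 ← correctChild e.1 nd e.2.1 e.2.2 false
    let n1 ← correctChild e.1 nd e.2.1 e.2.2 true
    let l ← evalSub R ρ b κ m (i + 1) (by omega) (app x false) n0
    let r ← evalSub R ρ b κ m (i + 1) (by omega) (app x true) n1
    ret (fun y => if y 0 then r (Fin.tail y) else l (Fin.tail y))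

/-- Evaluation of the full vector by one traversal of the tree. -/
def evalAll (R : GroupRep Gr) (ρ : Hash k d) (b sel : Bool) (κ : Key lam d k B Gr) :
    P lam B Gr (Bits d → Fin B → Gr) :=
  evalSub R ρ b κ d 0 (Nat.zero_add d) Fin.elim0 (root b sel κ)

end Scheme

/-! ### Correctness and security -/

/-- Correctness with error `γ`: for each `k`-block-sparse function and each input, over uniformly random
hash functions and the random choices of `Gen`, the two shares add up to the value of the function with
probability at least `1 - γ`. -/
def CorrectWithError {lam d k B : ℕ} {Gr : Type} [AddCommGroup Gr] [Fintype Gr] (R : GroupRep Gr)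
    (G : Bits lam → Bits (2 * (lam + 2))) (G' : Bits lam → Bits (B * glen Gr)) (γ : ℝ) : Prop :=
  ∀ (α : Fin k → Bits d) (β : Fin k → Fin B → Gr), Function.Injective α →
    ∀ (x : Bits d) (j : Fin B),
      1 - γ ≤ prob (fun z : Hash k d × Tape lam d k B Gr =>
        let out := (gen R z.1 α β z.2).run G G'
        (eval R z.1 false out.2 (out.1 false) x j).run G G' +
          (eval R z.1 true out.2 (out.1 true) x j).run G G' = blockSparse α β x j)

/-- What server `b` receives from `Gen`, as a bit string: its key and the choice for the root. -/
def serverView {lam d k B : ℕ} {Gr : Type} [AddCommGroup Gr] [Fintype Gr] (R : GroupRep Gr)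
    (G : Bits lam → Bits (2 * (lam + 2))) (G' : Bits lam → Bits (B * glen Gr)) (b : Bool)
    (ρ : Hash k d) (α : Fin k → Bits d) (β : Fin k → Fin B → Gr) (ω : Tape lam d k B Gr) :
    Bits (lam + cwLen lam d k B Gr + 1) :=
  let out := (gen R ρ α β ω).run G G'
  Fin.snoc (α := fun _ => Bool) (encodeKey R (out.1 b)) out.2

/-- The simulated view: a uniformly random key `κ`, and the first choice for the root. It depends on
nothing but the parameters. -/
def simView {lam d k B : ℕ} {Gr : Type} [Fintype Gr] (R : GroupRep Gr) (κ : Key lam d k B Gr) :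
    Bits (lam + cwLen lam d k B Gr + 1) :=
  Fin.snoc (α := fun _ => Bool) (encodeKey R κ) false

/-- Security: for each server, all public hash functions (fixed in advance, so that the distinguisher may
depend on them) and all `k`-block-sparse functions, the view of the server is indistinguishable from
the simulated one. -/
def Secure (d k B : ℕ → ℕ) (Gr : ℕ → Type) [∀ l, AddCommGroup (Gr l)] [∀ l, Fintype (Gr l)]
    (R : ∀ l, GroupRep (Gr l)) (G : ∀ l, Bits l → Bits (2 * (l + 2)))
    (G' : ∀ l, Bits l → Bits (B l * glen (Gr l))) : Prop :=
  ∀ (b : Bool) (ρ : ∀ l, Hash (k l) (d l)) (α : ∀ l, Fin (k l) → Bits (d l))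
    (β : ∀ l, Fin (k l) → Fin (B l) → Gr l), (∀ l, Function.Injective (α l)) →
    CompIndist
      (fun l (ω : Tape l (d l) (k l) (B l) (Gr l)) =>
        serverView (R l) (G l) (G' l) b (ρ l) (α l) (β l) ω)
      (fun l (κ : Key l (d l) (k l) (B l) (Gr l)) => simView (R l) κ)

end DPF

/-! Correctness. Off the paths to the shared points both servers hold the same node; on a path their
control bits differ in exactly one of the two, the one selected by `g`. In the XOR of the servers'
children every common term cancels, and of the two correction words of a node `x` only the one at `ρ
x (g x)` survives. By its definition it equalizes the seeds of a child that leaves the paths and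
restores the required difference of the control bits. So the invariant descends through the tree
(`xor_children`, `nodes_relation`) as long as the locations chosen in each layer are distinct. At a
shared leaf exactly one server adds the last correction word, which turns the sum of the shares into
the desired block; at any other leaf the shares are opposite. Hence the output is correct whenever
cuckoo hashing succeeds in all layers (`genWith_correct`).

Failure of hashing. Items are edges between their two locations. If an item cannot be inserted,
propagation has collided for both of its orientations, and each collision yields a trail of distinct
edges that returns to itself. The two trails combine to a single one with both ends returning to
inner locations (`exists_doubleReturn`). With `s + 1` edges this imposes `s + 2` independent
equations on the hash values, each of probability `1 / (3k)`, and there are at most `(2k)^(s+1) s²`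
such configurations. Their probabilities sum to at most `2/(9k) · Σ s² (2/3)^s ≤ 20/(3k)`
(`avg_doubleReturn_le`). The root layer has a single item and never fails, so a union bound over the
other `d` layers gives the error `7d/k`.

Costs. All program measures are compatible with sequential composition, so the counts follow the
structure of the programs. Loops are bounded by the number of steps times the cost of a step.

Security. Fix server `b`. In the hybrid at depth `n` the layers above `n` are uniform and the other
server's seeds at the path nodes of depth `n` are uniform. Replacing their expansions under `G` by
uniform strings changes a distinguisher's acceptance probability by at most `k ε`. Once the
expansions are uniform, a measure-preserving exchange of randomness (`swap`, `avg_layer`) shows that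
the correction words of the layer and the other server's seeds one level below are exactly uniform,
which is the hybrid at depth `n + 1`. At the leaves `G'` and `convert` provide uniform blocks, which
hide the last words (`avg_lastCW`). The total loss is `d k ε + k (ε' + B εc)`. The public bit
reveals nothing, because the root is always assigned to its first location. The reductions are
non-uniform: hash functions, choices, points and the fixed randomness are built into the circuit,
and the relation `Comp` counts the remaining gates. -/

set_option linter.unusedSectionVars false

/-! ### Results and costs of composed programs -/

namespace Prog

section Calculus

variable {S W V α β : Type} (G : S → W) (G' : S → V) (c : Bool)

@[simp] theorem run_bind (p : Prog S W V α) (f : α → Prog S W V β) :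
    (p >>= f).run G G' = (f (p.run G G')).run G G' := by
  change (p.bind f).run G G' = _
  induction p with
  | ret a => rfl
  | callG b s next ih => exact ih _
  | callG' b s next ih => exact ih _
  | op next ih => exact ih

@[simp] theorem ops_bind (p : Prog S W V α) (f : α → Prog S W V β) :
    (p >>= f).ops G G' = p.ops G G' + (f (p.run G G')).ops G G' := by
  change (p.bind f).ops G G' = _
  induction p with
  | ret a => simp [bind, ops, run]
  | callG b s next ih => exact ih _
  | callG' b s next ih => exact ih _
  | op next ih => simp only [bind, ops, run, ih]; omega

@[simp] theorem callsG_bind (p : Prog S W V α) (f : α → Prog S W V β) :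
    (p >>= f).callsG G G' c = p.callsG G G' c + (f (p.run G G')).callsG G G' c := by
  change (p.bind f).callsG G G' c = _
  induction p with
  | ret a => simp [bind, callsG, run]
  | callG b s next ih => simp only [bind, callsG, run, ih]; omega
  | callG' b s next ih => exact ih _
  | op next ih => exact ih

@[simp] theorem callsG'_bind (p : Prog S W V α) (f : α → Prog S W V β) :
    (p >>= f).callsG' G G' c = p.callsG' G G' c + (f (p.run G G')).callsG' G G' c := by
  change (p.bind f).callsG' G G' c = _
  induction p with
  | ret a => simp [bind, callsG', run]
  | callG b s next ih => exact ih _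
  | callG' b s next ih => simp only [bind, callsG', run, ih]; omega
  | op next ih => exact ih

@[simp] theorem run_ret (a : α) : (ret a : Prog S W V α).run G G' = a := rfl
@[simp] theorem ops_ret (a : α) : (ret a : Prog S W V α).ops G G' = 0 := rfl
@[simp] theorem callsG_ret (a : α) : (ret a : Prog S W V α).callsG G G' c = 0 := rfl
@[simp] theorem callsG'_ret (a : α) : (ret a : Prog S W V α).callsG' G G' c = 0 := rfl
@[simp] theorem run_pure (a : α) : (pure a : Prog S W V α).run G G' = a := rfl
@[simp] theorem ops_pure (a : α) : (pure a : Prog S W V α).ops G G' = 0 := rfl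
@[simp] theorem callsG_pure (a : α) : (pure a : Prog S W V α).callsG G G' c = 0 := rfl
@[simp] theorem callsG'_pure (a : α) : (pure a : Prog S W V α).callsG' G G' c = 0 := rfl
@[simp] theorem run_prim (a : α) : (prim a : Prog S W V α).run G G' = a := rfl
@[simp] theorem ops_prim (a : α) : (prim a : Prog S W V α).ops G G' = 1 := rfl
@[simp] theorem callsG_prim (a : α) : (prim a : Prog S W V α).callsG G G' c = 0 := rfl
@[simp] theorem callsG'_prim (a : α) : (prim a : Prog S W V α).callsG' G G' c = 0 := rfl
@[simp] theorem run_expand (b : Bool) (s : S) :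
    (expand b s : Prog S W V W).run G G' = G s := rfl
@[simp] theorem ops_expand (b : Bool) (s : S) : (expand b s : Prog S W V W).ops G G' = 0 := rfl
@[simp] theorem callsG_expand (b : Bool) (s : S) :
    (expand b s : Prog S W V W).callsG G G' c = if b = c then 1 else 0 := by
  simp [expand, callsG]
@[simp] theorem callsG'_expand (b : Bool) (s : S) :
    (expand b s : Prog S W V W).callsG' G G' c = 0 := rfl
@[simp] theorem run_expandBlock (b : Bool) (s : S) :
    (expandBlock b s : Prog S W V V).run G G' = G' s := rfl
@[simp] theorem ops_expandBlock (b : Bool) (s : S) :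
    (expandBlock b s : Prog S W V V).ops G G' = 0 := rfl
@[simp] theorem callsG_expandBlock (b : Bool) (s : S) :
    (expandBlock b s : Prog S W V V).callsG G G' c = 0 := rfl
@[simp] theorem callsG'_expandBlock (b : Bool) (s : S) :
    (expandBlock b s : Prog S W V V).callsG' G G' c = if b = c then 1 else 0 := by
  simp [expandBlock, callsG']

@[simp] theorem run_ite (q : Prop) [Decidable q] (x y : Prog S W V α) :
    (if q then x else y).run G G' = if q then x.run G G' else y.run G G' := by
  split <;> rfl
@[simp] theorem ops_ite (q : Prop) [Decidable q] (x y : Prog S W V α) :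
    (if q then x else y).ops G G' = if q then x.ops G G' else y.ops G G' := by
  split <;> rfl
@[simp] theorem callsG_ite (q : Prop) [Decidable q] (x y : Prog S W V α) :
    (if q then x else y).callsG G G' c = if q then x.callsG G G' c else y.callsG G G' c := by
  split <;> rfl
@[simp] theorem callsG'_ite (q : Prop) [Decidable q] (x y : Prog S W V α) :
    (if q then x else y).callsG' G G' c = if q then x.callsG' G G' c else y.callsG' G G' c := by
  split <;> rfl

theorem run_foldlM (f : β → α → Prog S W V β) (L : List α) (s : β) :
    (L.foldlM f s).run G G' = L.foldl (fun s a => (f s a).run G G') s := by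
  induction L generalizing s with
  | nil => rfl
  | cons a L ih => simp [List.foldlM_cons, ih]

/-- A cost bound for a fold whose steps have bounded cost. -/
theorem ops_foldlM_le (f : β → α → Prog S W V β) (L : List α) (s : β) (t : ℕ)
    (I : β → Prop) (hs : I s) (hI : ∀ s a, a ∈ L → I s → I ((f s a).run G G'))
    (ht : ∀ s a, a ∈ L → I s → (f s a).ops G G' ≤ t) :
    (L.foldlM f s).ops G G' ≤ L.length * t := by
  induction L generalizing s with
  | nil => simp
  | cons a L ih =>
    have h1 := ht s a (by simp) hs
    have h2 := ih ((f s a).run G G') (hI s a (by simp) hs)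
      (fun s b hb => hI s b (by simp [hb])) (fun s b hb => ht s b (by simp [hb]))
    simp only [List.foldlM_cons, ops_bind, List.length_cons]
    nlinarith

theorem callsG_foldlM_le (f : β → α → Prog S W V β) (L : List α) (s : β) (t : ℕ)
    (ht : ∀ s a, (f s a).callsG G G' c ≤ t) :
    (L.foldlM f s).callsG G G' c ≤ L.length * t := by
  induction L generalizing s with
  | nil => simp
  | cons a L ih =>
    have h1 := ht s a
    have h2 := ih ((f s a).run G G')
    simp only [List.foldlM_cons, callsG_bind, List.length_cons]
    nlinarith

theorem callsG'_foldlM_le (f : β → α → Prog S W V β) (L : List α) (s : β) (t : ℕ)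
    (ht : ∀ s a, (f s a).callsG' G G' c ≤ t) :
    (L.foldlM f s).callsG' G G' c ≤ L.length * t := by
  induction L generalizing s with
  | nil => simp
  | cons a L ih =>
    have h1 := ht s a
    have h2 := ih ((f s a).run G G')
    simp only [List.foldlM_cons, callsG'_bind, List.length_cons]
    nlinarith

theorem run_forFin (n : ℕ) (f : Fin n → Prog S W V α) :
    (forFin n f).run G G' = fun i => (f i).run G G' := by
  induction n with
  | zero => funext i; exact i.elim0
  | succ n ih =>
    funext i
    refine Fin.cases ?_ (fun j => ?_) i <;> simp [forFin, ih]

theorem ops_forFin (n : ℕ) (f : Fin n → Prog S W V α) (t : ℕ)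
    (ht : ∀ i, (f i).ops G G' = t) : (forFin n f).ops G G' = n * t := by
  induction n with
  | zero => simp [forFin]
  | succ n ih => simp [forFin, ht, ih (fun i => f i.succ) (fun i => ht _)]; ring

theorem callsG_forFin (n : ℕ) (f : Fin n → Prog S W V α)
    (ht : ∀ i, (f i).callsG G G' c = 0) : (forFin n f).callsG G G' c = 0 := by
  induction n with
  | zero => simp [forFin]
  | succ n ih => simp [forFin, ht, ih (fun i => f i.succ) (fun i => ht _)]

theorem callsG'_forFin (n : ℕ) (f : Fin n → Prog S W V α)
    (ht : ∀ i, (f i).callsG' G G' c = 0) : (forFin n f).callsG' G G' c = 0 := by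
  induction n with
  | zero => simp [forFin]
  | succ n ih => simp [forFin, ht, ih (fun i => f i.succ) (fun i => ht _)]

end Calculus

/-! ### Results and costs of the list operations -/

section Lists

variable {S W V X : Type} (G : S → W) (G' : S → V) (c : Bool) [DecidableEq X]

@[simp] theorem run_mem (a : X) (l : List X) :
    (mem a l : Prog S W V Bool).run G G' = decide (a ∈ l) := by
  induction l with
  | nil => simp [mem]
  | cons b l ih =>
    by_cases h : a = b <;> simp [mem, ih, h]

theorem ops_mem_le (a : X) (l : List X) :
    (mem a l : Prog S W V Bool).ops G G' ≤ l.length := by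
  induction l with
  | nil => simp [mem]
  | cons b l ih =>
    by_cases h : a = b <;> simp [mem, h]; omega

@[simp] theorem callsG_mem (a : X) (l : List X) :
    (mem a l : Prog S W V Bool).callsG G G' c = 0 := by
  induction l with
  | nil => simp [mem]
  | cons b l ih => simp [mem, ih]

@[simp] theorem callsG'_mem (a : X) (l : List X) :
    (mem a l : Prog S W V Bool).callsG' G G' c = 0 := by
  induction l with
  | nil => simp [mem]
  | cons b l ih => simp [mem, ih]

theorem run_dedup (l : List X) : (dedup l : Prog S W V (List X)).run G G' = l.dedup := by
  induction l with
  | nil => simp [dedup]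
  | cons a l ih =>
    by_cases h : a ∈ l <;> simp [dedup, ih, h]

theorem length_dedup_le (l : List X) : l.dedup.length ≤ l.length :=
  (List.dedup_sublist l).length_le

theorem ops_dedup_le (l : List X) :
    (dedup l : Prog S W V (List X)).ops G G' ≤ l.length * l.length := by
  induction l with
  | nil => simp [dedup]
  | cons a l ih =>
    have h := ops_mem_le G G' a l.dedup
    have h2 := length_dedup_le l
    simp only [dedup, ops_bind, run_dedup, ops_ret, List.length_cons]
    nlinarith

@[simp] theorem callsG_dedup (l : List X) :
    (dedup l : Prog S W V (List X)).callsG G G' c = 0 := by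
  induction l with
  | nil => simp [dedup]
  | cons a l ih => simp [dedup, ih]

@[simp] theorem callsG'_dedup (l : List X) :
    (dedup l : Prog S W V (List X)).callsG' G G' c = 0 := by
  induction l with
  | nil => simp [dedup]
  | cons a l ih => simp [dedup, ih]

@[simp] theorem run_nodup (l : List X) :
    (nodup l : Prog S W V Bool).run G G' = decide l.Nodup := by
  induction l with
  | nil => simp [nodup]
  | cons a l ih =>
    by_cases h : a ∈ l <;> simp [nodup, ih, h]

theorem ops_nodup_le (l : List X) :
    (nodup l : Prog S W V Bool).ops G G' ≤ l.length * l.length := by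
  induction l with
  | nil => simp [nodup]
  | cons a l ih =>
    have h := ops_mem_le (S := S) (W := W) (V := V) G G' a l
    simp only [nodup, ops_bind, run_mem, List.length_cons]
    by_cases h' : a ∈ l <;> simp [h'] <;> nlinarith

@[simp] theorem callsG_nodup (l : List X) :
    (nodup l : Prog S W V Bool).callsG G G' c = 0 := by
  induction l with
  | nil => simp [nodup]
  | cons a l ih => simp [nodup, ih]

@[simp] theorem callsG'_nodup (l : List X) :
    (nodup l : Prog S W V Bool).callsG' G G' c = 0 := by
  induction l with
  | nil => simp [nodup]
  | cons a l ih => simp [nodup, ih]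

end Lists

end Prog

namespace DPF

open Prog

/-! ### Cost of evaluation, and agreement of full and pointwise evaluation -/

section Evaluation

variable {lam d k B : ℕ} {Gr : Type} [AddCommGroup Gr] [Fintype Gr]

/-- The value computed by `correctChild`. -/
def childNode (w : Bits (2 * (lam + 2))) (nd : Node lam) (c0 c1 : CWord lam) (j : Bool) : Node lam :=
  ⟨fun t => xor (xor (childSeed w j t) (nd.u && c0.1 t)) (nd.q && c1.1 t),
    xor (xor (childU w j) (nd.u && c0.2.1 j)) (nd.q && c1.2.1 j),
    xor (xor (childQ w j) (nd.u && c0.2.2 j)) (nd.q && c1.2.2 j)⟩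

variable (G : Bits lam → Bits (2 * (lam + 2))) (G' : Bits lam → Bits (B * glen Gr)) (c : Bool)

@[simp] theorem run_correctChild (w : Bits (2 * (lam + 2))) (nd : Node lam) (c0 c1 : CWord lam)
    (j : Bool) :
    (correctChild w nd c0 c1 j : P lam B Gr _).run G G' = childNode w nd c0 c1 j := by
  simp [correctChild, childNode]

@[simp] theorem ops_correctChild (w : Bits (2 * (lam + 2))) (nd : Node lam) (c0 c1 : CWord lam)
    (j : Bool) : (correctChild w nd c0 c1 j : P lam B Gr _).ops G G' = 6 := by
  simp [correctChild]

@[simp] theorem callsG_correctChild (w : Bits (2 * (lam + 2))) (nd : Node lam) (c0 c1 : CWord lam)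
    (j : Bool) : (correctChild w nd c0 c1 j : P lam B Gr _).callsG G G' c = 0 := by
  simp [correctChild]

@[simp] theorem callsG'_correctChild (w : Bits (2 * (lam + 2))) (nd : Node lam) (c0 c1 : CWord lam)
    (j : Bool) : (correctChild w nd c0 c1 j : P lam B Gr _).callsG' G G' c = 0 := by
  simp [correctChild]

theorem ops_leafBlock (R : GroupRep Gr) (ρ : Hash k d) (b : Bool) (κ : Key lam d k B Gr)
    (x : Bits d) (nd : Node lam) :
    (leafBlock R ρ b κ x nd).ops G G' = 2 + B * 4 := by
  simp only [leafBlock, ops_bind, ops_prim, ops_expandBlock]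
  rw [ops_forFin G G' B _ 4 (fun i => by simp)]
  omega

theorem callsG_leafBlock (R : GroupRep Gr) (ρ : Hash k d) (b : Bool) (κ : Key lam d k B Gr)
    (x : Bits d) (nd : Node lam) :
    (leafBlock R ρ b κ x nd).callsG G G' c = 0 := by
  simp only [leafBlock, callsG_bind, callsG_prim, callsG_expandBlock]
  rw [callsG_forFin G G' c B _ (fun i => by simp)]

theorem callsG'_leafBlock (R : GroupRep Gr) (ρ : Hash k d) (b : Bool) (κ : Key lam d k B Gr)
    (x : Bits d) (nd : Node lam) :
    (leafBlock R ρ b κ x nd).callsG' G G' c = if b = c then 1 else 0 := by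
  simp only [leafBlock, callsG'_bind, callsG'_prim, callsG'_expandBlock]
  rw [callsG'_forFin G G' c B _ (fun i => by simp)]
  omega

/-- Each level takes four table accesses and the six XORs of `correctChild`, hence the factor 10. -/
theorem evalPath_cost (ρ : Hash k d) (b sel : Bool) (κ : Key lam d k B Gr) (x : Bits d)
    (i : ℕ) (h : i ≤ d) :
    (evalPath ρ b sel κ x i h).ops G G' = 10 * i ∧
    (evalPath ρ b sel κ x i h).callsG G G' c = (if b = c then i else 0) ∧
    (evalPath ρ b sel κ x i h).callsG' G G' c = 0 := by
  induction i with
  | zero => simp [evalPath]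
  | succ i ih =>
    obtain ⟨h1, h2, h3⟩ := ih (Nat.le_of_succ_le h)
    refine ⟨?_, ?_, ?_⟩
    · simp [evalPath, expandNode, h1]; ring
    · simp only [evalPath, expandNode, callsG_bind, h2]; split_ifs <;> simp [*]
    · simp [evalPath, expandNode, h3]

theorem eval_ops (R : GroupRep Gr) (ρ : Hash k d) (b sel : Bool) (κ : Key lam d k B Gr)
    (x : Bits d) (j : Fin B) : (eval R ρ b sel κ x j).ops G G' = 10 * d + (2 + B * 4) := by
  simp [eval, (evalPath_cost G G' b ρ b sel κ x d le_rfl).1, ops_leafBlock]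

theorem eval_callsG (R : GroupRep Gr) (ρ : Hash k d) (b sel : Bool) (κ : Key lam d k B Gr)
    (x : Bits d) (j : Fin B) : ∑ c, (eval R ρ b sel κ x j).callsG G G' c = d := by
  simp [eval, (evalPath_cost G G' _ ρ b sel κ x d le_rfl).2.1, callsG_leafBlock]

theorem eval_callsG' (R : GroupRep Gr) (ρ : Hash k d) (b sel : Bool) (κ : Key lam d k B Gr)
    (x : Bits d) (j : Fin B) : ∑ c, (eval R ρ b sel κ x j).callsG' G G' c = 1 := by
  simp [eval, (evalPath_cost G G' _ ρ b sel κ x d le_rfl).2.2, callsG'_leafBlock]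

/-- An inner node takes four table accesses and two corrections of six operations. Adding 16 to the
count makes the recursion homogeneous: the sum doubles with each level, starting from `18 + 4B` at a
leaf. -/
theorem evalSub_cost (R : GroupRep Gr) (ρ : Hash k d) (b : Bool) (κ : Key lam d k B Gr)
    (m i : ℕ) (h : i + m = d) (x : Bits i) (nd : Node lam) :
    (evalSub R ρ b κ m i h x nd).ops G G' + 16 = 2 ^ m * (18 + B * 4) ∧
    (evalSub R ρ b κ m i h x nd).callsG G G' c = (if b = c then 2 ^ m - 1 else 0) ∧
    (evalSub R ρ b κ m i h x nd).callsG' G G' c = (if b = c then 2 ^ m else 0) := by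
  induction m generalizing i nd with
  | zero => simp [evalSub, ops_leafBlock, callsG_leafBlock, callsG'_leafBlock]; ring
  | succ m ih =>
    have hl := fun nd => ih (i + 1) (by omega) (app x false) nd
    have hr := fun nd => ih (i + 1) (by omega) (app x true) nd
    have hp : 1 ≤ 2 ^ m := Nat.one_le_two_pow
    refine ⟨?_, ?_, ?_⟩
    · have h1 : ∀ nd, _ = 2 ^ m * (18 + B * 4) - 16 := fun nd => Nat.eq_sub_of_add_eq (hl nd).1
      have h2 : ∀ nd, _ = 2 ^ m * (18 + B * 4) - 16 := fun nd => Nat.eq_sub_of_add_eq (hr nd).1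
      simp only [evalSub, expandNode, ops_bind, ops_prim, ops_expand, ops_ret, ops_correctChild,
        h1, h2, pow_succ]
      have : 18 ≤ 2 ^ m * (18 + B * 4) := by nlinarith
      rw [mul_right_comm]
      omega
    · simp only [evalSub, expandNode, callsG_bind, callsG_prim, callsG_expand, callsG_ret,
        callsG_correctChild, (hl _).2.1, (hr _).2.1, pow_succ]
      split_ifs <;> omega
    · simp only [evalSub, expandNode, callsG'_bind, callsG'_prim, callsG'_expand, callsG'_ret,
        callsG'_correctChild, (hl _).2.2, (hr _).2.2, pow_succ]
      split_ifs <;> omega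

theorem evalAll_cost (R : GroupRep Gr) (ρ : Hash k d) (b sel : Bool) (κ : Key lam d k B Gr) :
    (evalAll R ρ b sel κ).ops G G' ≤ 2 ^ d * (18 + B * 4) ∧
    ∑ c, (evalAll R ρ b sel κ).callsG G G' c ≤ 2 ^ d ∧
    ∑ c, (evalAll R ρ b sel κ).callsG' G G' c = 2 ^ d := by
  have h := fun c => evalSub_cost G G' c R ρ b κ d 0 (Nat.zero_add d) Fin.elim0 (root b sel κ)
  refine ⟨?_, ?_, ?_⟩
  · have := (h b).1; rw [evalAll]; omega
  · simp [evalAll, (h _).2.1]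
  · simp [evalAll, (h _).2.2]

theorem app_pre (x : Bits d) (i : ℕ) (h : i + 1 ≤ d) :
    app (pre i (Nat.le_of_succ_le h) x) (x ⟨i, h⟩) = pre (i + 1) h x := by
  funext t
  refine Fin.lastCases ?_ (fun t => ?_) t
  · simp [app, pre]; rfl
  · simp [app, pre]

/-- The traversal is followed along the path to one leaf `z`; `y` is the part of `z` still to be
read. Its first bit decides which subtree contains `z`, and the induction continues there with the
node that `evalPath` computes. -/
theorem run_evalSub (R : GroupRep Gr) (ρ : Hash k d) (b sel : Bool) (κ : Key lam d k B Gr)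
    (z : Bits d) (m i : ℕ) (h : i + m = d) (y : Bits m)
    (hy : ∀ t : Fin m, y t = z ⟨i + t, by omega⟩) :
    (evalSub R ρ b κ m i h (pre i (by omega) z)
      ((evalPath ρ b sel κ z i (by omega)).run G G')).run G G' y =
    (leafBlock R ρ b κ z ((evalPath ρ b sel κ z d le_rfl).run G G')).run G G' := by
  induction m generalizing i with
  | zero =>
    obtain rfl : i = d := h
    simp only [evalSub, run_bind, run_ret]
    rfl
  | succ m ih =>
    have h0 := hy 0
    have ih' := ih (i + 1) (by omega) (Fin.tail y) (fun t => by
      simp only [Fin.tail, hy]; congr 2; simp; omega)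
    have e1 := app_pre z i (by omega)
    simp only [evalSub, run_bind, run_ret, run_correctChild]
    simp only [evalPath, run_bind, run_correctChild, ← e1] at ih'
    simp only [Fin.val_zero, add_zero] at h0
    rw [h0]
    cases hz : z ⟨i, by omega⟩
    · simpa [hz] using ih'
    · simpa [hz] using ih'

theorem run_evalAll (R : GroupRep Gr) (ρ : Hash k d) (b sel : Bool) (κ : Key lam d k B Gr)
    (x : Bits d) (j : Fin B) :
    (evalAll R ρ b sel κ).run G G' x j = (eval R ρ b sel κ x j).run G G' := by
  have h := run_evalSub G G' R ρ b sel κ x d 0 (Nat.zero_add d) x (fun t => by simp)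
  have e : pre 0 (Nat.zero_le d) x = Fin.elim0 := by funext t; exact t.elim0
  simp only [evalAll, eval, run_bind, run_ret]
  rw [← h, e]
  rfl

end Evaluation

/-! ### Length and faithfulness of the encoding of keys -/

section KeySize

variable {lam d k B : ℕ} {Gr : Type} [Fintype Gr]

theorem flatten_injective {a b : ℕ} : Function.Injective (flatten : (Fin a → Bits b) → Bits (a * b)) := by
  intro f g h
  funext i t
  have := congrFun h (finProdFinEquiv (i, t))
  simpa [flatten] using this

theorem fin_append_injective {m n : ℕ} {x x' : Bits m} {y y' : Bits n}
    (h : Fin.append x y = Fin.append x' y') : x = x' ∧ y = y' := by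
  constructor
  · funext t; simpa using congrFun h (Fin.castAdd n t)
  · funext t; simpa using congrFun h (Fin.natAdd m t)

theorem encodeCW_injective : Function.Injective (encodeCW (lam := lam)) := by
  rintro ⟨c, m, p⟩ ⟨c', m', p'⟩ h
  obtain ⟨h1, h2⟩ := fin_append_injective h
  have e0 := congrFun h2 0
  have e1 := congrFun h2 1
  have e2 := congrFun h2 2
  have e3 := congrFun h2 3
  simp at h1 e0 e1 e2 e3
  subst h1
  have : m = m' := by funext j; cases j <;> assumption
  have : p = p' := by funext j; cases j <;> assumption
  simp_all

/-- All fields have fixed lengths and can be read off again, so the key size is the length of a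
faithful encoding. -/
theorem encodeKey_injective (R : GroupRep Gr) :
    Function.Injective (encodeKey (lam := lam) (d := d) (k := k) (B := B) R) := by
  rintro ⟨s, c, e⟩ ⟨s', c', e'⟩ h
  obtain ⟨h1, h2⟩ := fin_append_injective h
  obtain ⟨h2, h3⟩ := fin_append_injective h2
  have hc : c = c' := by
    funext i a
    exact encodeCW_injective (congrFun (flatten_injective (congrFun (flatten_injective h2) i)) a)
  have he : e = e' := by
    funext i a
    exact R.enc_injective (congrFun (flatten_injective (congrFun (flatten_injective h3) i)) a)
  simp at h1
  simp [h1, hc, he]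

theorem cwLen_eq : lam + cwLen lam d k B Gr =
    lam + (3 * k * d * (lam + 4) + 3 * k * B * Nat.clog 2 (Fintype.card Gr)) := by
  simp only [cwLen, glen]; ring

end KeySize

end DPF

namespace Cuckoo

/-! ### Trails in the cuckoo graph

An item `y` is an edge between the locations `h y false` and `h y true`; the pair `(y, b)` is this edge
directed towards `h y b`. Trails are lists of directed edges, the most recent edge first. -/

variable {X : Type} {n : ℕ} (h : X → Bool → Fin n)

/-- The location a directed edge points to. -/
def hd (e : X × Bool) : Fin n := h e.1 e.2

/-- The location a directed edge starts from. -/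
def tl (e : X × Bool) : Fin n := h e.1 (!e.2)

/-- The reversed edge. -/
def flip (e : X × Bool) : X × Bool := (e.1, !e.2)

@[simp] theorem hd_flip (e : X × Bool) : hd h (flip e) = tl h e := rfl
@[simp] theorem tl_flip (e : X × Bool) : tl h (flip e) = hd h e := by simp [tl, flip, hd]
@[simp] theorem flip_fst (e : X × Bool) : (flip e).1 = e.1 := rfl

/-- A sequence of consecutive edges of items of `L`, most recent first, without repeated items. -/
structure Trail (L : List X) (Q : List (X × Bool)) : Prop where
  chain : Q.IsChain (fun a b => tl h a = hd h b)
  nodup : (Q.map Prod.fst).Nodup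
  mem : ∀ e ∈ Q, e.1 ∈ L

/-- A trail both of whose ends return to one of its inner locations. -/
structure DoubleReturn (L : List X) (a o : X × Bool) (Q : List (X × Bool)) : Prop where
  trail : Trail h L (a :: Q)
  last : Q.getLast? = some o
  hd_mem : hd h a ∈ Q.map (hd h)
  tl_mem : tl h o ∈ Q.map (hd h)

variable {h} {L : List X}

/-- Every edge except the oldest starts at the location its predecessor points to. Thus only the
starting point of the whole trail may be unvisited, in the sense that no older edge points to it. -/
theorem Trail.tl_mem {a : X × Bool} {Q : List (X × Bool)} (hQ : Trail h L (a :: Q))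
    {t : X × Bool} (ht : t ∈ a :: Q) : (a :: Q).getLast? = some t ∨ tl h t ∈ Q.map (hd h) := by
  have hc := hQ.chain
  clear hQ
  induction Q generalizing a with
  | nil => left; simp at ht; simp [ht]
  | cons b Q ih =>
    rw [List.isChain_cons_cons] at hc
    rcases List.mem_cons.1 ht with rfl | ht
    · right; simp [hc.1]
    · rcases ih ht hc.2 with h1 | h1
      · left; simpa using h1
      · right; rw [List.map_cons]; exact List.mem_cons_of_mem _ h1

/-- Every edge except the newest ends where its successor starts. Since reversal exchanges heads and
tails, locations visited by a trail remain visited by the reversed one. -/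
theorem Trail.hd_mem {a : X × Bool} {Q : List (X × Bool)} (hQ : Trail h L (a :: Q))
    {t : X × Bool} (ht : t ∈ Q) : hd h t ∈ (a :: Q).map (tl h) := by
  have hc := hQ.chain
  clear hQ
  induction Q generalizing a with
  | nil => simp at ht
  | cons b Q ih =>
    rw [List.isChain_cons_cons] at hc
    rcases List.mem_cons.1 ht with rfl | ht
    · simp [hc.1]
    · rw [List.map_cons]; exact List.mem_cons_of_mem _ (ih ht hc.2)

theorem Trail.reverse {Q : List (X × Bool)} (hQ : Trail h L Q) :
    Trail h L (Q.reverse.map flip) := by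
  refine ⟨?_, ?_, ?_⟩
  · rw [List.isChain_map, List.isChain_reverse]
    exact hQ.chain.imp (fun a b hab => by simp [hab])
  · have : (Q.reverse.map flip).map Prod.fst = (Q.map Prod.fst).reverse := by
      simp [List.map_reverse]
    rw [this, List.nodup_reverse]; exact hQ.nodup
  · intro e he
    simp only [List.mem_map, List.mem_reverse] at he
    obtain ⟨e, he, rfl⟩ := he
    exact hQ.mem e he

theorem Trail.cons {r u : X × Bool} {R : List (X × Bool)} (hR : Trail h L (r :: R))
    (h1 : tl h u = hd h r) (h2 : u.1 ∉ (r :: R).map Prod.fst) (h3 : u.1 ∈ L) :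
    Trail h L (u :: r :: R) := by
  refine ⟨?_, ?_, ?_⟩
  · rw [List.isChain_cons_cons]; exact ⟨h1, hR.chain⟩
  · rw [List.map_cons, List.nodup_cons]; exact ⟨h2, hR.nodup⟩
  · intro e he
    rcases List.mem_cons.1 he with rfl | he
    · exact h3
    · exact hR.mem e he

/-- Extend a trail along a walk until it returns to a location already visited. -/
theorem Trail.extend (U : List (X × Bool)) :
    ∀ (r o : X × Bool) (R : List (X × Bool)), Trail h L (r :: R) →
      (r :: R).getLast? = some o →
      (r :: U).IsChain (fun a b => tl h b = hd h a) →
      (U.map Prod.fst).Nodup → (∀ u ∈ U, u.1 ∈ L) →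
      (∀ u, U.head? = some u → u.1 ∉ (r :: R).map Prod.fst) →
      (∃ u, U.getLast? = some u ∧ (hd h u ∈ (r :: R).map (hd h) ∨ hd h u ∈ U.dropLast.map (hd h))) →
      ((∀ u ∈ U, u.1 ≠ o.1) ∨ tl h o ∈ (r :: R).map (hd h)) →
      ∃ a Z, Trail h L (a :: (Z ++ r :: R)) ∧ hd h a ∈ (Z ++ r :: R).map (hd h) := by
  induction U with
  | nil => intro r o R _ _ _ _ _ _ ⟨u, hu, _⟩; simp at hu
  | cons u U ih =>
    intro r o R hR ho hc hn hL hu hlast hcond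
    rw [List.isChain_cons_cons] at hc
    have hR' : Trail h L (u :: r :: R) := hR.cons hc.1 (hu u rfl) (hL u (by simp))
    -- Visited locations are the heads of the edges of the trail. If `u` returns to one of them, the
    -- extension ends here.
    by_cases hin : hd h u ∈ (r :: R).map (hd h)
    · exact ⟨u, [], hR', hin⟩
    cases U with
    | nil =>
      obtain ⟨v, hv, hv'⟩ := hlast
      simp at hv; subst hv
      rcases hv' with h1 | h1
      · exact absurd h1 hin
      · simp at h1
    | cons v U =>
      have hn' := List.nodup_cons.1 hn
      suffices hx : ∃ a Z, Trail h L (a :: (Z ++ u :: r :: R)) ∧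
          hd h a ∈ (Z ++ u :: r :: R).map (hd h) by
        obtain ⟨a, Z, h1, h2⟩ := hx
        refine ⟨a, Z ++ [u], ?_, ?_⟩ <;> rw [List.append_assoc]
        · exact h1
        · exact h2
      refine ih u o (r :: R) hR' (by simpa using ho) hc.2 hn'.2
        (fun w hw => hL w (List.mem_cons_of_mem _ hw)) ?_ ?_ ?_
      · intro w hw
        simp at hw; subst hw
        intro hmem
        rw [List.map_cons, List.mem_cons] at hmem
        rcases hmem with hmem | hmem
        · exact hn'.1 (by simp [hmem])
        · have htl : tl h v = hd h u := (List.isChain_cons_cons.1 hc.2).1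
          obtain ⟨t, ht, hte⟩ := List.mem_map.1 hmem
          -- The next edge `v` starts at the unvisited location `hd h u`. If its item were that of
          -- an edge `t` of the trail, this location would be the head or the tail of `t`. Heads are
          -- visited, and so are tails except possibly that of the oldest edge `o`, which the last
          -- hypothesis takes care of.
          have hdir : tl h v = hd h t ∨ (tl h v = tl h t) := by
            obtain ⟨y, b⟩ := v; obtain ⟨y', b'⟩ := t
            simp only at hte; subst hte
            cases b <;> cases b' <;> simp [hd, tl]
          rcases hdir with h1 | h1
          · exact hin (htl ▸ h1 ▸ List.mem_map_of_mem ht)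
          · rcases hR.tl_mem ht with h2 | h2
            · rw [ho] at h2
              simp only [Option.some.injEq] at h2
              subst h2
              rcases hcond with h3 | h3
              · exact h3 v (by simp) hte.symm
              · exact hin (htl ▸ h1 ▸ h3)
            · refine hin (htl ▸ h1 ▸ ?_)
              rw [List.map_cons]; exact List.mem_cons_of_mem _ h2
      · obtain ⟨w, hw, hw'⟩ := hlast
        refine ⟨w, by simpa using hw, ?_⟩
        rcases hw' with h1 | h1
        · exact Or.inl (List.mem_cons_of_mem _ h1)
        · rw [List.dropLast_cons_of_ne_nil (by simp), List.map_cons, List.mem_cons] at h1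
          rcases h1 with h1 | h1
          · exact Or.inl (List.mem_cons.2 (Or.inl h1))
          · exact Or.inr h1
      · rcases hcond with h3 | h3
        · left; exact fun w hw => h3 w (List.mem_cons_of_mem _ hw)
        · right; rw [List.map_cons]; exact List.mem_cons_of_mem _ h3

variable (h) in
/-- Sets of directed edges obtained from `e` by successively adding edges that start from a location
reached before, newest first. -/
inductive Grown (L : List X) (e : X × Bool) : List (X × Bool) → Prop
  | base : e.1 ∈ L → Grown L e [e]
  | step {Q : List (X × Bool)} {u : X × Bool} : Grown L e Q → u.1 ∈ L → u.1 ∉ Q.map Prod.fst →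
      tl h u ∈ Q.map (hd h) → Grown L e (u :: Q)

theorem Grown.nodup {e : X × Bool} {Q : List (X × Bool)} (hQ : Grown h L e Q) :
    (Q.map Prod.fst).Nodup := by
  induction hQ with
  | base => simp
  | step _ _ h2 _ ih => rw [List.map_cons, List.nodup_cons]; exact ⟨h2, ih⟩

theorem Grown.mem {e : X × Bool} {Q : List (X × Bool)} (hQ : Grown h L e Q) :
    ∀ u ∈ Q, u.1 ∈ L := by
  induction hQ with
  | base h1 => simpa using h1
  | step _ h1 _ _ ih =>
    intro v hv
    rcases List.mem_cons.1 hv with rfl | hv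
    · exact h1
    · exact ih v hv

/-- Each edge starts at a location reached by an older one; going back from edge to edge leads to
`e` inside `Q`. -/
theorem Grown.exists_trail {e : X × Bool} {Q : List (X × Bool)} (hQ : Grown h L e Q)
    {u : X × Bool} (hu : u ∈ Q) :
    ∃ T, Trail h L (u :: T) ∧ (u :: T).getLast? = some e ∧ ∀ t ∈ u :: T, t ∈ Q := by
  induction hQ generalizing u with
  | base h1 =>
    simp at hu; subst hu
    exact ⟨[], ⟨by simp, by simp, by simpa using h1⟩, by simp, by simp⟩
  | @step Q v hQ h1 h2 h3 ih =>
    rcases List.mem_cons.1 hu with rfl | hu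
    · obtain ⟨p, hp, hp'⟩ := List.mem_map.1 h3
      obtain ⟨T, hT, hT2, hT3⟩ := ih hp
      refine ⟨p :: T, hT.cons hp'.symm ?_ h1, by simpa using hT2, ?_⟩
      · intro hm
        obtain ⟨t, ht, hte⟩ := List.mem_map.1 hm
        exact h2 (hte ▸ List.mem_map_of_mem (hT3 t ht))
      · intro t ht
        rcases List.mem_cons.1 ht with rfl | ht
        · simp
        · exact List.mem_cons_of_mem _ (hT3 t ht)
    · obtain ⟨T, hT, hT2, hT3⟩ := ih hu
      exact ⟨T, hT, hT2, fun t ht => List.mem_cons_of_mem _ (hT3 t ht)⟩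

theorem eq_append_of_getLast? {α : Type} {l : List α} {a : α} (hl : l.getLast? = some a) :
    ∃ m, l = m ++ [a] := ⟨l.dropLast, (List.dropLast_append_getLast? a hl).symm⟩

/-- If two of the edges point to the same location, there is a trail that returns to itself. -/
theorem Grown.exists_return {e : X × Bool} {Q : List (X × Bool)} (hQ : Grown h L e Q)
    (hcol : ¬ (Q.map (hd h)).Nodup) :
    ∃ a T, Trail h L (a :: T) ∧ T.getLast? = some e ∧ hd h a ∈ T.map (hd h) := by
  have key : ∀ a T, Trail h L (a :: T) → (a :: T).getLast? = some e → hd h a ∈ T.map (hd h) →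
      ∃ a T, Trail h L (a :: T) ∧ T.getLast? = some e ∧ hd h a ∈ T.map (hd h) := by
    intro a T h1 h2 h3
    cases T with
    | nil => simp at h3
    | cons b T => exact ⟨a, b :: T, h1, by simpa using h2, h3⟩
  induction hQ with
  | base => simp at hcol
  | @step Q z hQ h1 h2 h3 ih =>
    -- Take the first edge `z` whose addition creates a collision.
    by_cases hn : (Q.map (hd h)).Nodup
    · have hz : hd h z ∈ Q.map (hd h) := by
        by_contra hz; exact hcol (by rw [List.map_cons, List.nodup_cons]; exact ⟨hz, hn⟩)
      obtain ⟨f, hf, hfz⟩ := List.mem_map.1 hz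
      obtain ⟨p, hp, hp'⟩ := List.mem_map.1 h3
      obtain ⟨T, hT, hT2, hT3⟩ := hQ.exists_trail hp
      have hzT : Trail h L (z :: p :: T) := by
        refine hT.cons hp'.symm (fun hm => ?_) h1
        obtain ⟨t, ht, hte⟩ := List.mem_map.1 hm
        exact h2 (hte ▸ List.mem_map_of_mem (hT3 t ht))
      -- If the edge `f` that `z` collides with lies on the trail to `z`, this trail already returns
      -- to itself. Otherwise it is continued backwards along the trail from `e` to `f`, leaving out
      -- `e`, until a visited location is met; this happens at the latest at the head of `e`.
      by_cases hfT : f ∈ p :: T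
      · exact key z (p :: T) hzT (by simpa using hT2) (hfz ▸ List.mem_map_of_mem hfT)
      obtain ⟨T2, hU, hU2, hU3⟩ := hQ.exists_trail hf
      obtain ⟨U, hUeq⟩ := eq_append_of_getLast? hU2
      have heT : e ∈ p :: T := List.mem_of_getLast? hT2
      cases U with
      | nil =>
        simp at hUeq
        exact absurd (hUeq.1 ▸ heT) hfT
      | cons f' U =>
        simp only [List.cons_append, List.cons.injEq] at hUeq
        obtain ⟨rfl, rfl⟩ := hUeq
        have hU' : Trail h L ((f :: U) ++ [e]) := hU
        suffices hx : ∃ a Z, Trail h L (a :: (Z ++ z :: p :: T)) ∧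
            hd h a ∈ (Z ++ z :: p :: T).map (hd h) by
          obtain ⟨a, Z, hZ1, hZ2⟩ := hx
          refine key a _ hZ1 ?_ hZ2
          rw [List.getLast?_cons, List.getLast?_append, List.getLast?_cons_cons, hT2]
          rfl
        refine Trail.extend ((f :: U).map flip) z e (p :: T) hzT
          (by simpa using hT2) ?_ ?_ ?_ ?_ ?_ ?_
        · rw [List.map_cons, List.isChain_cons_cons]
          refine ⟨by simp [hfz], ?_⟩
          rw [← List.map_cons, List.isChain_map]
          exact (List.isChain_append.1 hU'.chain).1.imp (fun a b hab => by simp [hab])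
        · have := hU'.nodup
          rw [List.map_append, List.nodup_append] at this
          simpa [Function.comp_def] using this.1
        · intro u hu
          obtain ⟨v, hv, rfl⟩ := List.mem_map.1 hu
          exact hU'.mem v (List.mem_append_left _ hv)
        · intro u hu
          simp at hu; subst hu
          rw [List.map_cons, List.mem_cons]
          rintro (hm | hm)
          · exact h2 (hm ▸ List.mem_map.2 ⟨f, hf, rfl⟩)
          · obtain ⟨t, ht, hte⟩ := List.mem_map.1 hm
            have : t = f := List.inj_on_of_nodup_map hQ.nodup (hT3 t ht) hf hte
            exact hfT (this ▸ ht)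
        · obtain ⟨w, hw⟩ : ∃ w, (f :: U).getLast? = some w := ⟨_, List.getLast?_eq_some_getLast (by simp)⟩
          refine ⟨flip w, by rw [List.getLast?_map, hw]; rfl, Or.inl ?_⟩
          obtain ⟨U', hU'e⟩ := eq_append_of_getLast? hw
          rw [hU'e] at hU'
          have h4 := hU'.chain
          rw [List.append_assoc, List.isChain_append] at h4
          have h5 : tl h w = hd h e := (List.isChain_cons_cons.1 h4.2.1).1
          rw [hd_flip, h5]
          exact List.mem_map_of_mem (List.mem_cons_of_mem _ heT)
        · left
          intro u hu
          obtain ⟨v, hv, rfl⟩ := List.mem_map.1 hu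
          have := hU'.nodup
          rw [List.map_append, List.nodup_append] at this
          exact this.2.2 _ (List.mem_map.2 ⟨v, hv, rfl⟩) _ (by simp)
    · exact ih hn

/-- If the trails from an item return for both of its directions, there is a trail with two returns. -/
theorem exists_doubleReturn {e : X × Bool} {a a' : X × Bool} {T T' : List (X × Bool)}
    (hT : Trail h L (a :: T)) (hTl : T.getLast? = some e) (hTr : hd h a ∈ T.map (hd h))
    (hT' : Trail h L (a' :: T')) (hTl' : T'.getLast? = some (flip e))
    (hTr' : hd h a' ∈ T'.map (hd h)) : ∃ a o Q, DoubleReturn h L a o Q := by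
  -- If the first trail also passes through its own starting point, both of its ends return.
  by_cases h0 : tl h e ∈ T.map (hd h)
  · exact ⟨a, e, T, hT, hTl, hTr, h0⟩
  obtain ⟨M, rfl⟩ := eq_append_of_getLast? hTl
  obtain ⟨M', rfl⟩ := eq_append_of_getLast? hTl'
  -- Otherwise the first trail is reversed. Its newest edge is then `flip e`, with which the second
  -- trail begins, and the second trail is appended until it returns to a visited location.
  have hrev : ((a :: (M ++ [e])).reverse.map flip) = flip e :: (M.reverse.map flip ++ [flip a]) := by
    simp
  have hR := hT.reverse
  rw [hrev] at hR
  have hrev' : (a' :: (M' ++ [flip e])).reverse = flip e :: (M'.reverse ++ [a']) := by simp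
  -- The reversed trail passes through its own starting point, because the first trail had returned
  -- to the head of `a`.
  have htla : tl h (flip a) ∈ (flip e :: (M.reverse.map flip ++ [flip a])).map (hd h) := by
    rw [← hrev, tl_flip, List.map_map]
    obtain ⟨t, ht, hte⟩ := List.mem_map.1 hTr
    rw [← hte]
    obtain ⟨s, hs, hse⟩ := List.mem_map.1 (hT.hd_mem ht)
    exact List.mem_map.2 ⟨s, List.mem_reverse.2 hs, by simp [hse]⟩
  have hlast : (flip e :: (M.reverse.map flip ++ [flip a])).getLast? = some (flip a) := by
    rw [List.getLast?_cons, List.getLast?_append]; simp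
  suffices hx : ∃ a2 Z, Trail h L (a2 :: (Z ++ flip e :: (M.reverse.map flip ++ [flip a]))) ∧
      hd h a2 ∈ (Z ++ flip e :: (M.reverse.map flip ++ [flip a])).map (hd h) by
    obtain ⟨a2, Z, h1, h2⟩ := hx
    refine ⟨a2, flip a, _, h1, ?_, h2, ?_⟩
    · rw [List.getLast?_append, hlast]; rfl
    · rw [List.map_append]
      exact List.mem_append_right _ htla
  refine Trail.extend (M'.reverse ++ [a']) (flip e) (flip a)
    (M.reverse.map flip ++ [flip a]) hR hlast ?_ ?_ ?_ ?_ ?_ (Or.inr htla)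
  · rw [← hrev', List.isChain_reverse]
    exact hT'.chain
  · have := hT'.nodup
    rw [← List.nodup_reverse, ← List.map_reverse, hrev', List.map_cons, List.nodup_cons] at this
    exact this.2
  · intro u hu
    refine hT'.mem u ?_
    rw [← List.mem_reverse, hrev']; exact List.mem_cons_of_mem _ hu
  · intro u hu hm
    have hchain : (flip e :: (M'.reverse ++ [a'])).IsChain (fun a b => tl h b = hd h a) := by
      rw [← hrev', List.isChain_reverse]; exact hT'.chain
    have hnd : u.1 ≠ e.1 := by
      have := hT'.nodup
      rw [← List.nodup_reverse, ← List.map_reverse, hrev', List.map_cons, List.nodup_cons] at this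
      intro hue
      exact this.1 (List.mem_map.2 ⟨u, List.mem_of_head? hu, hue⟩)
    have htl : tl h u = tl h e := by
      obtain ⟨v, U, hU⟩ : ∃ v U, M'.reverse ++ [a'] = v :: U := by
        cases M'.reverse <;> simp
      rw [hU] at hu hchain
      simp at hu; subst hu
      exact (List.isChain_cons_cons.1 hchain).1
    rw [← hrev] at hm
    have hm' : u.1 ∈ (a :: (M ++ [e])).map Prod.fst := by
      obtain ⟨t, ht, hte⟩ := List.mem_map.1 hm
      obtain ⟨s, hs, rfl⟩ := List.mem_map.1 ht
      exact List.mem_map.2 ⟨s, List.mem_reverse.1 hs, hte⟩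
    obtain ⟨t, ht, hte⟩ := List.mem_map.1 hm'
    -- The edge `u` starts at `tl h e`. If its item occurred on the first trail, that trail would
    -- visit `tl h e`, contrary to `h0`, unless the item is that of `e`, which the second trail does
    -- not use again.
    have hdir : tl h u = hd h t ∨ (tl h u = tl h t) := by
      obtain ⟨y, b⟩ := u; obtain ⟨y', b'⟩ := t
      simp only at hte; subst hte
      cases b <;> cases b' <;> simp [hd, tl]
    rw [htl] at hdir
    rcases hdir with h1 | h1
    · rcases List.mem_cons.1 ht with rfl | ht
      · exact h0 (h1 ▸ hTr)
      · exact h0 (h1 ▸ List.mem_map_of_mem ht)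
    · rcases hT.tl_mem ht with h2 | h2
      · have : t = e := by
          rw [List.getLast?_cons, hTl] at h2
          simpa using h2.symm
        exact hnd (this ▸ hte.symm)
      · exact h0 (h1 ▸ h2)
  · refine ⟨a', by simp, ?_⟩
    simp only [List.dropLast_concat]
    rw [List.map_append, List.mem_append] at hTr'
    rcases hTr' with h1 | h1
    · right; rw [List.map_reverse]; exact List.mem_reverse.2 h1
    · left
      rw [List.map_cons, List.mem_cons]
      left; simpa using h1

end Cuckoo

/-! ### Insertion by propagation, and what its failure implies -/

namespace Cuckoo

open Prog

variable {S W V X : Type} (G : S → W) (G' : S → V) [DecidableEq X] {n : ℕ} {h : X → Bool → Fin n}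
  {L : List X}

/-- The items of a partial assignment. -/
abbrev items (P : List (X × Bool × Fin n)) : List X := P.map (fun e => e.1)

/-- The locations of a partial assignment. -/
abbrev locs (P : List (X × Bool × Fin n)) : List (Fin n) := P.map (fun e => e.2.2)

variable (h) in
/-- The result of `forceItem`. -/
def force (P : List (X × Bool × Fin n)) (y : X) : List (X × Bool × Fin n) :=
  if y ∈ items P then P
  else if h y false ∈ locs P then (y, true, h y true) :: P
  else if h y true ∈ locs P then (y, false, h y false) :: P else P

theorem run_forceItem (P : List (X × Bool × Fin n)) (y : X) :
    (forceItem h P y : Prog S W V _).run G G' = force h P y := by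
  simp only [forceItem, force, run_bind, run_mem, run_ite, run_ret, run_prim, decide_eq_true_eq]

variable (h) in
/-- The result of one round of `propagate`. -/
def round (L : List X) (P : List (X × Bool × Fin n)) : List (X × Bool × Fin n) :=
  L.foldl (force h) P

theorem run_propagate (r : ℕ) (P : List (X × Bool × Fin n)) :
    (propagate h L r P : Prog S W V _).run G G' = (round h L)^[r] P := by
  induction r generalizing P with
  | zero => rfl
  | succ r ih =>
    simp only [propagate, run_bind, ih, run_foldlM, run_forceItem, Function.iterate_succ,
      Function.comp_apply, round]

theorem force_cases (P : List (X × Bool × Fin n)) (y : X) :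
    force h P y = P ∨ y ∉ items P ∧ ∃ b, h y (!b) ∈ locs P ∧ force h P y = (y, b, h y b) :: P := by
  unfold force
  split_ifs with h1 h2 h3
  · exact Or.inl rfl
  · exact Or.inr ⟨h1, true, h2, rfl⟩
  · exact Or.inr ⟨h1, false, h3, rfl⟩
  · exact Or.inl rfl

theorem force_eq_self {P : List (X × Bool × Fin n)} {y : X} (hf : force h P y = P) (b : Bool)
    (hy : y ∉ items P) : h y b ∉ locs P := by
  unfold force at hf
  rw [if_neg hy] at hf
  split_ifs at hf with h2 h3
  · simp at hf
  · simp at hf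
  · cases b <;> assumption

/-- Forcing an item either changes nothing or adds an entry. A round that adds nothing has therefore
left every item unforced. -/
theorem round_stable (P : List (X × Bool × Fin n)) :
    (∀ y ∈ L, force h P y = P) ∧ round h L P = P ∨ P.length < (round h L P).length := by
  have key : ∀ (M : List X) (P : List (X × Bool × Fin n)),
      ((∀ y ∈ M, force h P y = P) ∧ M.foldl (force h) P = P) ∨
        P.length < (M.foldl (force h) P).length := by
    intro M
    induction M with
    | nil => intro P; left; simp
    | cons y M ih =>
      intro P
      rw [List.foldl_cons]
      rcases force_cases (h := h) P y with h1 | ⟨_, b, _, h1⟩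
      · rw [h1]
        rcases ih P with ⟨h2, h3⟩ | h2
        · left; exact ⟨by simpa [h1] using h2, h3⟩
        · right; exact h2
      · right
        rcases ih (force h P y) with ⟨_, h3⟩ | h2
        · rw [h3, h1]; simp
        · rw [h1] at h2 ⊢; simp at h2; omega
  exact key L P

/-- Every round before stability adds an entry. As there are no more entries than items, `L.length`
rounds will be enough. -/
theorem iterate_round_stable (r : ℕ) (P : List (X × Bool × Fin n)) :
    (∀ y ∈ L, force h ((round h L)^[r] P) y = (round h L)^[r] P) ∨
      P.length + r ≤ ((round h L)^[r] P).length := by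
  induction r with
  | zero => right; simp
  | succ r ih =>
    rw [Function.iterate_succ_apply']
    rcases round_stable (h := h) (L := L) ((round h L)^[r] P) with ⟨h1, h2⟩ | h1
    · left; rw [h2]; exact h1
    · rcases ih with h2 | h2
      · exfalso
        have : round h L ((round h L)^[r] P) = (round h L)^[r] P := by
          unfold round at h2 ⊢
          have key : ∀ (M : List X) (P : List (X × Bool × Fin n)), (∀ y ∈ M, force h P y = P) →
              M.foldl (force h) P = P := by
            intro M
            induction M with
            | nil => intros; rfl
            | cons y M ih =>
              intro P hP
              rw [List.foldl_cons, hP y (by simp)]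
              exact ih P (fun z hz => hP z (by simp [hz]))
          exact key L _ h2
        rw [this] at h1; omega
      · right; omega

/-- Items of `L`, each at most once. -/
def Sub (L : List X) (P : List (X × Bool × Fin n)) : Prop :=
  (items P).Nodup ∧ ∀ y ∈ items P, y ∈ L

theorem Sub.length_le {P : List (X × Bool × Fin n)} (hP : Sub L P) : P.length ≤ L.length := by
  have := (hP.1.subperm (fun y hy => hP.2 y hy)).length_le
  simpa [items] using this

theorem Sub.force {P : List (X × Bool × Fin n)} (hP : Sub L P) {y : X} (hy : y ∈ L) :
    Sub L (force h P y) := by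
  rcases force_cases (h := h) P y with h1 | ⟨h2, b, _, h1⟩
  · rwa [h1]
  · rw [h1]
    refine ⟨by simpa [items] using ⟨by simpa [items] using h2, hP.1⟩, ?_⟩
    intro z hz
    simp only [items, List.map_cons, List.mem_cons] at hz
    rcases hz with rfl | hz
    · exact hy
    · exact hP.2 z hz

theorem foldl_invariant {α β : Type} (f : β → α → β) (I : β → Prop) (M : List α) (s : β) (hs : I s)
    (hI : ∀ s a, a ∈ M → I s → I (f s a)) : I (M.foldl f s) := by
  induction M generalizing s with
  | nil => exact hs
  | cons a M ih => exact ih _ (hI s a (by simp) hs) (fun s b hb => hI s b (by simp [hb]))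

theorem Sub.round {P : List (X × Bool × Fin n)} (hP : Sub L P) : Sub L (round h L P) :=
  foldl_invariant _ (Sub L) L P hP (fun _ _ hy hQ => hQ.force hy)

theorem Sub.iterate {P : List (X × Bool × Fin n)} (hP : Sub L P) (r : ℕ) :
    Sub L ((Cuckoo.round h L)^[r] P) := by
  induction r with
  | zero => exact hP
  | succ r ih => rw [Function.iterate_succ_apply']; exact ih.round

variable (h) in
/-- A partial assignment without collisions that touches no item outside. -/
structure Closed (L : List X) (P : List (X × Bool × Fin n)) : Prop where
  sub : Sub L P
  loc : ∀ e ∈ P, e.2.2 = h e.1 e.2.1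
  nodup : (locs P).Nodup
  free : ∀ y ∈ L, y ∉ items P → ∀ b, h y b ∉ locs P

variable (h) in
/-- The entry of a directed edge in a partial assignment. -/
def entry (e : X × Bool) : X × Bool × Fin n := (e.1, e.2, h e.1 e.2)

theorem items_entry (Q : List (X × Bool)) (P : List (X × Bool × Fin n)) :
    items (Q.map (entry h) ++ P) = Q.map Prod.fst ++ items P := by
  simp [items, entry, Function.comp_def]

theorem locs_entry (Q : List (X × Bool)) (P : List (X × Bool × Fin n)) :
    locs (Q.map (entry h) ++ P) = Q.map (hd h) ++ locs P := by
  simp only [locs, List.map_append, List.map_map]; rfl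

variable (h) in
/-- What `propagate` does to a closed assignment with one more edge. -/
def Extends (L : List X) (e : X × Bool) (P P' : List (X × Bool × Fin n)) : Prop :=
  ∃ Q, Grown h L e Q ∧ P' = Q.map (entry h) ++ P ∧ ∀ u ∈ Q, u.1 ∉ items P

/-- An item outside a closed assignment has both locations free there. If it is forced, the reason
is the head of a new edge, so the new edges continue to grow out of `e`. -/
theorem Extends.force {e : X × Bool} {P P' : List (X × Bool × Fin n)} (hP : Closed h L P)
    (hE : Extends h L e P P') {y : X} (hy : y ∈ L) : Extends h L e P (force h P' y) := by
  obtain ⟨Q, hQ, rfl, hd'⟩ := hE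
  rcases force_cases (h := h) (Q.map (entry h) ++ P) y with h1 | ⟨h2, b, h3, h1⟩
  · rw [h1]; exact ⟨Q, hQ, rfl, hd'⟩
  · rw [items_entry, List.mem_append, not_or] at h2
    rw [locs_entry, List.mem_append] at h3
    refine ⟨(y, b) :: Q, hQ.step hy h2.1 ?_, h1, ?_⟩
    · rcases h3 with h3 | h3
      · exact h3
      · exact absurd h3 (hP.free y hy h2.2 _)
    · intro u hu
      rcases List.mem_cons.1 hu with rfl | hu
      · exact h2.2
      · exact hd' u hu

theorem extends_iterate {e : X × Bool} {P : List (X × Bool × Fin n)} (hP : Closed h L P)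
    (he : e.1 ∈ L) (he' : e.1 ∉ items P) (r : ℕ) :
    Extends h L e P ((round h L)^[r] (entry h e :: P)) := by
  induction r with
  | zero => exact ⟨[e], Grown.base he, rfl, by simpa using he'⟩
  | succ r ih =>
    rw [Function.iterate_succ_apply']
    exact foldl_invariant _ (Extends h L e P) L _ ih (fun _ _ hy hQ => hQ.force hP hy)

/-- Propagation either yields a larger closed assignment or a returning trail. -/
theorem propagate_spec {e : X × Bool} {P P' : List (X × Bool × Fin n)} (hP : Closed h L P)
    (he : e.1 ∈ L) (he' : e.1 ∉ items P) (hP' : P' = (round h L)^[L.length] (entry h e :: P)) :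
    ((locs P').Nodup → Closed h L P' ∧ e.1 ∈ items P' ∧ ∀ y ∈ items P, y ∈ items P') ∧
    (¬ (locs P').Nodup →
      ∃ a T, Trail h L (a :: T) ∧ T.getLast? = some e ∧ hd h a ∈ T.map (hd h)) := by
  have hE := extends_iterate hP he he' L.length
  rw [← hP'] at hE
  have hsub : Sub L P' := by
    rw [hP']
    refine Sub.iterate ⟨?_, ?_⟩ _
    · simpa [items, entry] using ⟨by simpa [items] using he', hP.sub.1⟩
    · intro z hz
      simp only [items, entry, List.map_cons, List.mem_cons] at hz
      rcases hz with rfl | hz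
      · exact he
      · exact hP.sub.2 z hz
  have hstable : ∀ y ∈ L, force h P' y = P' := by
    -- Starting from at least one entry, `L.length` enlarging rounds would produce more entries than
    -- items.
    rcases iterate_round_stable (h := h) (L := L) L.length (entry h e :: P) with h1 | h1
    · rw [hP']; exact h1
    · rw [← hP'] at h1
      have := hsub.length_le
      simp at h1; omega
  obtain ⟨Q, hQ, hQe, hQd⟩ := hE
  have heQ : e ∈ Q := by
    clear hQe hQd
    induction hQ with
    | base => simp
    | step _ _ _ _ ih => exact List.mem_cons_of_mem _ ih
  constructor
  · intro hn
    refine ⟨⟨hsub, ?_, hn, ?_⟩, ?_, ?_⟩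
    · intro f hf
      rw [hQe, List.mem_append] at hf
      rcases hf with hf | hf
      · obtain ⟨u, _, rfl⟩ := List.mem_map.1 hf
        rfl
      · exact hP.loc f hf
    · intro y hy hy' b
      exact force_eq_self (hstable y hy) b hy'
    · rw [hQe, items_entry]
      exact List.mem_append_left _ (List.mem_map_of_mem heQ)
    · intro y hy
      rw [hQe, items_entry]
      exact List.mem_append_right _ hy
  · intro hn
    -- The new edges avoid all locations of the closed assignment `P`, so a collision is one between
    -- two new edges.
    refine hQ.exists_return (fun hn' => hn ?_)
    rw [hQe, locs_entry, List.nodup_append]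
    refine ⟨hn', hP.nodup, ?_⟩
    intro a ha b hb hab
    obtain ⟨u, hu, rfl⟩ := List.mem_map.1 ha
    exact hP.free u.1 (hQ.mem u hu) (hQd u hu) u.2 (by
      change hd h u ∈ _; rw [hab]; exact hb)

/-- A collision after trying the first location gives a returning trail that leaves the item in one
direction, a collision after trying the second one a returning trail in the other direction. If both
occur, the trails combine to a double return. -/
theorem insertItem_spec {P : List (X × Bool × Fin n)} (hP : Closed h L P) {x : X} (hx : x ∈ L) :
    (∀ P', (insertItem h L (some P) x : Prog S W V _).run G G' = some P' →
      Closed h L P' ∧ x ∈ items P' ∧ ∀ y ∈ items P, y ∈ items P') ∧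
    ((insertItem h L (some P) x : Prog S W V _).run G G' = none →
      ∃ a o Q, DoubleReturn h L a o Q) := by
  simp only [insertItem, run_bind, run_mem, run_ite, run_ret, run_prim, run_propagate, run_nodup,
    decide_eq_true_eq]
  by_cases hxP : x ∈ items P
  · rw [if_pos hxP]
    refine ⟨?_, by simp⟩
    intro P' hP'
    simp only [Option.some.injEq] at hP'
    subst hP'
    exact ⟨hP, hxP, fun y hy => hy⟩
  · rw [if_neg hxP]
    have h0 := propagate_spec (e := (x, false)) hP hx hxP rfl
    have h1 := propagate_spec (e := (x, true)) hP hx hxP rfl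
    by_cases hn0 : (locs ((round h L)^[L.length] ((x, false, h x false) :: P))).Nodup
    · rw [if_pos hn0]
      refine ⟨?_, by simp⟩
      intro P' hP'
      simp only [Option.some.injEq] at hP'
      subst hP'
      exact h0.1 hn0
    · rw [if_neg hn0]
      by_cases hn1 : (locs ((round h L)^[L.length] ((x, true, h x true) :: P))).Nodup
      · rw [if_pos hn1]
        refine ⟨?_, by simp⟩
        intro P' hP'
        simp only [Option.some.injEq] at hP'
        subst hP'
        exact h1.1 hn1
      · rw [if_neg hn1]
        refine ⟨by simp, fun _ => ?_⟩
        obtain ⟨a, T, hT1, hT2, hT3⟩ := h0.2 hn0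
        obtain ⟨a', T', hT1', hT2', hT3'⟩ := h1.2 hn1
        exact exists_doubleReturn hT1 hT2 hT3 hT1' hT2' hT3'

theorem foldl_update_of_mem {α : Type} {P : List (X × α)} (hP : (P.map Prod.fst).Nodup)
    (t : X → α) {e : X × α} (he : e ∈ P) :
    P.foldl (fun t e => Function.update t e.1 e.2) t e.1 = e.2 := by
  induction P generalizing t with
  | nil => simp at he
  | cons f P ih =>
    rw [List.map_cons, List.nodup_cons] at hP
    rw [List.foldl_cons]
    rcases List.mem_cons.1 he with rfl | he
    · have key : ∀ (P : List (X × α)) (t : X → α), e.1 ∉ P.map Prod.fst →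
          P.foldl (fun t e => Function.update t e.1 e.2) t e.1 = t e.1 := by
        intro P
        induction P with
        | nil => intros; rfl
        | cons f P ih =>
          intro t hf
          rw [List.map_cons, List.mem_cons, not_or] at hf
          rw [List.foldl_cons, ih _ hf.2, Function.update_of_ne hf.1]
      rw [key P _ hP.1, Function.update_self]
    · exact ih hP.2 _ he

theorem insertItems_spec (M : List X) (hM : ∀ x ∈ M, x ∈ L) (P : List (X × Bool × Fin n))
    (hP : Closed h L P) :
    (∀ P', (M.foldlM (insertItem h L) (some P) : Prog S W V _).run G G' = some P' →
      Closed h L P' ∧ (∀ y ∈ items P, y ∈ items P') ∧ ∀ y ∈ M, y ∈ items P') ∧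
    ((M.foldlM (insertItem h L) (some P) : Prog S W V _).run G G' = none →
      ∃ a o Q, DoubleReturn h L a o Q) := by
  induction M generalizing P with
  | nil =>
    refine ⟨?_, ?_⟩
    · intro P' hP'
      simp at hP'
      subst hP'
      exact ⟨hP, fun y hy => hy, by simp⟩
    · intro h1; simp at h1
  | cons x M ih =>
    have h1 := insertItem_spec G G' hP (hM x (by simp))
    simp only [List.foldlM_cons, run_bind]
    cases hres : (insertItem h L (some P) x : Prog S W V _).run G G' with
    | none =>
      have hnone : ∀ M : List X, (M.foldlM (insertItem h L) none : Prog S W V _).run G G' = none := by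
        intro M
        induction M with
        | nil => rfl
        | cons y M ih => simp only [List.foldlM_cons, run_bind, insertItem, run_ret, ih]
      rw [hnone]
      exact ⟨by simp, fun _ => h1.2 hres⟩
    | some P1 =>
      obtain ⟨hc, hx, hsub⟩ := h1.1 P1 hres
      obtain ⟨h2, h3⟩ := ih (fun y hy => hM y (by simp [hy])) P1 hc
      refine ⟨?_, h3⟩
      intro P' hP'
      obtain ⟨k1, k2, k3⟩ := h2 P' hP'
      refine ⟨k1, fun y hy => k2 y (hsub y hy), ?_⟩
      intro y hy
      rcases List.mem_cons.1 hy with rfl | hy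
      · exact k2 _ hx
      · exact k3 y hy

theorem closed_nil : Closed h L ([] : List (X × Bool × Fin n)) :=
  ⟨⟨by simp, by simp⟩, by simp, by simp, by simp⟩

/-- Cuckoo hashing finds an assignment without collisions, or there is a trail with two returns. -/
theorem cuckoo_spec :
    (∀ g, (cuckoo h L : Prog S W V _).run G G' = some g →
      ∀ x ∈ L, ∀ y ∈ L, h x (g x) = h y (g y) → x = y) ∧
    ((cuckoo h L : Prog S W V _).run G G' = none → ∃ a o Q, DoubleReturn h L a o Q) := by
  have h1 := insertItems_spec G G' L (fun _ hx => hx) [] (closed_nil (h := h) (L := L))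
  simp only [cuckoo, run_bind]
  cases hres : (L.foldlM (insertItem h L) (some []) : Prog S W V _).run G G' with
  | none =>
    exact ⟨by simp, fun _ => h1.2 hres⟩
  | some P =>
    obtain ⟨hc, -, hL⟩ := h1.1 P hres
    refine ⟨?_, by simp⟩
    intro g hg x hx y hy hxy
    simp only [run_bind, run_ret, Option.some.injEq, run_foldlM, run_prim] at hg
    have hloc : ∀ x ∈ L, ∃ e ∈ P, e.1 = x ∧ e.2.2 = h x (g x) := by
      intro x hx
      obtain ⟨e, he, rfl⟩ := List.mem_map.1 (hL x hx)
      refine ⟨e, he, rfl, ?_⟩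
      rw [hc.loc e he]
      have := foldl_update_of_mem (P := P.map (fun e => (e.1, e.2.1)))
        (by simpa [items, Function.comp_def] using hc.sub.1) (fun _ => false)
        (e := (e.1, e.2.1)) (List.mem_map.2 ⟨e, he, rfl⟩)
      rw [List.foldl_map] at this
      rw [← hg, this]
    obtain ⟨e, he, rfl, he2⟩ := hloc x hx
    obtain ⟨f, hf, rfl, hf2⟩ := hloc y hy
    have : e = f := List.inj_on_of_nodup_map hc.nodup he hf (by rw [he2, hf2, hxy])
    rw [this]

/-- A single item is assigned to its first location. -/
theorem cuckoo_singleton (x : X) :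
    ∃ g, (cuckoo h [x] : Prog S W V _).run G G' = some g ∧ g x = false := by
  refine ⟨Function.update (fun _ => false) x false, ?_, by simp⟩
  have hr : round h [x] [(x, false, h x false)] = [(x, false, h x false)] := by
    simp [round, force]
  simp [cuckoo, insertItem, run_propagate, hr]

/-- The trail has at least two edges, and their items differ. Consequently a layer with one item,
such as the root, cannot fail. -/
theorem DoubleReturn.one_lt_length {a o : X × Bool} {Q : List (X × Bool)}
    (hQ : DoubleReturn h L a o Q) : 1 < L.length := by
  have h1 := (hQ.trail.nodup.subperm (l₂ := L) (fun y hy => by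
    obtain ⟨e, he, rfl⟩ := List.mem_map.1 hy
    exact hQ.trail.mem e he)).length_le
  have h2 := hQ.last
  cases Q with
  | nil => simp at h2
  | cons b Q => simp at h1; omega

/-! ### Cost -/

theorem ops_forceItem_le {P : List (X × Bool × Fin n)} (hP : Sub L P) (y : X) :
    (forceItem h P y : Prog S W V _).ops G G' ≤ 3 * L.length + 2 := by
  have h0 := hP.length_le
  have h1 := ops_mem_le G G' y (items P)
  have h2 := fun a => ops_mem_le G G' a (locs P)
  simp only [forceItem, ops_bind, run_mem, ops_ite, ops_ret, ops_prim, run_prim]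
  have h3 := h2 (h y false)
  have h4 := h2 (h y true)
  simp only [items, locs, List.length_map] at h1 h3 h4
  split_ifs <;> omega

theorem ops_propagate_le (r : ℕ) {P : List (X × Bool × Fin n)} (hP : Sub L P) :
    (propagate h L r P : Prog S W V _).ops G G' ≤ r * (L.length * (3 * L.length + 2)) := by
  induction r generalizing P with
  | zero => simp [propagate]
  | succ r ih =>
    simp only [propagate, ops_bind]
    have h1 := ops_foldlM_le G G' (forceItem h) L P (3 * L.length + 2) (Sub L) hP
      (fun s a ha hs => by rw [run_forceItem]; exact hs.force ha)
      (fun s a ha hs => ops_forceItem_le G G' hs a)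
    have h2 := ih (P := (List.foldlM (forceItem h) P L : Prog S W V _).run G G') (by
      rw [run_foldlM]
      exact foldl_invariant _ (Sub L) L P hP (fun s a ha hs => by
        rw [run_forceItem]; exact hs.force ha))
    rw [add_mul, one_mul]
    omega

/-- The main cost is that of two propagations, each with `L.length` rounds in which all items are
forced at linear cost. The invariant `Closed` bounds the lengths of the assignments involved. -/
theorem ops_insertItem_le {st : Option (List (X × Bool × Fin n))}
    (hP : ∀ P, st = some P → Closed h L P) {x : X} (hx : x ∈ L) :
    (insertItem h L st x : Prog S W V _).ops G G' ≤ 6 * (L.length + 1) ^ 3 := by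
  cases st with
  | none => simp [insertItem]
  | some P =>
    have hc := hP P rfl
    have h0 := hc.sub.length_le
    have h1 := ops_mem_le G G' x (items P)
    simp only [insertItem, ops_bind, run_mem, ops_ite, ops_ret, ops_prim, run_prim, run_nodup,
      run_propagate, decide_eq_true_eq]
    by_cases hxP : x ∈ items P
    · rw [if_pos hxP]
      simp only [items, List.length_map] at h1
      nlinarith [Nat.zero_le (L.length ^ 3), Nat.zero_le (L.length ^ 2)]
    · rw [if_neg hxP]
      have hsub : ∀ b, Sub L ((x, b, h x b) :: P) := by
        intro b
        refine ⟨?_, ?_⟩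
        · simpa [items] using ⟨by simpa [items] using hxP, hc.sub.1⟩
        · intro z hz
          simp only [items, List.map_cons, List.mem_cons] at hz
          rcases hz with rfl | hz
          · exact hx
          · exact hc.sub.2 z hz
      have h2 := fun b => ops_propagate_le (h := h) G G' L.length (hsub b)
      have h3 := fun b => ops_nodup_le (S := S) (W := W) (V := V) G G'
        (locs ((round h L)^[L.length] ((x, b, h x b) :: P)))
      have h4 := fun b => ((hsub b).iterate (h := h) L.length).length_le
      have h5 : ∀ b, (nodup (locs ((round h L)^[L.length] ((x, b, h x b) :: P))) :
          Prog S W V _).ops G G' ≤ L.length * L.length := fun b =>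
        (h3 b).trans (by simpa using Nat.mul_le_mul (h4 b) (h4 b))
      have a1 := h2 false
      have a2 := h2 true
      have a3 := h5 false
      have a4 := h5 true
      simp only [items, List.length_map] at h1
      simp only [locs] at a3 a4
      have hpoly : L.length + 1 + (1 + 2 * (L.length * (L.length * (3 * L.length + 2))) +
          2 * (L.length * L.length)) ≤ 6 * (L.length + 1) ^ 3 := by
        ring_nf; nlinarith [Nat.zero_le (L.length ^ 3), Nat.zero_le (L.length ^ 2)]
      split_ifs <;> omega

theorem ops_cuckoo_le :
    (cuckoo h L : Prog S W V _).ops G G' ≤ 7 * (L.length + 1) ^ 4 := by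
  have h1 := insertItems_spec G G' L (fun _ hx => hx) [] (closed_nil (h := h) (L := L))
  have h2 := ops_foldlM_le G G' (insertItem h L) L (some []) (6 * (L.length + 1) ^ 3)
    (fun st => ∀ P, st = some P → Closed h L P)
    (fun P hP => by simp at hP; subst hP; exact closed_nil)
    (fun s a ha hs P hP => by
      cases s with
      | none => simp [insertItem] at hP
      | some Q => exact ((insertItem_spec G G' (hs Q rfl) ha).1 P hP).1)
    (fun s a ha hs => ops_insertItem_le G G' hs ha)
  simp only [cuckoo, ops_bind]
  have hp : L.length * (6 * (L.length + 1) ^ 3) + L.length ≤ 7 * (L.length + 1) ^ 4 := by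
    have h3 : 1 ≤ (L.length + 1) ^ 3 := Nat.one_le_pow _ _ (by omega)
    have h4 : (L.length + 1) ^ 4 = L.length * (L.length + 1) ^ 3 + (L.length + 1) ^ 3 := by ring
    nlinarith
  cases hres : (L.foldlM (insertItem h L) (some []) : Prog S W V _).run G G' with
  | none => simp only [ops_ret]; omega
  | some P =>
    have h3 := (h1.1 P hres).1.sub.length_le
    have h4 := ops_foldlM_le G G' (fun t (e : X × Bool × Fin n) =>
        (prim (Function.update t e.1 e.2.1) : Prog S W V _)) P (fun _ => false) 1
      (fun _ => True) trivial (fun _ _ _ _ => trivial) (fun _ _ _ _ => by simp)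
    simp only [ops_bind, ops_ret]
    omega

variable (c : Bool)

@[simp] theorem callsG_cuckoo : (cuckoo h L : Prog S W V _).callsG G G' c = 0 := by
  have hf : ∀ P y, (forceItem h P y : Prog S W V _).callsG G G' c = 0 := by
    intro P y; simp [forceItem]
  have hp : ∀ r P, (propagate h L r P : Prog S W V _).callsG G G' c = 0 := by
    intro r
    induction r with
    | zero => intro P; simp [propagate]
    | succ r ih =>
      intro P
      have := callsG_foldlM_le G G' c (forceItem h) L P 0 (fun s a => (hf s a).le)
      simp only [propagate, callsG_bind, ih]; omega
  have hi : ∀ st y, (insertItem h L st y : Prog S W V _).callsG G G' c = 0 := by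
    intro st y; cases st <;> simp [insertItem, hp]
  have h1 := callsG_foldlM_le G G' c (insertItem h L) L (some []) 0 (fun s a => (hi s a).le)
  simp only [cuckoo, callsG_bind]
  cases (L.foldlM (insertItem h L) (some []) : Prog S W V _).run G G' with
  | none => simp only [callsG_ret]; omega
  | some P =>
    have h4 := callsG_foldlM_le G G' c (fun t (e : X × Bool × Fin n) =>
        (prim (Function.update t e.1 e.2.1) : Prog S W V _)) P (fun _ => false) 0
      (fun _ _ => by simp)
    simp only [callsG_bind, callsG_ret]
    omega

@[simp] theorem callsG'_cuckoo : (cuckoo h L : Prog S W V _).callsG' G G' c = 0 := by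
  have hf : ∀ P y, (forceItem h P y : Prog S W V _).callsG' G G' c = 0 := by
    intro P y; simp [forceItem]
  have hp : ∀ r P, (propagate h L r P : Prog S W V _).callsG' G G' c = 0 := by
    intro r
    induction r with
    | zero => intro P; simp [propagate]
    | succ r ih =>
      intro P
      have := callsG'_foldlM_le G G' c (forceItem h) L P 0 (fun s a => (hf s a).le)
      simp only [propagate, callsG'_bind, ih]; omega
  have hi : ∀ st y, (insertItem h L st y : Prog S W V _).callsG' G G' c = 0 := by
    intro st y; cases st <;> simp [insertItem, hp]
  have h1 := callsG'_foldlM_le G G' c (insertItem h L) L (some []) 0 (fun s a => (hi s a).le)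
  simp only [cuckoo, callsG'_bind]
  cases (L.foldlM (insertItem h L) (some []) : Prog S W V _).run G G' with
  | none => simp only [callsG'_ret]; omega
  | some P =>
    have h4 := callsG'_foldlM_le G G' c (fun t (e : X × Bool × Fin n) =>
        (prim (Function.update t e.1 e.2.1) : Prog S W V _)) P (fun _ => false) 0
      (fun _ _ => by simp)
    simp only [callsG'_bind, callsG'_ret]
    omega

end Cuckoo

/-! ### Averages over finite sample spaces -/

section Average

/-- The average of `f` over a finite sample space. -/
noncomputable def avg {Ω : Type} [Fintype Ω] (f : Ω → ℝ) : ℝ := (∑ ω, f ω) / Fintype.card Ω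

open Classical in
/-- The indicator of a proposition. -/
noncomputable def ind (p : Prop) : ℝ := if p then 1 else 0

theorem ind_true {p : Prop} (hp : p) : ind p = 1 := if_pos hp
theorem ind_false {p : Prop} (hp : ¬ p) : ind p = 0 := if_neg hp
theorem ind_nonneg (p : Prop) : 0 ≤ ind p := by unfold ind; split_ifs <;> norm_num

variable {Ω Ω' : Type} [Fintype Ω] [Fintype Ω']

theorem prob_eq_avg (p : Ω → Prop) : prob p = avg (fun ω => ind (p ω)) := by
  classical
  simp [prob, avg, ind, Nat.card_eq_fintype_card, Fintype.card_subtype]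

theorem avg_mono {f g : Ω → ℝ} (h : ∀ ω, f ω ≤ g ω) : avg f ≤ avg g :=
  div_le_div_of_nonneg_right (Finset.sum_le_sum (fun ω _ => h ω)) (Nat.cast_nonneg _)

theorem avg_const [Nonempty Ω] (c : ℝ) : avg (fun _ : Ω => c) = c := by
  simp [avg]

theorem avg_add (f g : Ω → ℝ) : avg (fun ω => f ω + g ω) = avg f + avg g := by
  simp [avg, Finset.sum_add_distrib, add_div]

theorem avg_sub (f g : Ω → ℝ) : avg (fun ω => f ω - g ω) = avg f - avg g := by
  simp [avg, Finset.sum_sub_distrib, sub_div]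

theorem avg_sum {ι : Type} (s : Finset ι) (f : ι → Ω → ℝ) :
    avg (fun ω => ∑ i ∈ s, f i ω) = ∑ i ∈ s, avg (f i) := by
  simp only [avg]
  rw [Finset.sum_comm, Finset.sum_div]

theorem avg_abs_le {f : Ω → ℝ} {ε : ℝ} [Nonempty Ω] (h : ∀ ω, |f ω| ≤ ε) : |avg f| ≤ ε := by
  rw [abs_le]
  constructor
  · rw [← avg_const (Ω := Ω) (-ε)]; exact avg_mono (fun ω => (abs_le.1 (h ω)).1)
  · rw [← avg_const (Ω := Ω) ε]; exact avg_mono (fun ω => (abs_le.1 (h ω)).2)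

theorem avg_equiv (e : Ω ≃ Ω') (f : Ω' → ℝ) : avg (fun ω => f (e ω)) = avg f := by
  simp [avg, Fintype.card_congr e, Equiv.sum_comp e]

/-- An injective self-map of a finite set is bijective. The exchanges of randomness in the security
proof are used in this form, which requires no explicit inverse. -/
theorem avg_comp_injective {φ : Ω → Ω} (hφ : Function.Injective φ) (f : Ω → ℝ) :
    avg (fun ω => f (φ ω)) = avg f :=
  avg_equiv (Equiv.ofBijective φ (Finite.injective_iff_bijective.1 hφ)) f

theorem avg_prod (f : Ω × Ω' → ℝ) : avg f = avg (fun a => avg (fun b => f (a, b))) := by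
  simp only [avg, Fintype.sum_prod_type, Fintype.card_prod, Nat.cast_mul]
  rw [← Finset.sum_div, div_div, mul_comm]

theorem avg_comm (f : Ω → Ω' → ℝ) :
    avg (fun a => avg (fun b => f a b)) = avg (fun b => avg (fun a => f a b)) := by
  rw [← avg_prod (fun z : Ω × Ω' => f z.1 z.2), ← avg_prod (fun z : Ω' × Ω => f z.2 z.1),
    ← avg_equiv (Equiv.prodComm Ω Ω')]
  rfl

theorem avg_fst [Nonempty Ω'] (f : Ω → ℝ) : avg (fun z : Ω × Ω' => f z.1) = avg f := by
  rw [avg_prod]; simp only [avg_const]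

theorem avg_snd [Nonempty Ω] (f : Ω' → ℝ) : avg (fun z : Ω × Ω' => f z.2) = avg f := by
  rw [avg_prod]; exact avg_const (Ω := Ω) (avg f)

theorem avg_pi {ι : Type} [Fintype ι] [DecidableEq ι] {β : ι → Type} [∀ i, Fintype (β i)]
    [∀ i, Nonempty (β i)] (i : ι) (f : β i → ℝ) : avg (fun z : ∀ i, β i => f (z i)) = avg f := by
  have e := Equiv.piSplitAt i β
  have := avg_equiv (Equiv.piSplitAt i β) (fun z => f z.1)
  rw [avg_fst] at this
  exact this

/-- Resampling one coordinate. -/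
theorem avg_update {ι : Type} [Fintype ι] [DecidableEq ι] [Nonempty Ω] (i : ι) (f : (ι → Ω) → ℝ) :
    avg f = avg (fun z => avg (fun ω => f (Function.update z i ω))) := by
  have key : ∀ g : Ω × ({j // j ≠ i} → Ω) → ℝ,
      avg g = avg (fun z : Ω × ({j // j ≠ i} → Ω) => avg (fun ω => g (ω, z.2))) := by
    intro g
    rw [avg_snd (fun r => avg (fun ω => g (ω, r))), avg_prod, avg_comm]
  have h1 := avg_equiv (Equiv.piSplitAt i (fun _ : ι => Ω)).symm f
  rw [← h1, key, ← avg_equiv (Equiv.piSplitAt i (fun _ : ι => Ω))]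
  refine congrArg avg (funext fun z => congrArg avg (funext fun ω => congrArg f (funext fun j => ?_)))
  by_cases hj : j = i
  · subst hj; simp [Equiv.piSplitAt]
  · simp [Equiv.piSplitAt, hj, Function.update]

theorem avg_ind_le_sum {ι : Type} [Fintype ι] (p : Ω → Prop) (q : ι → Ω → Prop)
    (h : ∀ ω, p ω → ∃ i, q i ω) : avg (fun ω => ind (p ω)) ≤ ∑ i, avg (fun ω => ind (q i ω)) := by
  rw [← avg_sum]
  refine avg_mono (fun ω => ?_)
  by_cases hp : p ω
  · obtain ⟨i, hi⟩ := h ω hp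
    rw [ind_true hp, ← ind_true hi]
    exact Finset.single_le_sum (f := fun i => ind (q i ω)) (fun j _ => ind_nonneg _)
      (Finset.mem_univ i)
  · rw [ind_false hp]
    exact Finset.sum_nonneg (fun j _ => ind_nonneg _)

end Average

/-! ### The failure probability of cuckoo hashing -/

namespace Cuckoo

/-- Probability that the values at `m` coordinates are copies of those at other coordinates. -/
theorem avg_copies_le {ι τ : Type} [Fintype ι] [DecidableEq ι] [Fintype τ] {n : ℕ} (hn : 0 < n)
    {D : τ → ι} (hD : Function.Injective D) (src : τ → ι) (hsrc : ∀ t s, src t ≠ D s) :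
    avg (fun f : ι → Fin n => ind (∀ t, f (D t) = f (src t))) ≤ 1 / (n : ℝ) ^ Fintype.card τ := by
  classical
  -- Overwriting the coordinates `D t` by arbitrary values loses no information: the sources of the
  -- copies are not among them and stay unchanged. So solutions make up at most the fraction `1 / n
  -- ^ card τ` of all functions.
  have hinj : Function.Injective (fun z : {f : ι → Fin n // ∀ t, f (D t) = f (src t)} × (τ → Fin n) =>
      Function.extend D z.2 z.1.1) := by
    rintro ⟨⟨f, hf⟩, v⟩ ⟨⟨f', hf'⟩, v'⟩ heq
    simp only at heq
    have hv : v = v' := by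
      funext t
      have := congrFun heq (D t)
      rwa [hD.extend_apply, hD.extend_apply] at this
    have hoff : ∀ i, (¬ ∃ t, D t = i) → f i = f' i := by
      intro i hi
      have := congrFun heq i
      rwa [Function.extend_apply' _ _ _ hi, Function.extend_apply' _ _ _ hi] at this
    have hff : f = f' := by
      funext i
      by_cases hi : ∃ t, D t = i
      · obtain ⟨t, rfl⟩ := hi
        rw [hf, hf']
        exact hoff _ (fun ⟨s, hs⟩ => hsrc t s hs.symm)
      · exact hoff i hi
    subst hv; subst hff; rfl
  have hcard := Fintype.card_le_of_injective _ hinj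
  rw [Fintype.card_prod, Fintype.card_fun (α := τ), Fintype.card_fin] at hcard
  have hpos : (0 : ℝ) < (n : ℝ) ^ Fintype.card τ := by positivity
  rw [← prob_eq_avg, prob, Nat.card_eq_fintype_card, Nat.card_eq_fintype_card,
    div_le_div_iff₀ (by rw [Fintype.card_fun, Fintype.card_fin]; positivity) hpos, one_mul]
  exact_mod_cast hcard

/-- The infinite series has the value 30; the closed form shows that the partial sums stay below it.
-/
theorem sum_sq_two_thirds (N : ℕ) :
    ∑ s ∈ Finset.range N, (s : ℝ) ^ 2 * (2 / 3) ^ s =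
      30 - (3 * (N : ℝ) ^ 2 + 12 * N + 30) * (2 / 3) ^ N := by
  induction N with
  | zero => simp
  | succ N ih => rw [Finset.sum_range_succ, ih, pow_succ]; push_cast; ring

variable {X : Type}

/-- The positions of a trail with two returns: its length, its edges, and the places of the returns. -/
abbrev Shape (m : ℕ) : Type :=
  Σ s : Fin m, (Fin (s + 1) → Fin m × Bool) × Fin s × Fin s

/-- The edge at a position. -/
def Shape.edge (L : List X) (z : Shape L.length) (t : Fin (z.1 + 1)) : X × Bool :=
  (L.get (z.2.1 t).1, (z.2.1 t).2)

/-- The event that a shape is realized by a trail with two returns. -/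
def Shape.Event (L : List X) (z : Shape L.length) {n : ℕ} (h : X → Bool → Fin n) : Prop :=
  Function.Injective (fun t => (z.edge L t).1) ∧
  (∀ t : Fin z.1, tl h (z.edge L t.castSucc) = hd h (z.edge L t.succ)) ∧
  hd h (z.edge L 0) = hd h (z.edge L z.2.2.1.succ) ∧
  tl h (z.edge L (Fin.last _)) = hd h (z.edge L z.2.2.2.succ)

/-- Index data replace lists so that a union bound over a finite type becomes possible. As no item
is repeated, the trail has at most `L.length` edges, which bounds the first index. -/
theorem DoubleReturn.exists_shape {n : ℕ} {h : X → Bool → Fin n} {L : List X} {a o : X × Bool}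
    {Q : List (X × Bool)} (hQ : DoubleReturn h L a o Q) : ∃ z : Shape L.length, z.Event L h := by
  have hlen := (hQ.trail.nodup.subperm (l₂ := L) (fun y hy => by
    obtain ⟨e, he, rfl⟩ := List.mem_map.1 hy
    exact hQ.trail.mem e he)).length_le
  simp only [List.length_map, List.length_cons] at hlen
  have hidx : ∀ t : Fin (Q.length + 1), ∃ i : Fin L.length, L.get i = ((a :: Q).get t).1 :=
    fun t => List.mem_iff_get.1 (hQ.trail.mem _ (List.get_mem _ _))
  choose c hc using hidx
  obtain ⟨u, hu, hu'⟩ := List.mem_map.1 hQ.hd_mem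
  obtain ⟨i, rfl⟩ := List.mem_iff_get.1 hu
  obtain ⟨v, hv, hv'⟩ := List.mem_map.1 hQ.tl_mem
  obtain ⟨j, rfl⟩ := List.mem_iff_get.1 hv
  let z : Shape L.length := ⟨⟨Q.length, by omega⟩, fun t => (c t, ((a :: Q).get t).2), i, j⟩
  have hz : ∀ t, z.edge L t = (a :: Q).get t := fun t => Prod.ext (hc t) rfl
  refine ⟨z, ?_, ?_, ?_, ?_⟩
  · intro t t' htt
    simp only [hz] at htt
    have hnd := hQ.trail.nodup
    rw [List.nodup_iff_injective_get] at hnd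
    have := @hnd (Fin.cast (by simp [z]) t) (Fin.cast (by simp [z]) t') (by
      rw [List.get_eq_getElem, List.get_eq_getElem, List.getElem_map, List.getElem_map]
      exact htt)
    simpa [Fin.ext_iff] using this
  · intro t
    rw [hz, hz]
    have := List.isChain_iff_getElem.1 hQ.trail.chain t (by have := t.2; simp [z] at this ⊢)
    simpa using this
  · rw [hz, hz]; exact hu'.symm
  · rw [hz, hz]
    have hl := hQ.last
    rw [List.getLast?_eq_getElem?] at hl
    have hpos : 0 < Q.length := by have := i.2; omega
    have : (a :: Q).get (Fin.last Q.length) = o := by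
      rw [List.getElem?_eq_getElem (by omega)] at hl
      simp only [Option.some.injEq] at hl
      rw [← hl]
      simp only [List.get_eq_getElem, Fin.val_last]
      rw [List.getElem_cons]
      simp [hpos.ne']
    rw [show (a :: Q).get (Fin.last z.1) = o from this]
    exact hv'.symm

/-- A shape with `s + 1` edges involves `2(s + 1)` independent hash values. The event makes `s + 2`
of them, all tails and the head of the newest edge, copies of the others, the heads of the `s` older
edges. Shapes that repeat an item are impossible. -/
theorem avg_event_le [Fintype X] {n : ℕ} (hn : 0 < n) (L : List X) (z : Shape L.length)
    [DecidableEq X] :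
    avg (fun h : X → Bool → Fin n => ind (z.Event L h)) ≤ 1 / (n : ℝ) ^ ((z.1 : ℕ) + 2) := by
  by_cases hinj : Function.Injective (fun t => (z.edge L t).1)
  swap
  · have : ∀ h : X → Bool → Fin n, ¬ z.Event L h := fun h he => hinj he.1
    simp only [ind_false (this _)]
    have : Nonempty (Fin n) := ⟨⟨0, hn⟩⟩
    rw [avg_const]; positivity
  let D : Option (Fin (z.1 + 1)) → X × Bool := fun t => match t with
    | none => z.edge L 0
    | some t => flip (z.edge L t)
  let src : Option (Fin (z.1 + 1)) → X × Bool := fun t => match t with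
    | none => z.edge L z.2.2.1.succ
    | some t => Fin.lastCases (motive := fun _ => X × Bool) (z.edge L z.2.2.2.succ)
        (fun t => z.edge L t.succ) t
  have hflip : ∀ e f : X × Bool, e = flip f → e.1 = f.1 ∧ e ≠ f := by
    rintro e f rfl
    refine ⟨rfl, fun hef => ?_⟩
    have := congrArg Prod.snd hef
    simp [flip] at this
  have hD : Function.Injective D := by
    intro t t' htt
    cases t with
    | none =>
      cases t' with
      | none => rfl
      | some t' =>
        obtain ⟨h1, h2⟩ := hflip _ _ htt
        exact absurd (congrArg (z.edge L) (hinj h1)) h2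
    | some t =>
      cases t' with
      | none =>
        obtain ⟨h1, h2⟩ := hflip _ _ htt.symm
        exact absurd (congrArg (z.edge L) (hinj h1)) h2
      | some t' => exact congrArg some (hinj (congrArg Prod.fst htt :))
  have hsrc' : ∀ t, ∃ r : Fin z.1, src t = z.edge L r.succ := by
    intro t
    cases t with
    | none => exact ⟨_, rfl⟩
    | some t =>
      refine Fin.lastCases ?_ (fun t => ?_) t
      · exact ⟨z.2.2.2, by simp [src]⟩
      · exact ⟨t, by simp [src]⟩
  have hsrc : ∀ t s, src t ≠ D s := by
    intro t s hts
    obtain ⟨r, hr⟩ := hsrc' t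
    rw [hr] at hts
    cases s with
    | none =>
      have := hinj (congrArg Prod.fst hts :)
      exact absurd this (Fin.succ_ne_zero r)
    | some s =>
      obtain ⟨h1, h2⟩ := hflip _ _ hts
      exact absurd (congrArg (z.edge L) (hinj h1)) h2
  have key := avg_copies_le hn hD src hsrc
  rw [Fintype.card_option, Fintype.card_fin] at key
  rw [← avg_equiv (Equiv.curry X Bool (Fin n))]
  refine (avg_mono (fun f => ?_)).trans key
  by_cases hev : z.Event L (Equiv.curry X Bool (Fin n) f)
  · rw [ind_true hev]
    refine (ind_true ?_).ge
    intro t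
    cases t with
    | none => exact hev.2.2.1
    | some t =>
      refine Fin.lastCases ?_ (fun t => ?_) t
      · have := hev.2.2.2
        simp only [D, src, Fin.lastCases_last]
        exact this
      · have := hev.2.1 t
        simp only [D, src, Fin.lastCases_castSucc]
        exact this
  · rw [ind_false hev]; exact ind_nonneg _

/-- The number of locations being three times the number of items, cuckoo hashing fails with
probability `O(1/k)`. -/
theorem avg_doubleReturn_le [Fintype X] [DecidableEq X] {k : ℕ} (hk : 0 < k) (L : List X)
    (hL : L.length ≤ k) :
    avg (fun h : X → Bool → Fin (3 * k) => ind (∃ a o Q, DoubleReturn h L a o Q)) ≤ 7 / k := by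
  have h3 : 0 < 3 * k := by omega
  have hkR : (0 : ℝ) < k := by exact_mod_cast hk
  refine (avg_ind_le_sum _ (fun (z : Shape L.length) h => z.Event L h)
    (fun h ⟨a, o, Q, hQ⟩ => hQ.exists_shape)).trans ?_
  refine (Finset.sum_le_sum (fun z _ => avg_event_le h3 L z)).trans ?_
  rw [Fintype.sum_sigma]
  -- At most `(2k)^(s+1)` choices of directed edges and `s²` choices of the returns stand against
  -- the probability `(3k)^(-(s+2))`. Three locations per item make the ratio of the resulting
  -- series `2/3`.
  have hterm : ∀ s : Fin L.length,
      ∑ _y : (Fin (s + 1) → Fin L.length × Bool) × Fin s × Fin s,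
        1 / ((3 * k : ℕ) : ℝ) ^ ((s : ℕ) + 2) ≤ 2 / (9 * k) * (((s : ℕ) : ℝ) ^ 2 * (2 / 3) ^ (s : ℕ)) := by
    intro s
    rw [Finset.sum_const, Finset.card_univ, nsmul_eq_mul]
    simp only [Fintype.card_prod, Fintype.card_fun, Fintype.card_fin, Fintype.card_bool]
    push_cast
    have hLk : ((L.length : ℝ) * 2) ^ ((s : ℕ) + 1) ≤ ((k : ℝ) * 2) ^ ((s : ℕ) + 1) := by
      have : (L.length : ℝ) ≤ k := by exact_mod_cast hL
      gcongr
    calc ((L.length : ℝ) * 2) ^ ((s : ℕ) + 1) * ((s : ℕ) * (s : ℕ)) * (1 / (3 * (k : ℝ)) ^ ((s : ℕ) + 2))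
        ≤ ((k : ℝ) * 2) ^ ((s : ℕ) + 1) * ((s : ℕ) * (s : ℕ)) * (1 / (3 * (k : ℝ)) ^ ((s : ℕ) + 2)) := by
          gcongr
      _ = 2 / (9 * k) * (((s : ℕ) : ℝ) ^ 2 * (2 / 3) ^ (s : ℕ)) := by
          rw [div_pow, mul_pow, mul_pow]
          simp only [pow_succ]
          field_simp
          ring
  refine (Finset.sum_le_sum (fun s _ => hterm s)).trans ?_
  rw [← Finset.mul_sum, Fin.sum_univ_eq_sum_range (fun s => ((s : ℕ) : ℝ) ^ 2 * (2 / 3) ^ s),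
    sum_sq_two_thirds]
  have : (30 : ℝ) - (3 * (L.length : ℝ) ^ 2 + 12 * L.length + 30) * (2 / 3) ^ L.length ≤ 30 := by
    have : 0 ≤ (3 * (L.length : ℝ) ^ 2 + 12 * L.length + 30) * (2 / 3) ^ L.length := by positivity
    linarith
  -- The constant is `2/9 · 30 = 20/3 ≤ 7`.
  calc 2 / (9 * (k : ℝ)) * _ ≤ 2 / (9 * (k : ℝ)) * 30 := by gcongr
    _ ≤ 7 / k := by rw [div_mul_eq_mul_div, div_le_div_iff₀ (by positivity) hkR]; nlinarith

end Cuckoo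

namespace DPF

open Prog

/-! ### Tables written by a loop -/

section Updates

variable {ι κ β : Type} [DecidableEq κ]

theorem foldl_update_of_forall_ne (L : List ι) (key : ι → κ) (val : ι → β) (t : κ → β) {a : κ}
    (ha : ∀ x ∈ L, key x ≠ a) :
    L.foldl (fun t x => Function.update t (key x) (val x)) t a = t a := by
  induction L generalizing t with
  | nil => rfl
  | cons y L ih =>
    rw [List.foldl_cons, ih _ (fun x hx => ha x (by simp [hx])),
      Function.update_of_ne (ha y (by simp)).symm]

/-- Distinct keys keep a written entry from being overwritten by another item. This is where the
absence of collisions enters, both for correctness and for security. -/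
theorem foldl_update_key (L : List ι) (key : ι → κ) (val : ι → β) (t : κ → β)
    (hkey : ∀ x ∈ L, ∀ y ∈ L, key x = key y → x = y) {x : ι} (hx : x ∈ L) :
    L.foldl (fun t x => Function.update t (key x) (val x)) t (key x) = val x := by
  induction L generalizing t with
  | nil => simp at hx
  | cons y L ih =>
    rw [List.foldl_cons]
    by_cases hxL : x ∈ L
    · exact ih _ (fun a ha b hb => hkey a (by simp [ha]) b (by simp [hb])) hxL
    · obtain rfl : x = y := by simpa [hxL] using hx
      rw [foldl_update_of_forall_ne, Function.update_self]
      intro z hz hzx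
      exact hxL (hkey z (by simp [hz]) x (by simp) hzx ▸ hz)

theorem foldl_congr_mem {α : Type} (L : List α) (f f' : β → α → β) (t : β)
    (h : ∀ t, ∀ x ∈ L, f t x = f' t x) : L.foldl f t = L.foldl f' t := by
  induction L generalizing t with
  | nil => rfl
  | cons y L ih =>
    rw [List.foldl_cons, List.foldl_cons, h t y (by simp)]
    exact ih _ (fun t x hx => h t x (by simp [hx]))

end Updates

/-! ### Prefixes of the shared points -/

section Prefixes

variable {d : ℕ}

/-- The distinct prefixes of length `n`. -/
def pfx (pts : List (Bits d)) (n : ℕ) (h : n ≤ d) : List (Bits n) := (pts.map (pre n h)).dedup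

theorem mem_pfx {pts : List (Bits d)} {n : ℕ} {h : n ≤ d} {y : Bits n} :
    y ∈ pfx pts n h ↔ ∃ x ∈ pts, pre n h x = y := by
  simp [pfx]

theorem nodup_pfx (pts : List (Bits d)) (n : ℕ) (h : n ≤ d) : (pfx pts n h).Nodup :=
  List.nodup_dedup _

theorem length_pfx_le (pts : List (Bits d)) (n : ℕ) (h : n ≤ d) :
    (pfx pts n h).length ≤ pts.length := by
  simpa [pfx] using length_dedup_le (pts.map (pre n h))

/-- The parent of a node. -/
def par {n : ℕ} (y : Bits (n + 1)) : Bits n := Fin.init y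

theorem par_app {n : ℕ} (x : Bits n) (j : Bool) : par (app x j) = x := by
  simp [par, app]

theorem app_last {n : ℕ} (x : Bits n) (j : Bool) : app x j (Fin.last n) = j := by
  simp [app]

theorem app_par {n : ℕ} (y : Bits (n + 1)) : app (par y) (y (Fin.last n)) = y := by
  simp [par, app]

theorem par_pre (x : Bits d) (n : ℕ) (h : n + 1 ≤ d) :
    par (pre (n + 1) h x) = pre n (Nat.le_of_succ_le h) x := by
  rw [← app_pre x n h, par_app]

theorem pre_last (x : Bits d) (n : ℕ) (h : n + 1 ≤ d) :
    pre (n + 1) h x (Fin.last n) = x ⟨n, h⟩ := by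
  rw [← app_pre x n h, app_last]

theorem par_mem_pfx {pts : List (Bits d)} {n : ℕ} {h : n + 1 ≤ d} {y : Bits (n + 1)}
    (hy : y ∈ pfx pts (n + 1) h) : par y ∈ pfx pts n (Nat.le_of_succ_le h) := by
  obtain ⟨x, hx, rfl⟩ := mem_pfx.1 hy
  exact mem_pfx.2 ⟨x, hx, (par_pre x n h).symm⟩

theorem exists_app_mem_pfx {pts : List (Bits d)} {n : ℕ} (h : n + 1 ≤ d) {x : Bits n}
    (hx : x ∈ pfx pts n (Nat.le_of_succ_le h)) : ∃ j, app x j ∈ pfx pts (n + 1) h := by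
  obtain ⟨z, hz, rfl⟩ := mem_pfx.1 hx
  exact ⟨z ⟨n, h⟩, mem_pfx.2 ⟨z, hz, (app_pre z n h).symm⟩⟩

theorem pre_self (x : Bits d) : pre d le_rfl x = x := rfl

theorem mem_pfx_self {pts : List (Bits d)} {x : Bits d} : x ∈ pfx pts d le_rfl ↔ x ∈ pts := by
  simp [mem_pfx, pre_self]

end Prefixes

/-! ### Key generation as a function, and correctness of the keys -/

section Model

variable {lam d k B : ℕ} {Gr : Type} [AddCommGroup Gr] [Fintype Gr]
  (G : Bits lam → Bits (2 * (lam + 2))) (G' : Bits lam → Bits (B * glen Gr))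

/-- The value computed by `correctionWord`. -/
def word {i : ℕ} (x : Bits i) (w : Bool → Bits (2 * (lam + 2))) (has : Bool → Bool)
    (gnext : Bits (i + 1) → Bool) (rnd : Bits lam) : CWord lam :=
  (if has false && has true then rnd
    else if has false then fun t => xor (childSeed (w false) true t) (childSeed (w true) true t)
    else fun t => xor (childSeed (w false) false t) (childSeed (w true) false t),
   fun j => xor (xor (childU (w false) j) (childU (w true) j)) (has j && !gnext (app x j)),
   fun j => xor (xor (childQ (w false) j) (childQ (w true) j)) (has j && gnext (app x j)))

theorem run_correctionWord {i : ℕ} (x : Bits i) (w : Bool → Bits (2 * (lam + 2)))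
    (has : Bool → Bool) (gnext : Bits (i + 1) → Bool) (rnd : Bits lam) :
    (correctionWord x w has gnext rnd : P lam B Gr _).run G G' = word x w has gnext rnd := by
  simp only [correctionWord, word, run_bind, run_prim, run_ret]
  refine Prod.ext rfl (Prod.ext (funext fun j => ?_) (funext fun j => ?_)) <;> cases j <;> rfl

/-- The default node. -/
def zeroNode : Node lam := ⟨fun _ => false, false, false⟩

/-- The correction words of one layer, from the expansions `E` of both servers. -/
def layerCW {i : ℕ} (ρ : Bits i → Bool → Fin (3 * k)) (g : Bits i → Bool)
    (gnext : Bits (i + 1) → Bool) (L : List (Bits i)) (L' : List (Bits (i + 1)))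
    (rnd : Fin (3 * k) → CWord lam) (E : Bits i → Bool → Bits (2 * (lam + 2))) :
    Fin (3 * k) → CWord lam :=
  L.foldl (fun cw x => Function.update cw (ρ x (g x))
    (word x (E x) (fun j => decide (app x j ∈ L')) gnext (rnd (ρ x (g x))).1)) rnd

/-- The nodes of the next layer. -/
def layerSt {i : ℕ} (ρ : Bits i → Bool → Fin (3 * k)) (L' : List (Bits (i + 1)))
    (cw : Fin (3 * k) → CWord lam) (E : Bits i → Bool → Bits (2 * (lam + 2)))
    (st : Bits i → Bool → Node lam) (y : Bits (i + 1)) (b : Bool) : Node lam :=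
  if y ∈ L' then childNode (E (par y) b) (st (par y) b) (cw (ρ (par y) false)) (cw (ρ (par y) true))
    (y (Fin.last i)) else zeroNode

/-- An entry of the next layer is written only while its unique parent is processed, always with the
same value, so the order of the writes does not matter. -/
theorem run_childStep {i : ℕ} (L : List (Bits i)) (L' : List (Bits (i + 1)))
    (hL : ∀ y ∈ L', par y ∈ L) (N : Bits (i + 1) → Bool → Node lam) :
    L.foldl (fun (st' : Bits (i + 1) → Bool → Node lam) x =>
      let st'' := if app x false ∈ L' then Function.update st' (app x false) (N (app x false)) else st'
      if app x true ∈ L' then Function.update st'' (app x true) (N (app x true)) else st'')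
      (fun _ _ => zeroNode) = fun y => if y ∈ L' then N y else fun _ => zeroNode := by
  have key : ∀ (M : List (Bits i)) (t : Bits (i + 1) → Bool → Node lam),
      M.foldl (fun (st' : Bits (i + 1) → Bool → Node lam) x =>
      let st'' := if app x false ∈ L' then Function.update st' (app x false) (N (app x false)) else st'
      if app x true ∈ L' then Function.update st'' (app x true) (N (app x true)) else st'') t =
      fun y => if y ∈ L' ∧ par y ∈ M then N y else t y := by
    intro M
    induction M with
    | nil => intro t; simp
    | cons x M ih =>
      intro t
      rw [List.foldl_cons, ih]
      funext y
      by_cases hy : y ∈ L'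
      · by_cases hyM : par y ∈ M
        · simp [hy, hyM]
        · simp only [hy, hyM, and_false, if_false, List.mem_cons, or_false, true_and]
          by_cases hyx : par y = x
          · have hyy := app_par y
            rw [hyx] at hyy
            rw [if_pos hyx]
            cases hlast : y (Fin.last i) <;> rw [hlast] at hyy
            · have hne : y ≠ app x true := by
                intro hyt; rw [hyt, app_last] at hlast; simp at hlast
              have hm : app x false ∈ L' := by rw [hyy]; exact hy
              simp only [hm, if_true]
              split_ifs
              · rw [Function.update_of_ne hne, ← hyy, Function.update_self]
              · rw [← hyy, Function.update_self]
            · have hm : app x true ∈ L' := by rw [hyy]; exact hy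
              simp only [hm, if_true]
              rw [← hyy, Function.update_self]
          · have hne : ∀ j, y ≠ app x j := by
              intro j hj; exact hyx (by rw [hj, par_app])
            rw [if_neg hyx]
            split_ifs <;> simp [Function.update_of_ne (hne _)]
      · have hne : ∀ j, app x j ∈ L' → y ≠ app x j := fun j hj hyj => hy (hyj ▸ hj)
        simp only [hy, false_and, if_false]
        split_ifs with h1 h2 <;> simp [Function.update_of_ne, *]
  rw [key L]
  funext y
  by_cases hy : y ∈ L'
  · simp [hy, hL y hy]
  · simp [hy]

/-- The table of expansions built by the program agrees with `G` on the seeds only at the nodes of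
`L`. This suffices, because it is read only there. -/
theorem run_genNext {i : ℕ} (ρ : Bits i → Bool → Fin (3 * k)) (g : Bits i → Bool)
    (gnext : Bits (i + 1) → Bool) (L : List (Bits i)) (L' : List (Bits (i + 1)))
    (hL : ∀ y ∈ L', par y ∈ L)
    (rnd : Fin (3 * k) → CWord lam) (st : Bits i → Bool → Node lam) :
    (genNext ρ g gnext L L' rnd st : P lam B Gr _).run G G' =
      (layerCW ρ g gnext L L' rnd (fun x b => G (st x b).seed),
       layerSt ρ L' (layerCW ρ g gnext L L' rnd (fun x b => G (st x b).seed))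
        (fun x b => G (st x b).seed) st) := by
  have hE : ∀ x ∈ L, L.foldl (fun (E : Bits i → Bool → Bits (2 * (lam + 2))) x =>
      Function.update E x (fun b => if b then G (st x true).seed else G (st x false).seed))
      (fun _ _ _ => false) x = fun b => G (st x b).seed := by
    intro x hx
    have h1 := foldl_update_key L (fun x => x)
      (fun x (b : Bool) => if b then G (st x true).seed else G (st x false).seed)
      (fun _ _ _ => false) (fun _ _ _ _ hxy => hxy) hx
    rw [h1]
    funext b; cases b <;> rfl
  simp only [genNext, run_bind, run_foldlM, run_expand, run_prim, run_mem, run_correctionWord,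
    run_ite, run_correctChild, run_ret, decide_eq_true_eq]
  have hcw : L.foldl (fun (cw : Fin (3 * k) → CWord lam) x =>
      Function.update cw (ρ x (g x)) (word x (L.foldl
        (fun (E : Bits i → Bool → Bits (2 * (lam + 2))) x =>
          Function.update E x (fun b => if b then G (st x true).seed else G (st x false).seed))
        (fun _ _ _ => false) x)
        (fun j => if j then decide (app x true ∈ L') else decide (app x false ∈ L')) gnext
        (rnd (ρ x (g x))).1)) rnd = layerCW ρ g gnext L L' rnd (fun x b => G (st x b).seed) := by
    unfold layerCW
    refine foldl_congr_mem _ _ _ _ (fun t x hx => ?_)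
    rw [hE x hx]
    congr 2
    funext j; cases j <;> rfl
  rw [hcw]
  refine Prod.ext rfl ?_
  simp only
  have h2 := run_childStep L L' hL (fun y b => childNode (G (st (par y) b).seed) (st (par y) b)
    (layerCW ρ g gnext L L' rnd (fun x b => G (st x b).seed) (ρ (par y) false))
    (layerCW ρ g gnext L L' rnd (fun x b => G (st x b).seed) (ρ (par y) true)) (y (Fin.last i)))
  refine Eq.trans ?_ (h2.trans ?_)
  swap
  · funext y b
    unfold layerSt
    split_ifs <;> rfl
  refine foldl_congr_mem _ _ _ _ (fun t x hx => ?_)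
  simp only [par_app, app_last, hE x hx]
  have hb : ∀ (f : Bool → Node lam), (fun b => if b then f true else f false) = f := by
    intro f; funext b; cases b <;> rfl
  simp only [fun j => hb (fun b => childNode (G (st x b).seed) (st x b)
    (layerCW ρ g gnext L L' rnd (fun x b => G (st x b).seed) (ρ x false))
    (layerCW ρ g gnext L L' rnd (fun x b => G (st x b).seed) (ρ x true)) j)]

theorem run_prefixes (pts : List (Bits d)) (i : ℕ) (h : i ≤ d) :
    (prefixes pts i h : P lam B Gr _).run G G' = pfx pts i h := by
  exact run_dedup G G' (pts.map (pre i h))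

/-- The layers after depth `n`, from the nodes at depth `n`. -/
def runFrom (ρ : Hash k d) (g : (i : ℕ) → Bits i → Bool) (pts : List (Bits d)) :
    (m n : ℕ) → n + m = d → (Fin d → Fin (3 * k) → CWord lam) → (Bits n → Bool → Node lam) →
      (Fin d → Fin (3 * k) → CWord lam) × (Bits d → Bool → Node lam)
  | 0, _, h, cw, st => (cw, fun x => st (fun t => x (Fin.cast h t)))
  | m + 1, n, h, cw, st =>
    let c := layerCW (ρ ⟨n, by omega⟩) (g n) (g (n + 1)) (pfx pts n (by omega))
      (pfx pts (n + 1) (by omega)) (cw ⟨n, by omega⟩) (fun x b => G (st x b).seed)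
    runFrom ρ g pts m (n + 1) (by omega) (Function.update cw ⟨n, by omega⟩ c)
      (layerSt (ρ ⟨n, by omega⟩) (pfx pts (n + 1) (by omega)) c (fun x b => G (st x b).seed) st)

/-- The nodes of the two servers at the root. -/
def rootSt (g : (i : ℕ) → Bits i → Bool) (ω : Tape lam d k B Gr) (_ : Bits 0) (b : Bool) : Node lam :=
  if b then ⟨ω.2.1, !g 0 Fin.elim0, g 0 Fin.elim0⟩ else ⟨ω.1, false, false⟩

/-- `genLayers` recurses on the last layer, `runFrom` on the first one. The latter form is needed
since the hybrids start at an arbitrary depth from prescribed nodes. -/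
theorem runFrom_genLayers (ρ : Hash k d) (g : (i : ℕ) → Bits i → Bool) (pts : List (Bits d))
    (ω : Tape lam d k B Gr) (m n : ℕ) (h : n + m = d) :
    runFrom G ρ g pts m n h ((genLayers ρ g pts ω n (by omega)).run G G').1
      ((genLayers ρ g pts ω n (by omega)).run G G').2 =
    (genLayers ρ g pts ω d le_rfl).run G G' := by
  induction m generalizing n with
  | zero =>
    obtain rfl : n = d := h
    rfl
  | succ m ih =>
    rw [← ih (n + 1) (by omega)]
    simp only [runFrom, genLayers, run_bind, run_prefixes, run_forFin, run_prim, run_ret]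
    rw [run_genNext G G' _ _ _ _ _ (fun y hy => par_mem_pfx (pts := pts) hy)]

theorem run_genLayers (ρ : Hash k d) (g : (i : ℕ) → Bits i → Bool) (pts : List (Bits d))
    (ω : Tape lam d k B Gr) :
    (genLayers ρ g pts ω d le_rfl).run G G' =
      runFrom G ρ g pts d 0 (Nat.zero_add d) ω.2.2.1 (rootSt g ω) := by
  rw [← runFrom_genLayers G G' ρ g pts ω d 0 (Nat.zero_add d)]
  simp only [genLayers, run_bind, run_prim, run_ret]
  rfl

/-- The correction words of the last layer, from the expanded blocks `val` of both servers and the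
bits `sign`. -/
def lastCW (ρ : Bits d → Bool → Fin (3 * k)) (g : Bits d → Bool)
    (items : List (Bits d × (Fin B → Gr))) (rnd : Fin (3 * k) → Fin B → Gr)
    (sign : Bits d → Bool) (val : Bits d → Bool → Fin B → Gr) : Fin (3 * k) → Fin B → Gr :=
  items.foldl (fun cw e => Function.update cw (ρ e.1 (g e.1)) (fun j =>
    if sign e.1 then -(e.2 j - val e.1 false j + val e.1 true j)
    else e.2 j - val e.1 false j + val e.1 true j)) rnd

/-- The sign of the last correction word at a leaf. -/
def signOf (g : Bits d → Bool) (st : Bits d → Bool → Node lam) (x : Bits d) : Bool :=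
  if g x then (st x true).q else (st x true).u

/-- The block of group elements obtained from a seed. -/
def blockOf (R : GroupRep Gr) (v : Bits (B * glen Gr)) (j : Fin B) : Gr := R.convert (chunk v j)

theorem run_genLast (R : GroupRep Gr) (ρ : Bits d → Bool → Fin (3 * k)) (g : Bits d → Bool)
    (items : List (Bits d × (Fin B → Gr))) (rnd : Fin (3 * k) → Fin B → Gr)
    (st : Bits d → Bool → Node lam) :
    (genLast R ρ g items rnd st).run G G' =
      lastCW ρ g items rnd (signOf g st) (fun x b => blockOf R (G' (st x b).seed)) := by
  simp only [genLast, run_foldlM, run_bind, run_expandBlock, run_prim, run_forFin]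
  rfl

theorem run_genWith (R : GroupRep Gr) (ρ : Hash k d) (g : (i : ℕ) → Bits i → Bool)
    (items : List (Bits d × (Fin B → Gr))) (ω : Tape lam d k B Gr) :
    (genWith R ρ g items ω).run G G' =
      let lay := runFrom G ρ g (items.map (fun e => e.1)) d 0 (Nat.zero_add d) ω.2.2.1 (rootSt g ω)
      (fun b => (if b then ω.2.1 else ω.1, lay.1,
        lastCW (ρ ⟨d, Nat.lt_succ_self d⟩) (g d) items ω.2.2.2 (signOf (g d) lay.2)
          (fun x b => blockOf R (G' (lay.2 x b).seed))), g 0 Fin.elim0) := by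
  simp only [genWith, run_bind, run_genLayers, run_forFin, run_prim, run_genLast, run_ret]

/-! ### Consistency of the generated keys -/

/-- The node of a server reached from its root node `nd` with the correction words `cw`. -/
def nodeOf (ρ : Hash k d) (cw : Fin d → Fin (3 * k) → CWord lam) (nd : Node lam) :
    (n : ℕ) → n ≤ d → Bits n → Node lam
  | 0, _, _ => nd
  | n + 1, h, y =>
    childNode (G (nodeOf ρ cw nd n (Nat.le_of_succ_le h) (par y)).seed)
      (nodeOf ρ cw nd n (Nat.le_of_succ_le h) (par y))
      (cw ⟨n, h⟩ (ρ ⟨n, Nat.lt_succ_of_lt h⟩ (par y) false))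
      (cw ⟨n, h⟩ (ρ ⟨n, Nat.lt_succ_of_lt h⟩ (par y) true)) (y (Fin.last n))

/-- A node depends on the layers above it only. Writing or resampling its own layer of correction
words leaves it unchanged. -/
theorem nodeOf_congr (ρ : Hash k d) {cw cw' : Fin d → Fin (3 * k) → CWord lam} (nd : Node lam)
    (n : ℕ) (h : n ≤ d) (hcw : ∀ i : Fin d, (i : ℕ) < n → cw i = cw' i) (x : Bits n) :
    nodeOf G ρ cw nd n h x = nodeOf G ρ cw' nd n h x := by
  induction n with
  | zero => rfl
  | succ n ih =>
    simp only [nodeOf]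
    rw [ih (Nat.le_of_succ_le h) (fun i hi => hcw i (by omega)), hcw ⟨n, h⟩ (by simp)]

theorem run_evalPath (ρ : Hash k d) (b sel : Bool) (κ : Key lam d k B Gr) (x : Bits d) (i : ℕ)
    (h : i ≤ d) : (evalPath ρ b sel κ x i h).run G G' =
      nodeOf G ρ κ.2.1 (root b sel κ) i h (pre i h x) := by
  induction i with
  | zero => rfl
  | succ i ih =>
    simp only [evalPath, run_bind, ih, expandNode, run_prim, run_expand, run_ret, run_correctChild,
      nodeOf, par_pre, pre_last]

/-- The locations assigned in one layer are distinct. -/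
def GoodAt (ρ : Hash k d) (g : (i : ℕ) → Bits i → Bool) (pts : List (Bits d)) (n : ℕ)
    (h : n ≤ d) : Prop :=
  ∀ x ∈ pfx pts n h, ∀ y ∈ pfx pts n h,
    ρ ⟨n, Nat.lt_succ_of_le h⟩ x (g n x) = ρ ⟨n, Nat.lt_succ_of_le h⟩ y (g n y) → x = y

/-- The locations assigned in all layers are distinct. -/
def Good (ρ : Hash k d) (g : (i : ℕ) → Bits i → Bool) (pts : List (Bits d)) : Prop :=
  ∀ n h, GoodAt ρ g pts n h

/-- A layer is not touched after it has been written, and the nodes from which it was computed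
depend on earlier layers only. Hence the defining equations of the words, stated for intermediate
tables, also hold for the final table. -/
theorem runFrom_spec (ρ : Hash k d) (g : (i : ℕ) → Bits i → Bool) (pts : List (Bits d))
    (hg : Good ρ g pts) (nd : Bool → Node lam) (m n : ℕ) (h : n + m = d)
    (cw : Fin d → Fin (3 * k) → CWord lam) (st : Bits n → Bool → Node lam)
    (hst : ∀ x ∈ pfx pts n (by omega), ∀ b, st x b = nodeOf G ρ cw (nd b) n (by omega) x) :
    (∀ i : Fin d, (i : ℕ) < n → (runFrom G ρ g pts m n h cw st).1 i = cw i) ∧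
    (∀ x ∈ pts, ∀ b, (runFrom G ρ g pts m n h cw st).2 x b =
      nodeOf G ρ (runFrom G ρ g pts m n h cw st).1 (nd b) d le_rfl x) ∧
    (∀ (i : ℕ) (hi : i < d), n ≤ i → ∀ x ∈ pfx pts i hi.le, ∃ rnd,
      (runFrom G ρ g pts m n h cw st).1 ⟨i, hi⟩ (ρ ⟨i, Nat.lt_succ_of_lt hi⟩ x (g i x)) =
        word x (fun b => G (nodeOf G ρ (runFrom G ρ g pts m n h cw st).1 (nd b) i hi.le x).seed)
          (fun j => decide (app x j ∈ pfx pts (i + 1) hi)) (g (i + 1)) rnd) := by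
  induction m generalizing n cw with
  | zero =>
    obtain rfl : n = d := h
    refine ⟨fun _ _ => rfl, fun x hx b => hst x (mem_pfx_self.2 hx) b, fun i hi hi' => ?_⟩
    omega
  | succ m ih =>
    have hn : n < d := by omega
    set c := layerCW (ρ ⟨n, by omega⟩) (g n) (g (n + 1)) (pfx pts n (by omega))
      (pfx pts (n + 1) (by omega)) (cw ⟨n, by omega⟩) (fun x b => G (st x b).seed) with hc
    obtain ⟨h1, h2, h3⟩ := ih (n + 1) (by omega) (Function.update cw ⟨n, hn⟩ c)
      (layerSt (ρ ⟨n, by omega⟩) (pfx pts (n + 1) (by omega)) c (fun x b => G (st x b).seed) st)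
      (fun y hy b => by
        have hpar := par_mem_pfx hy
        have hnode : nodeOf G ρ (Function.update cw ⟨n, hn⟩ c) (nd b) n hn.le (par y) =
            st (par y) b := by
          rw [hst (par y) hpar b]
          exact nodeOf_congr G ρ (nd b) n hn.le
            (fun i hi => Function.update_of_ne (Fin.ne_of_lt hi) _ _) _
        simp only [layerSt, if_pos hy, nodeOf, hnode, Function.update_self])
    have hrun : runFrom G ρ g pts (m + 1) n h cw st = runFrom G ρ g pts m (n + 1) (by omega)
      (Function.update cw ⟨n, by omega⟩ c)
      (layerSt (ρ ⟨n, by omega⟩) (pfx pts (n + 1) (by omega)) c (fun x b => G (st x b).seed) st) :=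
      rfl
    rw [hrun]
    refine ⟨fun i hi => ?_, h2, fun i hi hi' x hx => ?_⟩
    · rw [h1 i (by omega), Function.update_of_ne (Fin.ne_of_lt hi)]
    · rcases Nat.lt_or_ge n i with hni | hni
      · exact h3 i hi hni x hx
      · obtain rfl : i = n := by omega
        refine ⟨(cw ⟨i, hi⟩ (ρ ⟨i, by omega⟩ x (g i x))).1, ?_⟩
        -- By the distinctness of the locations no other prefix overwrites the word of `x`.
        have hcx : c (ρ ⟨i, by omega⟩ x (g i x)) = word x (fun b => G (st x b).seed)
            (fun j => decide (app x j ∈ pfx pts (i + 1) hi)) (g (i + 1))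
            (cw ⟨i, hi⟩ (ρ ⟨i, by omega⟩ x (g i x))).1 :=
          foldl_update_key (pfx pts i hi.le) (fun x => ρ ⟨i, by omega⟩ x (g i x)) _ _
            (hg i hi.le) hx
        rw [h1 ⟨i, hi⟩ (by simp), Function.update_self, hcx]
        congr 1
        funext b
        rw [hst x hx b]
        congr 2
        exact nodeOf_congr G ρ (nd b) i hi.le (fun l hl => by
          rw [h1 l (by omega), Function.update_of_ne (Fin.ne_of_lt hl)]) x

/-- Terms common to both servers cancel. Since the control bits differ only in the one selected by
`gx`, of the two correction words only `c gx` contributes to the difference. Its bit parts contain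
the XOR of the expanded bits, so these cancel too and the prescribed difference remains. -/
theorem xor_children {i : ℕ} (x : Bits i) (w : Bool → Bits (2 * (lam + 2))) (nd : Bool → Node lam)
    (c : Bool → CWord lam) (has : Bool → Bool) (gx : Bool) (gnext : Bits (i + 1) → Bool)
    (rnd : Bits lam)
    (hu : (nd true).u = xor (nd false).u (!gx)) (hq : (nd true).q = xor (nd false).q gx)
    (hc : c gx = word x w has gnext rnd) (j : Bool) :
    (∀ t, (childNode (w true) (nd true) (c false) (c true) j).seed t =
      xor ((childNode (w false) (nd false) (c false) (c true) j).seed t)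
        (xor (xor (childSeed (w false) j t) (childSeed (w true) j t)) ((c gx).1 t))) ∧
    (childNode (w true) (nd true) (c false) (c true) j).u =
      xor (childNode (w false) (nd false) (c false) (c true) j).u (has j && !gnext (app x j)) ∧
    (childNode (w true) (nd true) (c false) (c true) j).q =
      xor (childNode (w false) (nd false) (c false) (c true) j).q (has j && gnext (app x j)) := by
  have hm := congrArg (fun w => w.2.1 j) hc
  have hp := congrArg (fun w => w.2.2 j) hc
  simp only [word] at hm hp
  refine ⟨fun t => ?_, ?_, ?_⟩
  · cases gx <;> simp only [childNode, hu, hq] <;>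
      generalize (c false).1 t = a <;> generalize (c true).1 t = b <;>
      generalize (nd false).u = e <;> generalize (nd false).q = f <;>
      generalize childSeed (w false) j t = p <;> generalize childSeed (w true) j t = q <;>
      revert a b e f p q <;> decide
  · cases gx <;> simp only [childNode, hu, hq, hm] <;>
      generalize (c false).2.1 j = a <;> generalize (c true).2.1 j = b <;>
      generalize (nd false).u = e <;> generalize (nd false).q = f <;>
      generalize childU (w false) j = p <;> generalize childU (w true) j = q <;>
      generalize (has j && !gnext (app x j)) = r <;>
      revert a b e f p q r <;> decide
  · cases gx <;> simp only [childNode, hu, hq, hp] <;>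
      generalize (c false).2.2 j = a <;> generalize (c true).2.2 j = b <;>
      generalize (nd false).u = e <;> generalize (nd false).q = f <;>
      generalize childQ (w false) j = p <;> generalize childQ (w true) j = q <;>
      generalize (has j && gnext (app x j)) = r <;>
      revert a b e f p q r <;> decide

/-- Off the paths to the points both servers hold the same node; on the paths the control bits differ
in the selected one only. -/
theorem nodes_relation (ρ : Hash k d) (g : (i : ℕ) → Bits i → Bool) (pts : List (Bits d))
    (cw : Fin d → Fin (3 * k) → CWord lam) (nd : Bool → Node lam) (hpts : pts ≠ [])
    (hu : (nd true).u = xor (nd false).u (!g 0 Fin.elim0))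
    (hq : (nd true).q = xor (nd false).q (g 0 Fin.elim0))
    (hcw : ∀ (i : ℕ) (hi : i < d), ∀ x ∈ pfx pts i hi.le, ∃ rnd,
      cw ⟨i, hi⟩ (ρ ⟨i, Nat.lt_succ_of_lt hi⟩ x (g i x)) =
        word x (fun b => G (nodeOf G ρ cw (nd b) i hi.le x).seed)
          (fun j => decide (app x j ∈ pfx pts (i + 1) hi)) (g (i + 1)) rnd)
    (n : ℕ) (h : n ≤ d) (y : Bits n) :
    (y ∈ pfx pts n h →
      (nodeOf G ρ cw (nd true) n h y).u = xor (nodeOf G ρ cw (nd false) n h y).u (!g n y) ∧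
      (nodeOf G ρ cw (nd true) n h y).q = xor (nodeOf G ρ cw (nd false) n h y).q (g n y)) ∧
    (y ∉ pfx pts n h → nodeOf G ρ cw (nd true) n h y = nodeOf G ρ cw (nd false) n h y) := by
  induction n with
  | zero =>
    have hy : y = Fin.elim0 := funext fun t => t.elim0
    subst hy
    refine ⟨fun _ => ⟨hu, hq⟩, fun hy => ?_⟩
    obtain ⟨x, hx⟩ := List.exists_mem_of_ne_nil _ hpts
    exact absurd (mem_pfx.2 ⟨x, hx, funext fun t => t.elim0⟩) hy
  | succ n ih =>
    obtain ⟨ih1, ih2⟩ := ih (Nat.le_of_succ_le h) (par y)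
    by_cases hpar : par y ∈ pfx pts n (Nat.le_of_succ_le h)
    · obtain ⟨hu', hq'⟩ := ih1 hpar
      obtain ⟨rnd, hrnd⟩ := hcw n h (par y) hpar
      obtain ⟨r1, r2, r3⟩ := xor_children (par y)
        (fun b => G (nodeOf G ρ cw (nd b) n (Nat.le_of_succ_le h) (par y)).seed)
        (fun b => nodeOf G ρ cw (nd b) n (Nat.le_of_succ_le h) (par y))
        (fun b => cw ⟨n, h⟩ (ρ ⟨n, Nat.lt_succ_of_lt h⟩ (par y) b))
        (fun j => decide (app (par y) j ∈ pfx pts (n + 1) h)) (g n (par y)) (g (n + 1)) rnd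
        hu' hq' hrnd (y (Fin.last n))
      rw [app_par] at r2 r3
      constructor
      · intro hy
        simp only [hy, decide_true, Bool.true_and] at r2 r3
        exact ⟨r2, r3⟩
      · intro hy
        simp only [hy, decide_false, Bool.false_and, Bool.xor_false] at r2 r3
        have hseed : ∀ t, (nodeOf G ρ cw (nd true) (n + 1) h y).seed t =
            (nodeOf G ρ cw (nd false) (n + 1) h y).seed t := by
          intro t
          refine (r1 t).trans ?_
          rw [hrnd]
          -- The parent of `y` lies on a path and `y` does not, so the sibling of `y` does. In this
          -- case the seed correction is the XOR of the expanded seeds at `y` itself.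
          obtain ⟨j, hj⟩ := exists_app_mem_pfx h hpar
          have hne : app (par y) (y (Fin.last n)) ∉ pfx pts (n + 1) h := by rwa [app_par]
          cases hl : y (Fin.last n)
          · rw [hl] at hne
            obtain rfl : j = true := by
              cases j with
              | false => exact absurd hj hne
              | true => rfl
            simp only [word, hne, decide_false, Bool.false_and]
            simp [nodeOf, hl]
          · rw [hl] at hne
            obtain rfl : j = false := by
              cases j with
              | true => exact absurd hj hne
              | false => rfl
            simp only [word, hne, decide_false, hj]
            simp [nodeOf, hl]
        have hN : ∀ a b : Node lam, a.seed = b.seed → a.u = b.u → a.q = b.q → a = b := by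
          rintro ⟨_, _, _⟩ ⟨_, _, _⟩ rfl rfl rfl; rfl
        exact hN _ _ (funext hseed) r2 r3
    · have hy : y ∉ pfx pts (n + 1) h := fun hy => hpar (par_mem_pfx hy)
      refine ⟨fun hy' => absurd hy' hy, fun _ => ?_⟩
      simp only [nodeOf, ih2 hpar]

theorem run_leafBlock (R : GroupRep Gr) (ρ : Hash k d) (b : Bool) (κ : Key lam d k B Gr)
    (x : Bits d) (nd : Node lam) (j : Fin B) :
    (leafBlock R ρ b κ x nd).run G G' j =
      (if b then -1 else 1 : ℤ) • (blockOf R (G' nd.seed) j +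
        (if nd.u then κ.2.2 (ρ ⟨d, Nat.lt_succ_self d⟩ x false) j else 0) +
        (if nd.q then κ.2.2 (ρ ⟨d, Nat.lt_succ_self d⟩ x true) j else 0)) := by
  simp only [leafBlock, run_bind, run_prim, run_expandBlock, run_forFin, blockOf]
  cases b <;> cases nd.u <;> cases nd.q <;> simp <;> abel

/-- Keys generated with an assignment free of collisions are correct. -/
theorem genWith_correct (R : GroupRep Gr) (ρ : Hash k d) (g : (i : ℕ) → Bits i → Bool)
    (α : Fin k → Bits d) (β : Fin k → Fin B → Gr) (hα : Function.Injective α) (hk : 0 < k)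
    (hg : Good ρ g (List.ofFn α)) (ω : Tape lam d k B Gr) (x : Bits d) (j : Fin B) :
    let out := (genWith R ρ g (List.ofFn (fun ℓ => (α ℓ, β ℓ))) ω).run G G'
    (eval R ρ false out.2 (out.1 false) x j).run G G' +
      (eval R ρ true out.2 (out.1 true) x j).run G G' = blockSparse α β x j := by
  intro out
  have hmap : (List.ofFn (fun ℓ => (α ℓ, β ℓ))).map (fun e => e.1) = List.ofFn α := by
    simp [List.map_ofFn, Function.comp_def]
  have hout : out = _ := run_genWith G G' R ρ g _ ω
  rw [hmap] at hout
  set lay := runFrom G ρ g (List.ofFn α) d 0 (Nat.zero_add d) ω.2.2.1 (rootSt g ω) with hlay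
  have hroot : ∀ b, root b out.2 (out.1 b) = rootSt g ω Fin.elim0 b := by
    intro b; rw [hout]; cases b <;> simp [root, rootSt]
  obtain ⟨-, h2, h3⟩ := runFrom_spec G ρ g (List.ofFn α) hg (rootSt g ω Fin.elim0) d 0
    (Nat.zero_add d) ω.2.2.1 (rootSt g ω) (fun x _ b => rfl)
  rw [← hlay] at h2 h3
  obtain ⟨r1, r2⟩ := nodes_relation G ρ g (List.ofFn α) lay.1 (rootSt g ω Fin.elim0)
    (by simp [List.ofFn_eq_nil_iff]; omega) (by simp [rootSt]) (by simp [rootSt])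
    (fun i hi x hx => h3 i hi (Nat.zero_le i) x hx) d le_rfl x
  have hev : ∀ b, (eval R ρ b out.2 (out.1 b) x j).run G G' =
      (leafBlock R ρ b (out.1 b) x (nodeOf G ρ lay.1 (rootSt g ω Fin.elim0 b) d le_rfl x)).run
        G G' j := by
    intro b
    simp only [eval, run_bind, run_ret, run_evalPath, hroot, pre_self]
    rw [hout]
  rw [hev, hev, run_leafBlock, run_leafBlock]
  have hlast : ∀ b, (out.1 b).2.2 = lastCW (ρ ⟨d, Nat.lt_succ_self d⟩) (g d)
      (List.ofFn (fun ℓ => (α ℓ, β ℓ))) ω.2.2.2 (signOf (g d) lay.2)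
          (fun x b => blockOf R (G' (lay.2 x b).seed)) := by
    intro b; rw [hout]
  rw [hlast, hlast]
  by_cases hx : x ∈ List.ofFn α
  · obtain ⟨hu, hq⟩ := r1 (mem_pfx_self.2 hx)
    obtain ⟨ℓ, rfl⟩ := (List.mem_ofFn' _ _).1 hx
    have hword := foldl_update_key (List.ofFn (fun ℓ => (α ℓ, β ℓ)))
      (fun e => ρ ⟨d, Nat.lt_succ_self d⟩ e.1 (g d e.1))
      (fun e (j : Fin B) =>
        if signOf (g d) lay.2 e.1 then
          -(e.2 j - blockOf R (G' (lay.2 e.1 false).seed) j + blockOf R (G' (lay.2 e.1 true).seed) j)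
        else
          e.2 j - blockOf R (G' (lay.2 e.1 false).seed) j + blockOf R (G' (lay.2 e.1 true).seed) j)
      ω.2.2.2 (by
        intro e he f hf hef
        obtain ⟨a, rfl⟩ := (List.mem_ofFn' _ _).1 he
        obtain ⟨b, rfl⟩ := (List.mem_ofFn' _ _).1 hf
        have := hg d le_rfl (α a) (mem_pfx_self.2 ((List.mem_ofFn' _ _).2 ⟨a, rfl⟩)) (α b)
          (mem_pfx_self.2 ((List.mem_ofFn' _ _).2 ⟨b, rfl⟩)) hef
        rw [hα this]) (x := (α ℓ, β ℓ)) ((List.mem_ofFn' _ _).2 ⟨ℓ, rfl⟩)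
    have hword' : lastCW (ρ ⟨d, Nat.lt_succ_self d⟩) (g d)
      (List.ofFn (fun ℓ => (α ℓ, β ℓ))) ω.2.2.2 (signOf (g d) lay.2)
          (fun x b => blockOf R (G' (lay.2 x b).seed))
          (ρ ⟨d, Nat.lt_succ_self d⟩ (α ℓ) (g d (α ℓ))) j = _ := congrFun hword j
    simp only [signOf, h2 _ hx] at hword'
    have hbs : blockSparse α β (α ℓ) j = β ℓ j := by
      simp [blockSparse, hα.eq_iff]
    rw [hbs]
    revert hword' hu hq
    generalize lastCW (ρ ⟨d, Nat.lt_succ_self d⟩) (g d)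
      (List.ofFn (fun ℓ => (α ℓ, β ℓ))) ω.2.2.2 (signOf (g d) lay.2)
          (fun x b => blockOf R (G' (lay.2 x b).seed)) = c
    generalize nodeOf G ρ lay.1 (rootSt g ω Fin.elim0 true) d le_rfl (α ℓ) = n1
    generalize nodeOf G ρ lay.1 (rootSt g ω Fin.elim0 false) d le_rfl (α ℓ) = n0
    intro hu hq hword
    rw [hu, hq] at hword ⊢
    -- Exactly one server adds the word selected by `g`; the other word is added by both or by
    -- neither and cancels. The sign of the correction word compensates the factor `-1` of server 1
    -- if that is the server adding it.
    cases hgx : g d (α ℓ) <;> cases hn0 : n0.u <;> cases hn0' : n0.q <;>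
      simp only [hgx, hn0, hn0', Bool.xor_false, Bool.xor_true, Bool.not_true,
        Bool.not_false, if_true, if_false, Bool.false_eq_true] at hword ⊢ <;>
      simp only [hword] <;> simp <;> abel
  -- Both servers hold the same leaf node, so their shares are opposite.
  · rw [r2 (fun h => hx (mem_pfx_self.1 h))]
    have hbs : blockSparse α β x j = 0 := by
      refine Finset.sum_eq_zero (fun ℓ _ => if_neg (fun h => hx ?_))
      exact (List.mem_ofFn' _ _).2 ⟨ℓ, h⟩
    rw [hbs]
    simp only [if_true, Bool.false_eq_true, if_false, one_smul, neg_smul, add_neg_cancel]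

end Model

end DPF

namespace DPF

open Prog

/-! ### Correctness with error `7d/k` -/

section Correctness

variable {lam d k B : ℕ} {Gr : Type} [AddCommGroup Gr] [Fintype Gr]
  (G : Bits lam → Bits (2 * (lam + 2))) (G' : Bits lam → Bits (B * glen Gr))

theorem pfx_zero {pts : List (Bits d)} (hpts : pts ≠ []) :
    pfx pts 0 (Nat.zero_le d) = [Fin.elim0] := by
  have hmem : ∀ y ∈ pfx pts 0 (Nat.zero_le d), y = Fin.elim0 := fun y _ => funext fun t => t.elim0
  have hne : pfx pts 0 (Nat.zero_le d) ≠ [] := by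
    obtain ⟨x, hx⟩ := List.exists_mem_of_ne_nil _ hpts
    exact List.ne_nil_of_mem (mem_pfx.2 ⟨x, hx, rfl⟩)
  have hnd := nodup_pfx pts 0 (Nat.zero_le d)
  revert hmem hne hnd
  generalize pfx pts 0 (Nat.zero_le d) = l
  intro hmem hne hnd
  match l with
  | [] => exact absurd rfl hne
  | [a] => rw [hmem a (by simp)]
  | a :: b :: l =>
    exfalso
    rw [List.nodup_cons] at hnd
    exact hnd.1 (by rw [hmem a (by simp), hmem b (by simp)]; simp)

/-- `cuckoo_spec` is applied layer by layer. At the root there is one item, and it receives its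
first location whatever the shared function is. So the public bit is `false` after every successful
run and carries no information. -/
theorem assignments_spec (ρ : Hash k d) (pts : List (Bits d)) (hpts : pts ≠ []) (n : ℕ)
    (h : n ≤ d + 1) :
    (∀ g, (assignments ρ pts n h : P lam B Gr _).run G G' = some g →
      (∀ i (hi : i ≤ d), i < n → GoodAt ρ g pts i hi) ∧ g 0 Fin.elim0 = false) ∧
    ((assignments ρ pts n h : P lam B Gr _).run G G' = none →
      ∃ (i : ℕ) (hi : i ≤ d), ∃ a o Q,
        Cuckoo.DoubleReturn (ρ ⟨i, Nat.lt_succ_of_le hi⟩) (pfx pts i hi) a o Q) := by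
  induction n with
  | zero =>
    refine ⟨fun g hg => ?_, fun hg => ?_⟩
    · simp only [assignments, run_ret, Option.some.injEq] at hg
      subst hg
      exact ⟨fun i _ hi => absurd hi (Nat.not_lt_zero i), rfl⟩
    · simp [assignments] at hg
  | succ n ih =>
    obtain ⟨ih1, ih2⟩ := ih (Nat.le_of_succ_le h)
    simp only [assignments, run_bind]
    cases hprev : (assignments ρ pts n (Nat.le_of_succ_le h) : P lam B Gr _).run G G' with
    | none => exact ⟨fun g hg => by simp at hg, fun _ => ih2 hprev⟩
    | some g =>
      obtain ⟨h1, h2⟩ := ih1 g hprev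
      simp only [run_bind, run_prefixes]
      have hc := Cuckoo.cuckoo_spec (h := ρ ⟨n, h⟩) (L := pfx pts n (Nat.le_of_succ_le_succ h)) G G'
      cases hres : (cuckoo (ρ ⟨n, h⟩) (pfx pts n (Nat.le_of_succ_le_succ h)) :
          P lam B Gr _).run G G' with
      | none =>
        exact ⟨fun g hg => by simp at hg, fun _ => ⟨n, Nat.le_of_succ_le_succ h, hc.2 hres⟩⟩
      | some gn =>
        refine ⟨fun g' hg' => ?_, fun hg' => by simp at hg'⟩
        simp only [run_ret, Option.some.injEq] at hg'
        subst hg'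
        refine ⟨fun i hi hin => ?_, ?_⟩
        · unfold GoodAt
          rcases Nat.lt_or_ge i n with hlt | hge
          · rw [Function.update_of_ne hlt.ne]
            exact h1 i hi hlt
          · obtain rfl : i = n := by omega
            rw [Function.update_self]
            exact hc.1 gn hres
        · cases n with
          | zero =>
            rw [Function.update_self]
            obtain ⟨g0, hg0, hg0'⟩ := Cuckoo.cuckoo_singleton (h := ρ ⟨0, h⟩) G G' Fin.elim0
            rw [pfx_zero hpts, hg0] at hres
            simp only [Option.some.injEq] at hres
            rw [← hres]; exact hg0'
          | succ n => rw [Function.update_of_ne (by omega)]; exact h2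

/-- Nothing has to be assumed about the root layer, whose single item admits no double return. -/
theorem gen_correct (R : GroupRep Gr) (ρ : Hash k d) (α : Fin k → Bits d) (β : Fin k → Fin B → Gr)
    (hα : Function.Injective α) (hk : 0 < k)
    (hρ : ∀ i : Fin d, ¬ ∃ a o Q, Cuckoo.DoubleReturn (ρ i.succ) (pfx (List.ofFn α) (i + 1) i.2) a o Q)
    (ω : Tape lam d k B Gr) (x : Bits d) (j : Fin B) :
    let out := (gen R ρ α β ω).run G G'
    (eval R ρ false out.2 (out.1 false) x j).run G G' +
      (eval R ρ true out.2 (out.1 true) x j).run G G' = blockSparse α β x j := by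
  have hpts : List.ofFn α ≠ [] := by simp [List.ofFn_eq_nil_iff]; omega
  obtain ⟨h1, h2⟩ := assignments_spec G G' ρ (List.ofFn α) hpts (d + 1) le_rfl
  simp only [gen, run_bind]
  cases hres : (assignments ρ (List.ofFn α) (d + 1) le_rfl : P lam B Gr _).run G G' with
  | none =>
    exfalso
    obtain ⟨i, hi, a, o, Q, hQ⟩ := h2 hres
    cases i with
    | zero =>
      have := hQ.one_lt_length
      rw [pfx_zero hpts] at this
      simp at this
    | succ i => exact hρ ⟨i, hi⟩ ⟨a, o, Q, hQ⟩
  | some g =>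
    exact genWith_correct G G' R ρ g α β hα hk
      (fun n h => (h1 g hres).1 n h (Nat.lt_succ_of_le h)) ω x j

instance : Fintype (Hash k d) := inferInstanceAs (Fintype (∀ i : Fin (d + 1), Bits i → Bool → Fin (3 * k)))

/-- A union bound over the `d` layers below the root. The hash function of each layer is by itself
uniform, and it is applied to at most `k` prefixes. -/
theorem correctWithError (R : GroupRep Gr) (hk : 0 < k) :
    CorrectWithError (d := d) (k := k) R G G' (7 * d / k) := by
  intro α β hα x j
  have hne : Nonempty (Fin (3 * k)) := ⟨⟨0, by omega⟩⟩
  rw [prob_eq_avg]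
  have hbad : ∀ i : Fin d, avg (fun z : Hash k d × Tape lam d k B Gr =>
      ind (∃ a o Q, Cuckoo.DoubleReturn (z.1 i.succ) (pfx (List.ofFn α) (i + 1) i.2) a o Q)) ≤
        7 / k := by
    intro i
    rw [avg_fst (fun ρ : Hash k d =>
      ind (∃ a o Q, Cuckoo.DoubleReturn (ρ i.succ) (pfx (List.ofFn α) (i + 1) i.2) a o Q))]
    have h1 := avg_pi (β := fun i : Fin (d + 1) => Bits i → Bool → Fin (3 * k)) i.succ
      (fun h => ind (∃ a o Q, Cuckoo.DoubleReturn h (pfx (List.ofFn α) (i + 1) i.2) a o Q))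
    refine h1.le.trans (Cuckoo.avg_doubleReturn_le hk _ ?_)
    simpa using length_pfx_le (List.ofFn α) (i + 1) i.2
  -- Pointwise, 1 is at most the indicator of a correct output plus the number of layers with a
  -- double return; the claim follows by averaging.
  have hsum := avg_mono (Ω := Hash k d × Tape lam d k B Gr) (f := fun _ => 1)
    (g := fun z => ind ((fun z : Hash k d × Tape lam d k B Gr =>
        let out := (gen R z.1 α β z.2).run G G'
        (eval R z.1 false out.2 (out.1 false) x j).run G G' +
          (eval R z.1 true out.2 (out.1 true) x j).run G G' = blockSparse α β x j) z) +
      ∑ i : Fin d, ind (∃ a o Q,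
        Cuckoo.DoubleReturn (z.1 i.succ) (pfx (List.ofFn α) (i + 1) i.2) a o Q)) (by
    intro z
    by_cases hz : ∀ i : Fin d, ¬ ∃ a o Q,
        Cuckoo.DoubleReturn (z.1 i.succ) (pfx (List.ofFn α) (i + 1) i.2) a o Q
    · have := ind_true (gen_correct G G' R z.1 α β hα hk hz z.2 x j)
      refine le_trans this.ge (le_add_of_nonneg_right ?_)
      exact Finset.sum_nonneg (fun _ _ => ind_nonneg _)
    · push Not at hz
      obtain ⟨i, hi⟩ := hz
      refine le_trans ?_ (le_add_of_nonneg_left (ind_nonneg _))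
      rw [← ind_true hi]
      exact Finset.single_le_sum (f := fun i : Fin d => ind (∃ a o Q,
        Cuckoo.DoubleReturn (z.1 i.succ) (pfx (List.ofFn α) (i + 1) i.2) a o Q))
        (fun _ _ => ind_nonneg _) (Finset.mem_univ i))
  rw [avg_const, avg_add, avg_sum] at hsum
  have h2 := Finset.sum_le_sum (s := Finset.univ) (fun i _ => hbad i)
  rw [Finset.sum_const, Finset.card_univ, Fintype.card_fin, nsmul_eq_mul] at h2
  have h3 : (7 : ℝ) * d / k = d * (7 / k) := by ring
  rw [h3]
  linarith

end Correctness

/-! ### Cost of key generation -/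

section GenCost

variable {lam d k B : ℕ} {Gr : Type} [AddCommGroup Gr] [Fintype Gr]
  (G : Bits lam → Bits (2 * (lam + 2))) (G' : Bits lam → Bits (B * glen Gr)) (c : Bool)

theorem ops_prefixes_le (pts : List (Bits d)) (i : ℕ) (h : i ≤ d) :
    (prefixes pts i h : P lam B Gr _).ops G G' ≤ pts.length * pts.length := by
  simpa [prefixes] using ops_dedup_le (S := Bits lam) (W := Bits (2 * (lam + 2)))
    (V := Bits (B * glen Gr)) G G' (pts.map (pre i h))

theorem callsG_prefixes (pts : List (Bits d)) (i : ℕ) (h : i ≤ d) :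
    (prefixes pts i h : P lam B Gr _).callsG G G' c = 0 := by
  simp [prefixes]

theorem ops_assignments_le (ρ : Hash k d) (pts : List (Bits d)) (n : ℕ) (h : n ≤ d + 1) :
    (assignments ρ pts n h : P lam B Gr _).ops G G' ≤
      n * (pts.length * pts.length + 7 * (pts.length + 1) ^ 4) := by
  induction n with
  | zero => simp [assignments]
  | succ n ih =>
    have ih := ih (Nat.le_of_succ_le h)
    simp only [assignments, ops_bind]
    rw [add_mul, one_mul]
    cases (assignments ρ pts n (Nat.le_of_succ_le h) : P lam B Gr _).run G G' with
    | none => simp only [ops_ret]; omega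
    | some g =>
      simp only [ops_bind, run_prefixes]
      have h1 := ops_prefixes_le (Gr := Gr) G G' pts n (Nat.le_of_succ_le_succ h)
      have h2 := Cuckoo.ops_cuckoo_le (h := ρ ⟨n, h⟩)
        (L := pfx pts n (Nat.le_of_succ_le_succ h)) G G'
      have h3 : 7 * ((pfx pts n (Nat.le_of_succ_le_succ h)).length + 1) ^ 4 ≤
          7 * (pts.length + 1) ^ 4 := by
        have := length_pfx_le pts n (Nat.le_of_succ_le_succ h)
        gcongr
      cases (cuckoo (ρ ⟨n, h⟩) (pfx pts n (Nat.le_of_succ_le_succ h)) : P lam B Gr _).run G G' <;>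
        simp only [ops_ret] <;> omega

theorem callsG_assignments (ρ : Hash k d) (pts : List (Bits d)) (n : ℕ) (h : n ≤ d + 1) :
    (assignments ρ pts n h : P lam B Gr _).callsG G G' c = 0 ∧
    (assignments ρ pts n h : P lam B Gr _).callsG' G G' c = 0 := by
  induction n with
  | zero => simp [assignments]
  | succ n ih =>
    obtain ⟨ih1, ih2⟩ := ih (Nat.le_of_succ_le h)
    simp only [assignments, callsG_bind, callsG'_bind, ih1, ih2]
    cases (assignments ρ pts n (Nat.le_of_succ_le h) : P lam B Gr _).run G G' with
    | none => simp
    | some g =>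
      simp only [callsG_bind, callsG'_bind, run_prefixes, Cuckoo.callsG_cuckoo,
        Cuckoo.callsG'_cuckoo]
      cases (cuckoo (ρ ⟨n, h⟩) (pfx pts n (Nat.le_of_succ_le_succ h)) : P lam B Gr _).run G G' <;>
        simp [prefixes]

theorem ops_correctionWord {i : ℕ} (x : Bits i) (w : Bool → Bits (2 * (lam + 2)))
    (has : Bool → Bool) (gnext : Bits (i + 1) → Bool) (rnd : Bits lam) :
    (correctionWord x w has gnext rnd : P lam B Gr _).ops G G' = 9 ∧
    (correctionWord x w has gnext rnd : P lam B Gr _).callsG G G' c = 0 ∧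
    (correctionWord x w has gnext rnd : P lam B Gr _).callsG' G G' c = 0 := by
  simp [correctionWord]

/-- For each node of `L` the three loops take 1, `11 + 2 * L'.length` and `28 + 2 * L'.length`
operations. In the second these are two membership tests, nine operations for the word and two
accesses; in the third two accesses and, for both children, a test, twelve XORs and an update. -/
theorem genNext_cost {i : ℕ} (ρ : Bits i → Bool → Fin (3 * k)) (g : Bits i → Bool)
    (gnext : Bits (i + 1) → Bool) (L : List (Bits i)) (L' : List (Bits (i + 1)))
    (rnd : Fin (3 * k) → CWord lam) (st : Bits i → Bool → Node lam) :
    (genNext ρ g gnext L L' rnd st : P lam B Gr _).ops G G' ≤ L.length * (40 + 4 * L'.length) ∧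
    (genNext ρ g gnext L L' rnd st : P lam B Gr _).callsG G G' c ≤ L.length ∧
    (genNext ρ g gnext L L' rnd st : P lam B Gr _).callsG' G G' c = 0 := by
  have hmem : ∀ y, (mem y L' : P lam B Gr _).ops G G' ≤ L'.length := fun y => ops_mem_le G G' y L'
  refine ⟨?_, ?_, ?_⟩
  · simp only [genNext, ops_bind, ops_ret]
    refine (add_le_add (ops_foldlM_le G G' _ L _ 1 (fun _ => True) trivial
      (fun _ _ _ _ => trivial) ?_) (add_le_add (ops_foldlM_le G G' _ L _ (11 + 2 * L'.length)
        (fun _ => True) trivial (fun _ _ _ _ => trivial) ?_) (add_le_add (ops_foldlM_le G G' _ L _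
          (28 + 2 * L'.length) (fun _ => True) trivial (fun _ _ _ _ => trivial) ?_)
            le_rfl))).trans ?_
    · intro _ _ _ _; simp
    · intro _ x _ _
      simp only [ops_bind, ops_prim, (ops_correctionWord G G' c _ _ _ _ _).1]
      have h1 := hmem (app x false)
      have h2 := hmem (app x true)
      omega
    · intro _ x _ _
      simp only [ops_bind, ops_prim, run_mem, ops_ite, ops_correctChild, ops_ret]
      have h1 := hmem (app x false)
      have h2 := hmem (app x true)
      split_ifs <;> omega
    · ring_nf; omega
  · simp only [genNext, callsG_bind, callsG_ret]
    refine (add_le_add (callsG_foldlM_le G G' c _ L _ 1 ?_) (add_le_add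
      (callsG_foldlM_le G G' c _ L _ 0 ?_) (add_le_add (callsG_foldlM_le G G' c _ L _ 0 ?_)
            le_rfl))).trans ?_
    · intro _ _; cases c <;> simp
    · intro _ _; simp [(ops_correctionWord G G' c _ _ _ _ _).2.1]
    · intro _ _; simp
    · omega
  · refine Nat.le_zero.1 ?_
    simp only [genNext, callsG'_bind, callsG'_ret]
    refine (add_le_add (callsG'_foldlM_le G G' c _ L _ 0 ?_) (add_le_add
      (callsG'_foldlM_le G G' c _ L _ 0 ?_) (add_le_add (callsG'_foldlM_le G G' c _ L _ 0 ?_)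
            le_rfl))).trans ?_
    · intro _ _; simp
    · intro _ _; simp [(ops_correctionWord G G' c _ _ _ _ _).2.2]
    · intro _ _; simp
    · omega

/-- A layer needs two lists of prefixes (`2k²`), the table of random words (`3k`), `genNext` (`40k +
4k²`) and one update. -/
theorem genLayers_cost (ρ : Hash k d) (g : (i : ℕ) → Bits i → Bool) (pts : List (Bits d))
    (hpts : pts.length ≤ k) (ω : Tape lam d k B Gr) (n : ℕ) (h : n ≤ d) :
    (genLayers ρ g pts ω n h).ops G G' ≤ 3 + n * (6 * (k * k) + 43 * k + 1) ∧
    (genLayers ρ g pts ω n h).callsG G G' c ≤ k * n ∧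
    (genLayers ρ g pts ω n h).callsG' G G' c = 0 := by
  induction n with
  | zero => simp [genLayers]
  | succ n ih =>
    obtain ⟨h1, h2, h3⟩ := ih (Nat.le_of_succ_le h)
    have hl : (pfx pts n (Nat.le_of_succ_le h)).length ≤ k := (length_pfx_le _ _ _).trans hpts
    have hl' : (pfx pts (n + 1) h).length ≤ k := (length_pfx_le _ _ _).trans hpts
    have hN := fun rnd st => genNext_cost (Gr := Gr) (B := B) G G' c (ρ ⟨n, Nat.lt_succ_of_lt h⟩)
      (g n) (g (n + 1)) (pfx pts n (Nat.le_of_succ_le h)) (pfx pts (n + 1) h) rnd st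
    have hkk : pts.length * pts.length ≤ k * k := Nat.mul_le_mul hpts hpts
    refine ⟨?_, ?_, ?_⟩
    · simp only [genLayers, ops_bind, run_prefixes, ops_prim, ops_ret]
      have p1 := ops_prefixes_le (Gr := Gr) (B := B) G G' pts n (Nat.le_of_succ_le h)
      have p2 := ops_prefixes_le (Gr := Gr) (B := B) G G' pts (n + 1) h
      have p3 : ∀ cw : Fin d → Fin (3 * k) → CWord lam,
          (forFin (3 * k) (fun a => prim (cw ⟨n, h⟩ a)) : P lam B Gr _).ops G G' = 3 * k * 1 :=
        fun cw => ops_forFin G G' _ _ 1 (fun _ => by simp)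
      have p4 : (pfx pts n (Nat.le_of_succ_le h)).length * (40 + 4 * (pfx pts (n + 1) h).length) ≤
          k * (40 + 4 * k) := by gcongr
      rw [p3]
      have p5 := fun rnd st => (hN rnd st).1.trans p4
      refine (add_le_add h1 (add_le_add p1 (add_le_add p2 (add_le_add le_rfl (add_le_add
        (p5 _ _) le_rfl))))).trans ?_
      nlinarith
    · simp only [genLayers, callsG_bind, run_prefixes, callsG_prim, callsG_ret]
      refine (add_le_add h2 (add_le_add (callsG_prefixes G G' c pts _ _).le (add_le_add
        (callsG_prefixes G G' c pts _ _).le (add_le_add (le_of_eq (callsG_forFin G G' c _ _ (by simp)))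
          (add_le_add ((hN _ _).2.1.trans hl) le_rfl))))).trans ?_
      nlinarith
    · simp only [genLayers, callsG'_bind, run_prefixes, callsG'_prim, callsG'_ret, h3, (hN _ _).2.2]
      rw [callsG'_forFin G G' c _ _ (by simp)]
      simp [prefixes]

theorem genWith_cost (R : GroupRep Gr) (ρ : Hash k d) (g : (i : ℕ) → Bits i → Bool)
    (items : List (Bits d × (Fin B → Gr))) (hitems : items.length ≤ k) (ω : Tape lam d k B Gr) :
    (genWith R ρ g items ω).ops G G' ≤
      4 + d * (6 * (k * k) + 43 * k + 1) + 3 * k * B + k * (4 + 5 * B) ∧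
    (genWith R ρ g items ω).callsG G G' c ≤ k * d ∧
    (genWith R ρ g items ω).callsG' G G' c ≤ k := by
  obtain ⟨h1, h2, h3⟩ := genLayers_cost G G' c ρ g (items.map (fun e => e.1)) (by simpa using hitems)
    ω d le_rfl
  have hlast : ∀ rnd st,
      (genLast R (ρ ⟨d, Nat.lt_succ_self d⟩) (g d) items rnd st).ops G G' ≤ k * (4 + 5 * B) ∧
      (genLast R (ρ ⟨d, Nat.lt_succ_self d⟩) (g d) items rnd st).callsG G G' c ≤ 0 ∧
      (genLast R (ρ ⟨d, Nat.lt_succ_self d⟩) (g d) items rnd st).callsG' G G' c ≤ k := by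
    intro rnd st
    refine ⟨?_, ?_, ?_⟩
    · refine (ops_foldlM_le G G' _ items rnd (4 + 5 * B) (fun _ => True) trivial
        (fun _ _ _ _ => trivial) ?_).trans (Nat.mul_le_mul_right _ hitems)
      intro cw e _ _
      simp only [ops_bind, ops_expandBlock, ops_prim]
      rw [ops_forFin G G' B _ 5 (fun j => by simp)]
      omega
    · refine (callsG_foldlM_le G G' c _ items rnd 0 ?_).trans (by simp)
      intro cw e
      simp only [callsG_bind, callsG_expandBlock, callsG_prim]
      rw [callsG_forFin G G' c B _ (fun j => by simp)]
    · refine (callsG'_foldlM_le G G' c _ items rnd 1 ?_).trans (by simpa using hitems)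
      intro cw e
      simp only [callsG'_bind, callsG'_expandBlock, callsG'_prim]
      rw [callsG'_forFin G G' c B _ (fun j => by simp)]
      cases c <;> simp
  have hrnd : (forFin (3 * k) (fun a => forFin B (fun j => prim (ω.2.2.2 a j))) :
      P lam B Gr _).ops G G' = 3 * k * (B * 1) :=
    ops_forFin G G' _ _ _ (fun a => ops_forFin G G' _ _ _ (fun j => by simp))
  have hrnd1 : (forFin (3 * k) (fun a => forFin B (fun j => prim (ω.2.2.2 a j))) :
      P lam B Gr _).callsG G G' c = 0 :=
    callsG_forFin G G' c _ _ (fun a => callsG_forFin G G' c _ _ (fun j => by simp))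
  have hrnd2 : (forFin (3 * k) (fun a => forFin B (fun j => prim (ω.2.2.2 a j))) :
      P lam B Gr _).callsG' G G' c = 0 :=
    callsG'_forFin G G' c _ _ (fun a => callsG'_forFin G G' c _ _ (fun j => by simp))
  refine ⟨?_, ?_, ?_⟩
  · simp only [genWith, ops_bind, ops_prim, ops_ret, hrnd]
    refine (add_le_add h1 (add_le_add le_rfl (add_le_add (hlast _ _).1 le_rfl))).trans ?_
    rw [mul_one]; omega
  · simp only [genWith, callsG_bind, callsG_prim, callsG_ret, hrnd1]
    refine (add_le_add h2 (add_le_add le_rfl (add_le_add (hlast _ _).2.1 le_rfl))).trans ?_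
    omega
  · simp only [genWith, callsG'_bind, callsG'_prim, callsG'_ret, hrnd2, h3]
    refine (add_le_add le_rfl (add_le_add le_rfl (add_le_add (hlast _ _).2.2 le_rfl))).trans ?_
    omega

theorem gen_cost (R : GroupRep Gr) (ρ : Hash k d) (α : Fin k → Bits d) (β : Fin k → Fin B → Gr)
    (ω : Tape lam d k B Gr) (hk : 0 < k) :
    (gen R ρ α β ω).ops G G' ≤ 1000 * (k + d + B) ^ 5 ∧
    (gen R ρ α β ω).callsG G G' c ≤ k * d ∧
    (gen R ρ α β ω).callsG' G G' c ≤ k := by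
  have hw := fun g items hitems => genWith_cost G G' c R ρ g items hitems ω
  have ha := ops_assignments_le (Gr := Gr) (B := B) G G' ρ (List.ofFn α) (d + 1) le_rfl
  obtain ⟨ha1, ha2⟩ := callsG_assignments (Gr := Gr) (B := B) G G' c ρ (List.ofFn α) (d + 1) le_rfl
  rw [List.length_ofFn] at ha
  set N := k + d + B with hN
  have hbound : (d + 1) * (k * k + 7 * (k + 1) ^ 4) +
      (4 + d * (6 * (k * k) + 43 * k + 1) + 3 * k * B + k * (4 + 5 * B)) ≤ 1000 * N ^ 5 := by
    have e1 : 1 ≤ N := by omega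
    have e2 : k ≤ N := by omega
    have e3 : d ≤ N := by omega
    have e4 : B ≤ N := by omega
    have e5 : k + 1 ≤ 2 * N := by omega
    have e6 : d + 1 ≤ 2 * N := by omega
    have p1 : N ≤ N ^ 5 := Nat.le_self_pow (by norm_num) N
    have p2 : N ^ 2 ≤ N ^ 5 := Nat.pow_le_pow_right e1 (by norm_num)
    have p3 : N ^ 3 ≤ N ^ 5 := Nat.pow_le_pow_right e1 (by norm_num)
    calc _ ≤ (2 * N) * (N * N + 7 * (2 * N) ^ 4) +
        (4 + N * (6 * (N * N) + 43 * N + 1) + 3 * N * N + N * (4 + 5 * N)) := by gcongr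
      _ = 224 * N ^ 5 + 8 * N ^ 3 + 51 * N ^ 2 + 5 * N + 4 := by ring
      _ ≤ 1000 * N ^ 5 := by omega
  -- Both branches of `gen` run `genWith` with at most `k` items; after a failure there is just one.
  have hcase : ∀ r : Option ((i : ℕ) → Bits i → Bool), ∃ g items, items.length ≤ k ∧
      (match r with
        | some g => genWith R ρ g (List.ofFn (fun ℓ => (α ℓ, β ℓ))) ω
        | none => genWith R ρ (fun _ _ => false) [(fun _ => false, 0)] ω) = genWith R ρ g items ω := by
    intro r
    cases r with
    | none => exact ⟨_, _, by simp only [List.length_singleton]; omega, rfl⟩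
    | some g => exact ⟨g, _, by simp, rfl⟩
  obtain ⟨g, items, hitems, heq⟩ := hcase
    ((assignments ρ (List.ofFn α) (d + 1) le_rfl : P lam B Gr _).run G G')
  obtain ⟨b1, b2, b3⟩ := hw g items hitems
  refine ⟨?_, ?_, ?_⟩
  · rw [gen, ops_bind]
    refine le_trans (add_le_add ha ?_) hbound
    rw [← heq] at b1
    exact b1
  · rw [gen, callsG_bind, ha1, zero_add]
    rw [← heq] at b2
    exact b2
  · rw [gen, callsG'_bind, ha2, zero_add]
    rw [← heq] at b3
    exact b3

end GenCost

end DPF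

/-! ### Families of Boolean functions computed by circuits -/

namespace Circuit

variable {T : Type}

/-- `Der V t V'`: from wires carrying the functions in `V`, `t` further gates yield `V'`. -/
inductive Der : Set (T → Bool) → ℕ → Set (T → Bool) → Prop
  | refl (V : Set (T → Bool)) : Der V 0 V
  | const {V V' : Set (T → Bool)} {t : ℕ} (b : Bool) : Der (insert (fun _ => b) V) t V' →
      Der V (t + 1) V'
  | nand {V V' : Set (T → Bool)} {t : ℕ} {f g : T → Bool} (hf : f ∈ V) (hg : g ∈ V) :
      Der (insert (fun x => !(f x && g x)) V) t V' → Der V (t + 1) V'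

theorem Der.subset {V V' : Set (T → Bool)} {t : ℕ} (h : Der V t V') : V ⊆ V' := by
  induction h with
  | refl => exact subset_rfl
  | const b _ ih => exact (Set.subset_insert _ _).trans ih
  | nand _ _ _ ih => exact (Set.subset_insert _ _).trans ih

theorem Der.trans {V V' V'' : Set (T → Bool)} {t t' : ℕ} (h : Der V t V') (h' : Der V' t' V'') :
    Der V (t + t') V'' := by
  induction h with
  | refl => rwa [zero_add]
  | const b _ ih => rw [Nat.add_right_comm]; exact Der.const b (ih h')
  | nand hf hg _ ih => rw [Nat.add_right_comm]; exact Der.nand hf hg (ih h')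

/-- Additional wires do no harm. Hence computations that start from the same wires can be carried
out one after the other. -/
theorem Der.mono {V V' W : Set (T → Bool)} {t : ℕ} (h : Der V t V') (hW : V ⊆ W) :
    ∃ W', V' ⊆ W' ∧ Der W t W' := by
  induction h generalizing W with
  | refl => exact ⟨W, hW, Der.refl W⟩
  | const b _ ih =>
    obtain ⟨W', h1, h2⟩ := ih (Set.insert_subset_insert hW)
    exact ⟨W', h1, Der.const b h2⟩
  | nand hf hg _ ih =>
    obtain ⟨W', h1, h2⟩ := ih (Set.insert_subset_insert hW)
    exact ⟨W', h1, Der.nand (hW hf) (hW hg) h2⟩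

/-- The functions in `U` can be computed from those in `V` with at most `t` gates. -/
def Comp (V : Set (T → Bool)) (t : ℕ) (U : Set (T → Bool)) : Prop :=
  ∃ V' s, s ≤ t ∧ Der V s V' ∧ U ⊆ V'

theorem Comp.of_subset {V U : Set (T → Bool)} (h : U ⊆ V) (t : ℕ) : Comp V t U :=
  ⟨V, 0, Nat.zero_le t, Der.refl V, h⟩

theorem Comp.mono {V W U U' : Set (T → Bool)} {t t' : ℕ} (h : Comp V t U) (hV : V ⊆ W)
    (ht : t ≤ t') (hU : U' ⊆ U) : Comp W t' U' := by
  obtain ⟨V', s, hs, hd, hU''⟩ := h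
  obtain ⟨W', h1, h2⟩ := hd.mono hV
  exact ⟨W', s, hs.trans ht, h2, hU.trans (hU''.trans h1)⟩

/-- First compute `U`, then `U'`. -/
theorem Comp.seq {V U U' : Set (T → Bool)} {t t' : ℕ} (h : Comp V t U) (h' : Comp (V ∪ U) t' U') :
    Comp V (t + t') (U ∪ U') := by
  obtain ⟨V', s, hs, hd, hU⟩ := h
  obtain ⟨W, s', hs', hd', hU'⟩ := h'
  obtain ⟨W', h1, h2⟩ := hd'.mono (Set.union_subset hd.subset hU)
  exact ⟨W', s + s', by omega, hd.trans h2,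
    Set.union_subset (hU.trans h2.subset) (hU'.trans h1)⟩

theorem Comp.seq' {V U U' : Set (T → Bool)} {t t' : ℕ} (h : Comp V t U) (h' : Comp (V ∪ U) t' U') :
    Comp V (t + t') U' :=
  (h.seq h').mono subset_rfl le_rfl Set.subset_union_right

theorem Comp.union {V U U' : Set (T → Bool)} {t t' : ℕ} (h : Comp V t U) (h' : Comp V t' U') :
    Comp V (t + t') (U ∪ U') :=
  h.seq (h'.mono Set.subset_union_left le_rfl subset_rfl)

theorem Comp.list {ι : Type} {V : Set (T → Bool)} {t : ℕ} (L : List ι) (U : ι → Set (T → Bool))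
    (h : ∀ i ∈ L, Comp V t (U i)) : Comp V (L.length * t) {f | ∃ i ∈ L, f ∈ U i} := by
  induction L with
  | nil => exact Comp.of_subset (by rintro f ⟨i, hi, _⟩; simp at hi) _
  | cons a L ih =>
    refine ((h a (by simp)).union (ih (fun i hi => h i (by simp [hi])))).mono subset_rfl
      (by rw [List.length_cons, add_mul, one_mul, add_comm]) ?_
    rintro f ⟨i, hi, hf⟩
    rcases List.mem_cons.1 hi with rfl | hi
    · exact Or.inl hf
    · exact Or.inr ⟨i, hi, hf⟩

theorem Comp.iUnion {ι : Type} [Fintype ι] {V : Set (T → Bool)} {t : ℕ} (U : ι → Set (T → Bool))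
    (h : ∀ i, Comp V t (U i)) : Comp V (Fintype.card ι * t) (⋃ i, U i) := by
  have := Comp.list (Finset.univ : Finset ι).toList U (fun i _ => h i)
  rw [Finset.length_toList, Finset.card_univ] at this
  refine this.mono subset_rfl le_rfl ?_
  intro f hf
  obtain ⟨i, hi⟩ := Set.mem_iUnion.1 hf
  exact ⟨i, by simp, hi⟩

theorem Comp.nand {V : Set (T → Bool)} {f g : T → Bool} (hf : f ∈ V) (hg : g ∈ V) :
    Comp V 1 {fun x => !(f x && g x)} :=
  ⟨_, 1, le_rfl, Der.nand hf hg (Der.refl _), by simp⟩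

theorem Comp.const (V : Set (T → Bool)) (b : Bool) : Comp V 1 {fun _ => b} :=
  ⟨_, 1, le_rfl, Der.const b (Der.refl _), by simp⟩

theorem Comp.and {V : Set (T → Bool)} {f g : T → Bool} (hf : f ∈ V) (hg : g ∈ V) :
    Comp V 2 {fun x => f x && g x} := by
  refine ((Comp.nand hf hg).seq' (Comp.nand (Or.inr rfl) (Or.inr rfl))).mono subset_rfl le_rfl ?_
  rw [Set.singleton_subset_iff, Set.mem_singleton_iff]
  funext x; simp

/-- The four-gate formula `NAND(NAND(f, n), NAND(g, n))` with `n = NAND(f, g)`. -/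
theorem Comp.xor {V : Set (T → Bool)} {f g : T → Bool} (hf : f ∈ V) (hg : g ∈ V) :
    Comp V 4 {fun x => xor (f x) (g x)} := by
  have h1 := Comp.nand hf hg
  have h2 := h1.seq ((Comp.nand (Or.inl hf) (Or.inr rfl)).union (Comp.nand (Or.inl hg) (Or.inr rfl)))
  refine (h2.seq' (Comp.nand (Or.inr (Or.inr (Or.inl rfl)))
    (Or.inr (Or.inr (Or.inr rfl))))).mono subset_rfl le_rfl ?_
  rw [Set.singleton_subset_iff, Set.mem_singleton_iff]
  funext x; cases f x <;> cases g x <;> rfl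

theorem Comp.xorAnd {V : Set (T → Bool)} {f g h : T → Bool} (hf : f ∈ V) (hg : g ∈ V) (hh : h ∈ V) :
    Comp V 6 {fun x => Bool.xor (f x) (g x && h x)} :=
  (Comp.and hg hh).seq' (Comp.xor (Or.inl hf) (Or.inr rfl))

/-- The selection is `g xor (s and (f xor g))`. -/
theorem Comp.mux {V : Set (T → Bool)} {s f g : T → Bool} (hs : s ∈ V) (hf : f ∈ V) (hg : g ∈ V) :
    Comp V 10 {fun x => if s x then f x else g x} := by
  refine ((Comp.xor hf hg).seq' (Comp.xorAnd (Or.inl hg) (Or.inl hs) (Or.inr rfl))).mono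
    subset_rfl le_rfl ?_
  rw [Set.singleton_subset_iff, Set.mem_singleton_iff]
  funext x; cases s x <;> cases f x <;> cases g x <;> rfl

/-- The coordinates of a string-valued function. -/
def bitsOf {m : ℕ} (f : T → Bits m) : Set (T → Bool) := Set.range (fun i t => f t i)

theorem bitsOf_subset {m : ℕ} {f : T → Bits m} {V : Set (T → Bool)} :
    bitsOf f ⊆ V ↔ ∀ i, (fun t => f t i) ∈ V := by
  simp [bitsOf, Set.range_subset_iff]

theorem Comp.bits {m : ℕ} {V : Set (T → Bool)} {t : ℕ} (f : T → Bits m)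
    (h : ∀ i, Comp V t {fun x => f x i}) : Comp V (m * t) (bitsOf f) := by
  refine (Comp.iUnion _ h).mono subset_rfl (by rw [Fintype.card_fin]) ?_
  rw [bitsOf_subset]
  intro i
  exact Set.mem_iUnion.2 ⟨i, rfl⟩

/-- A circuit applied to available strings. -/
theorem Comp.circuit {m n : ℕ} (C : Circuit m n) {V : Set (T → Bool)} (f : T → Bits n)
    (hf : bitsOf f ⊆ V) : Comp V C.size (bitsOf (fun x => C.eval (f x))) := by
  induction C generalizing V with
  | out o =>
    refine Comp.of_subset ?_ _
    rw [bitsOf_subset] at hf ⊢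
    exact fun i => hf (o i)
  | const b C ih =>
    have h1 := (Comp.const V b).seq' (ih (fun x => Fin.snoc (α := fun _ => Bool) (f x) b) (by
      rw [bitsOf_subset] at hf ⊢
      intro i
      refine Fin.lastCases ?_ (fun i => ?_) i
      · right; simp
      · left; simpa using hf i))
    exact h1.mono subset_rfl (by simp only [size]; omega) subset_rfl
  | nand i j C ih =>
    rw [bitsOf_subset] at hf
    have h1 := (Comp.nand (hf i) (hf j)).seq'
      (ih (fun x => Fin.snoc (α := fun _ => Bool) (f x) (!(f x i && f x j))) (by
      rw [bitsOf_subset]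
      intro i
      refine Fin.lastCases ?_ (fun i => ?_) i
      · right; simp
      · left; simpa using hf i))
    exact h1.mono subset_rfl (by simp only [size]; omega) subset_rfl

/-- Each step of the derivation becomes a gate. That every available function is carried by some
wire remains true when the gate appends its output to the wires. -/
theorem Der.exists_circuit {V V' : Set (T → Bool)} {t : ℕ} (h : Der V t V') {m n : ℕ}
    (x : T → Bits n) (hx : V ⊆ bitsOf x) (o : T → Bits m) (ho : bitsOf o ⊆ V') :
    ∃ C : Circuit m n, C.size = t ∧ ∀ z, C.eval (x z) = o z := by
  induction h generalizing n with
  | refl V =>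
    rw [bitsOf_subset] at ho
    have : ∀ i, ∃ j, (fun z => x z j) = fun z => o z i := fun i => by
      obtain ⟨j, hj⟩ := hx (ho i); exact ⟨j, hj⟩
    choose q hq using this
    refine ⟨Circuit.out q, rfl, fun z => funext fun i => ?_⟩
    exact congrFun (hq i) z
  | const b _ ih =>
    obtain ⟨C, h1, h2⟩ := ih (fun z => Fin.snoc (α := fun _ => Bool) (x z) b) (by
      intro f hf
      rcases hf with rfl | hf
      · exact ⟨Fin.last n, by simp⟩
      · obtain ⟨j, rfl⟩ := hx hf
        exact ⟨j.castSucc, by simp⟩) ho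
    exact ⟨Circuit.const b C, by simp [size, h1], fun z => h2 z⟩
  | nand hf hg _ ih =>
    obtain ⟨i, rfl⟩ := hx hf
    obtain ⟨j, rfl⟩ := hx hg
    obtain ⟨C, h1, h2⟩ := ih
      (fun z => Fin.snoc (α := fun _ => Bool) (x z) (!(x z i && x z j))) (by
      intro f hf
      rcases hf with rfl | hf
      · exact ⟨Fin.last n, by simp⟩
      · obtain ⟨j, rfl⟩ := hx hf
        exact ⟨j.castSucc, by simp⟩) ho
    exact ⟨Circuit.nand i j C, by simp [size, h1], fun z => h2 z⟩

theorem Comp.exists_circuit {V : Set (T → Bool)} {t m n : ℕ} (x : T → Bits n) (o : T → Bits m)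
    (h : Comp V t (bitsOf o)) (hx : V ⊆ bitsOf x) :
    ∃ C : Circuit m n, C.size ≤ t ∧ ∀ z, C.eval (x z) = o z := by
  obtain ⟨V', s, hs, hd, hU⟩ := h
  obtain ⟨C, h1, h2⟩ := hd.exists_circuit x hx o hU
  exact ⟨C, h1.le.trans hs, h2⟩

/-- Both constant functions. -/
def consts (T : Type) : Set (T → Bool) := {fun _ => false, fun _ => true}

theorem const_mem {V : Set (T → Bool)} (hV : consts T ⊆ V) (b : Bool) : (fun _ : T => b) ∈ V := by
  cases b
  · exact hV (Or.inl rfl)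
  · exact hV (Or.inr rfl)

theorem Comp.consts (V : Set (T → Bool)) : Comp V 2 (consts T) :=
  (Comp.const V false).union (Comp.const V true)

end Circuit

namespace DPF

open Circuit

/-! ### Circuits for the upper layers of a key -/

section Circuits

variable {T : Type} {lam d k B : ℕ}

/-- The coordinates of a function whose values are correction words. -/
def cwBits (c : T → CWord lam) : Set (T → Bool) :=
  bitsOf (fun t => (c t).1) ∪ (⋃ j, {fun t => (c t).2.1 j, fun t => (c t).2.2 j})

theorem cwBits_subset {c : T → CWord lam} {V : Set (T → Bool)} :
    cwBits c ⊆ V ↔ bitsOf (fun t => (c t).1) ⊆ V ∧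
      ∀ j, (fun t => (c t).2.1 j) ∈ V ∧ (fun t => (c t).2.2 j) ∈ V := by
  simp [cwBits, Set.union_subset_iff, Set.iUnion_subset_iff, Set.pair_subset_iff]

/-- The coordinates of a function whose values are nodes. -/
def nodeBits (N : T → Node lam) : Set (T → Bool) :=
  bitsOf (fun t => (N t).seed) ∪ {fun t => (N t).u, fun t => (N t).q}

theorem nodeBits_subset {N : T → Node lam} {V : Set (T → Bool)} :
    nodeBits N ⊆ V ↔ bitsOf (fun t => (N t).seed) ⊆ V ∧ (fun t => (N t).u) ∈ V ∧
      (fun t => (N t).q) ∈ V := by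
  unfold nodeBits
  rw [Set.union_subset_iff, Set.pair_subset_iff]

/-- Each of the `lam + 2` bits takes two conditional XORs of six gates. -/
theorem comp_childNode {V : Set (T → Bool)} {w : T → Bits (2 * (lam + 2))} {N : T → Node lam}
    {c0 c1 : T → CWord lam} (hw : bitsOf w ⊆ V) (hN : nodeBits N ⊆ V) (h0 : cwBits c0 ⊆ V)
    (h1 : cwBits c1 ⊆ V) (j : Bool) :
    Comp V ((lam + 2) * 12) (nodeBits (fun t => childNode (w t) (N t) (c0 t) (c1 t) j)) := by
  rw [bitsOf_subset] at hw
  rw [nodeBits_subset, bitsOf_subset] at hN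
  rw [cwBits_subset, bitsOf_subset] at h0 h1
  have key : ∀ {f g0 g1 : T → Bool}, f ∈ V → g0 ∈ V → g1 ∈ V →
      Comp V 12 {fun t => xor (xor (f t) ((N t).u && g0 t)) ((N t).q && g1 t)} := by
    intro f g0 g1 hf hg0 hg1
    exact (Comp.xorAnd hf hN.2.1 hg0).seq' (Comp.xorAnd (Or.inr rfl) (Or.inl hN.2.2) (Or.inl hg1))
  have hs : Comp V (lam * 12) (bitsOf (fun t => (childNode (w t) (N t) (c0 t) (c1 t) j).seed)) :=
    Comp.bits _ (fun i => key (hw _) (h0.1 i) (h1.1 i))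
  have hu : Comp V 12 {fun t => (childNode (w t) (N t) (c0 t) (c1 t) j).u} :=
    key (hw _) (h0.2 j).1 (h1.2 j).1
  have hq : Comp V 12 {fun t => (childNode (w t) (N t) (c0 t) (c1 t) j).q} :=
    key (hw _) (h0.2 j).2 (h1.2 j).2
  refine (hs.union (hu.union hq)).mono subset_rfl (by omega) ?_
  rw [nodeBits_subset]
  exact ⟨Set.subset_union_left, Or.inr (Or.inl rfl), Or.inr (Or.inr rfl)⟩

/-- The flags `has` and the choices `gnext` are fixed, so the case distinction for the seed part
costs no gates. A seed bit takes one XOR and each of the four control bits takes two. -/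
theorem comp_word {V : Set (T → Bool)} (hV : consts T ⊆ V) {i : ℕ} (x : Bits i)
    {w : T → Bool → Bits (2 * (lam + 2))} (hw : ∀ b, bitsOf (fun t => w t b) ⊆ V)
    (has : Bool → Bool) (gnext : Bits (i + 1) → Bool) {rnd : T → Bits lam} (hr : bitsOf rnd ⊆ V) :
    Comp V (lam * 4 + 32) (cwBits (fun t => word x (w t) has gnext (rnd t))) := by
  have hw' : ∀ b p, (fun t => w t b p) ∈ V := fun b => bitsOf_subset.1 (hw b)
  have hseed : ∀ j, Comp V (lam * 4)
      (bitsOf (fun t s => xor (childSeed (w t false) j s) (childSeed (w t true) j s))) :=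
    fun j => Comp.bits _ (fun s => Comp.xor (hw' false _) (hw' true _))
  have hc : Comp V (lam * 4) (bitsOf (fun t => (word x (w t) has gnext (rnd t)).1)) := by
    simp only [word]
    split_ifs
    · exact Comp.of_subset hr _
    · exact hseed true
    · exact hseed false
  have hb : ∀ {f g : T → Bool} (b : Bool), f ∈ V → g ∈ V →
      Comp V 8 {fun t => xor (xor (f t) (g t)) b} := fun b hf hg =>
    (Comp.xor hf hg).seq' (Comp.xor (Or.inr rfl) (Or.inl (const_mem hV b)))
  have hm : ∀ j, Comp V 16 {(fun t => (word x (w t) has gnext (rnd t)).2.1 j),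
      (fun t => (word x (w t) has gnext (rnd t)).2.2 j)} := fun j =>
    (hb _ (hw' false _) (hw' true _)).union (hb _ (hw' false _) (hw' true _))
  refine (hc.union (Comp.iUnion _ hm)).mono subset_rfl (by simp) subset_rfl

variable (G : Bits lam → Bits (2 * (lam + 2)))

/-- The gates for one layer. -/
def layerCost (lam k : ℕ) : ℕ := k * (lam * 4 + 32) + k * (2 * ((lam + 2) * 12))

/-- The functions carried by the correction words of one layer and the nodes of the next one. -/
theorem comp_layer {V : Set (T → Bool)} (hV : consts T ⊆ V) {i : ℕ}
    (ρ : Bits i → Bool → Fin (3 * k)) (g : Bits i → Bool)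
    (gnext : Bits (i + 1) → Bool) (L : List (Bits i)) (L' : List (Bits (i + 1)))
    (hL : L.length ≤ k) (hL' : L'.length ≤ k) (hpar : ∀ y ∈ L', par y ∈ L)
    (hg : ∀ x ∈ L, ∀ y ∈ L, ρ x (g x) = ρ y (g y) → x = y)
    {rnd : T → Fin (3 * k) → CWord lam} (hrnd : ∀ a, cwBits (fun t => rnd t a) ⊆ V)
    {E : T → Bits i → Bool → Bits (2 * (lam + 2))}
    (hE : ∀ x ∈ L, ∀ b, bitsOf (fun t => E t x b) ⊆ V)
    {st : T → Bits i → Bool → Node lam} (hst : ∀ x ∈ L, ∀ b, nodeBits (fun t => st t x b) ⊆ V) :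
    ∃ U, Comp V (layerCost lam k) U ∧
      (∀ a, cwBits (fun t => layerCW ρ g gnext L L' (rnd t) (E t) a) ⊆ V ∪ U) ∧
      (∀ y ∈ L', ∀ b, nodeBits (fun t => layerSt ρ L' (layerCW ρ g gnext L L' (rnd t) (E t))
        (E t) (st t) y b) ⊆ V ∪ U) := by
  set cw := fun t => layerCW ρ g gnext L L' (rnd t) (E t) with hcw
  have hword := Comp.list (V := V) (t := lam * 4 + 32) L (fun x => cwBits (fun t =>
    word x (E t x) (fun j => decide (app x j ∈ L')) gnext (rnd t (ρ x (g x))).1)) (fun x hx =>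
      comp_word hV x (hE x hx) _ _ (cwBits_subset.1 (hrnd _)).1)
  set U1 := {f | ∃ x ∈ L, f ∈ cwBits (fun t =>
    word x (E t x) (fun j => decide (app x j ∈ L')) gnext (rnd t (ρ x (g x))).1)} with hU1
  have hcwU : ∀ a, cwBits (fun t => cw t a) ⊆ V ∪ U1 := by
    intro a
    -- The circuit performs no table lookups: `ρ` and `g` are fixed, so it is known in advance
    -- whether entry `a` is a computed word or an entry of `rnd`.
    by_cases ha : ∃ x ∈ L, ρ x (g x) = a
    · obtain ⟨x, hx, rfl⟩ := ha
      have : (fun t => cw t (ρ x (g x))) = fun t =>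
          word x (E t x) (fun j => decide (app x j ∈ L')) gnext (rnd t (ρ x (g x))).1 := by
        funext t
        exact foldl_update_key L (fun x => ρ x (g x)) _ _ hg hx
      rw [this]
      intro f hf
      exact Or.inr ⟨x, hx, hf⟩
    · push Not at ha
      have : (fun t => cw t a) = fun t => rnd t a := by
        funext t
        exact foldl_update_of_forall_ne L (fun x => ρ x (g x)) _ _ ha
      rw [this]
      exact (hrnd a).trans Set.subset_union_left
  have hnode := Comp.list (V := V ∪ U1) (t := 2 * ((lam + 2) * 12)) L' (fun y => ⋃ b, nodeBits
    (fun t => childNode (E t (par y) b) (st t (par y) b) (cw t (ρ (par y) false))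
      (cw t (ρ (par y) true)) (y (Fin.last i)))) (fun y hy => by
        have := Comp.iUnion (fun b => nodeBits
          (fun t => childNode (E t (par y) b) (st t (par y) b) (cw t (ρ (par y) false))
            (cw t (ρ (par y) true)) (y (Fin.last i)))) (fun b => comp_childNode
              ((hE _ (hpar y hy) b).trans Set.subset_union_left)
              ((hst _ (hpar y hy) b).trans Set.subset_union_left)
              (hcwU _) (hcwU _) (y (Fin.last i)))
        simpa using this)
  refine ⟨_, (hword.seq hnode).mono subset_rfl ?_ subset_rfl, ?_, ?_⟩
  · unfold layerCost; gcongr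
  · intro a
    exact (hcwU a).trans (Set.union_subset_union_right _ Set.subset_union_left)
  · intro y hy b f hf
    right; right
    refine ⟨y, hy, Set.mem_iUnion.2 ⟨b, ?_⟩⟩
    simpa only [layerSt, if_pos hy] using hf

/-- The functions carried by the results of the remaining layers. -/
theorem comp_runFrom (CG : Circuit (2 * (lam + 2)) lam) (hCG : ∀ s, CG.eval s = G s) (ρ : Hash k d)
    (g : (i : ℕ) → Bits i → Bool) (pts : List (Bits d)) (hpts : pts.length ≤ k)
    (hg : Good ρ g pts) (m n : ℕ) (h : n + m = d) {V : Set (T → Bool)} (hV : consts T ⊆ V)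
    {cw : T → Fin d → Fin (3 * k) → CWord lam} (hcw : ∀ i a, cwBits (fun t => cw t i a) ⊆ V)
    {st : T → Bits n → Bool → Node lam}
    (hst : ∀ x ∈ pfx pts n (by omega), ∀ b, nodeBits (fun t => st t x b) ⊆ V) :
    ∃ U, Comp V (m * (k * (2 * CG.size) + layerCost lam k)) U ∧
      (∀ i a, cwBits (fun t => (runFrom G ρ g pts m n h (cw t) (st t)).1 i a) ⊆ V ∪ U) ∧
      (∀ x ∈ pts, ∀ b, nodeBits (fun t => (runFrom G ρ g pts m n h (cw t) (st t)).2 x b) ⊆ V ∪ U) := by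
  induction m generalizing n V cw with
  | zero =>
    obtain rfl : n = d := h
    refine ⟨∅, Comp.of_subset (Set.empty_subset _) _, ?_, ?_⟩
    · intro i a; rw [Set.union_empty]; exact hcw i a
    · intro x hx b; rw [Set.union_empty]; exact hst x (mem_pfx_self.2 hx) b
  | succ m ih =>
    have hn : n < d := by omega
    have hlen : (pfx pts n hn.le).length ≤ k := (length_pfx_le _ _ _).trans hpts
    have hlen' : (pfx pts (n + 1) hn).length ≤ k := (length_pfx_le _ _ _).trans hpts
    have hE := Comp.list (V := V) (t := 2 * CG.size) (pfx pts n hn.le)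
      (fun x => ⋃ b, bitsOf (fun t => G (st t x b).seed)) (fun x hx => by
        have := Comp.iUnion (fun b => bitsOf (fun t => G (st t x b).seed)) (fun b => by
          simp only [← hCG]
          exact Comp.circuit CG (fun t => (st t x b).seed) (nodeBits_subset.1 (hst x hx b)).1)
        simpa using this)
    set U0 := {f | ∃ x ∈ pfx pts n hn.le, f ∈ ⋃ b, bitsOf (fun t => G (st t x b).seed)} with hU0
    obtain ⟨U1, hU1, h1, h2⟩ := comp_layer (V := V ∪ U0) (hV.trans Set.subset_union_left)
      (ρ ⟨n, by omega⟩) (g n) (g (n + 1)) (pfx pts n hn.le) (pfx pts (n + 1) hn) hlen hlen'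
      (fun y hy => par_mem_pfx hy) (hg n hn.le)
      (rnd := fun t => cw t ⟨n, hn⟩) (fun a => (hcw _ a).trans Set.subset_union_left)
      (E := fun t x b => G (st t x b).seed)
      (fun x hx b f hf => Or.inr ⟨x, hx, Set.mem_iUnion.2 ⟨b, hf⟩⟩)
      (st := st) (fun x hx b => (hst x hx b).trans Set.subset_union_left)
    obtain ⟨U2, hU2, h3, h4⟩ := ih (n + 1) (by omega) (V := V ∪ U0 ∪ U1)
      ((hV.trans Set.subset_union_left).trans Set.subset_union_left)
      (cw := fun t => Function.update (cw t) ⟨n, hn⟩ (layerCW (ρ ⟨n, by omega⟩) (g n) (g (n + 1))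
        (pfx pts n hn.le) (pfx pts (n + 1) hn) (cw t ⟨n, hn⟩) (fun x b => G (st t x b).seed)))
      (fun i a => by
        by_cases hi : i = ⟨n, hn⟩
        · subst hi
          simp only [Function.update_self]
          exact h1 a
        · simp only [Function.update_of_ne hi]
          exact ((hcw i a).trans Set.subset_union_left).trans Set.subset_union_left)
      (st := fun t => layerSt (ρ ⟨n, by omega⟩) (pfx pts (n + 1) hn)
        (layerCW (ρ ⟨n, by omega⟩) (g n) (g (n + 1))
        (pfx pts n hn.le) (pfx pts (n + 1) hn) (cw t ⟨n, hn⟩) (fun x b => G (st t x b).seed))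
        (fun x b => G (st t x b).seed) (st t)) h2
    refine ⟨U0 ∪ (U1 ∪ U2), (hE.seq (hU1.seq hU2)).mono subset_rfl ?_ subset_rfl, ?_, ?_⟩
    · have : (pfx pts n hn.le).length * (2 * CG.size) ≤ k * (2 * CG.size) := by gcongr
      rw [add_mul, one_mul]; omega
    · intro i a
      rw [← Set.union_assoc, ← Set.union_assoc]
      exact h3 i a
    · intro x hx b
      rw [← Set.union_assoc, ← Set.union_assoc]
      exact h4 x hx b

end Circuits

/-! ### Circuits for the last layer and the encoded key -/

section GroupCircuits

variable {T : Type} {lam d k B : ℕ} {Gr : Type} [AddCommGroup Gr] [Fintype Gr] (R : GroupRep Gr)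

/-- The coordinates of a function with values in the group. -/
def grBits (γ : T → Gr) : Set (T → Bool) := bitsOf (fun t => R.enc (γ t))

/-- Circuits for the group operations and for `convert`. -/
structure GroupCircuits where
  add : Circuit (glen Gr) (glen Gr + glen Gr)
  neg : Circuit (glen Gr) (glen Gr)
  conv : Circuit (glen Gr) (glen Gr)
  add_eval : ∀ a b, add.eval (Fin.append (R.enc a) (R.enc b)) = R.enc (a + b)
  neg_eval : ∀ a, neg.eval (R.enc a) = R.enc (-a)
  conv_eval : ∀ w, conv.eval w = R.enc (R.convert w)

variable {R} (Q : GroupCircuits R) {V : Set (T → Bool)}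

theorem comp_add {γ δ : T → Gr} (hγ : grBits R γ ⊆ V) (hδ : grBits R δ ⊆ V) :
    Comp V Q.add.size (grBits R (fun t => γ t + δ t)) := by
  unfold grBits at *
  simp only [← Q.add_eval]
  refine Comp.circuit Q.add (fun t => Fin.append (R.enc (γ t)) (R.enc (δ t))) ?_
  rw [bitsOf_subset] at *
  intro i
  refine Fin.addCases (fun i => ?_) (fun i => ?_) i
  · simp only [Fin.append_left]; exact hγ i
  · simp only [Fin.append_right]; exact hδ i

theorem comp_neg {γ : T → Gr} (hγ : grBits R γ ⊆ V) :
    Comp V Q.neg.size (grBits R (fun t => -γ t)) := by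
  unfold grBits at *
  simp only [← Q.neg_eval]
  exact Comp.circuit Q.neg (fun t => R.enc (γ t)) hγ

theorem comp_convert {w : T → Bits (glen Gr)} (hw : bitsOf w ⊆ V) :
    Comp V Q.conv.size (grBits R (fun t => R.convert (w t))) := by
  unfold grBits
  simp only [← Q.conv_eval]
  exact Comp.circuit Q.conv w hw

theorem grBits_const (hV : consts T ⊆ V) (a : Gr) : grBits R (fun _ : T => a) ⊆ V :=
  bitsOf_subset.2 (fun _ => const_mem hV _)

theorem comp_ite {s : T → Bool} {γ δ : T → Gr} (hs : s ∈ V) (hγ : grBits R γ ⊆ V)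
    (hδ : grBits R δ ⊆ V) : Comp V (glen Gr * 10) (grBits R (fun t => if s t then γ t else δ t)) := by
  unfold grBits at *
  rw [bitsOf_subset] at hγ hδ
  refine Comp.bits _ (fun i => ?_)
  have : (fun t => R.enc (if s t then γ t else δ t) i) =
      fun t => if s t then R.enc (γ t) i else R.enc (δ t) i := by
    funext t; split_ifs <;> rfl
  rw [this]
  exact Comp.mux hs (hγ i) (hδ i)

/-- The gates for one component of a correction word of the last layer. -/
def GroupCircuits.lastCost : ℕ := 2 * Q.add.size + 2 * Q.neg.size + glen Gr * 10

/-- A negation and two additions give `a - γ + δ`; a second negation and a selection provide the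
sign. -/
theorem comp_lastWord (hV : consts T ⊆ V) {s : T → Bool} (hs : s ∈ V) (a : Gr) {γ δ : T → Gr}
    (hγ : grBits R γ ⊆ V) (hδ : grBits R δ ⊆ V) :
    Comp V Q.lastCost (grBits R (fun t => if s t then -(a - γ t + δ t) else a - γ t + δ t)) := by
  have h1 := comp_neg Q hγ
  have h2 := h1.seq (comp_add Q (grBits_const (R := R) (hV.trans Set.subset_union_left) a)
    Set.subset_union_right)
  have h3 := h2.seq (comp_add Q (Set.subset_union_right.trans Set.subset_union_right)
    (hδ.trans Set.subset_union_left))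
  have h4 := h3.seq (comp_neg Q (Set.subset_union_right.trans Set.subset_union_right))
  have h5 := h4.seq' (comp_ite (R := R) (Or.inl hs) (Set.subset_union_right.trans Set.subset_union_right)
    ((Set.subset_union_right.trans Set.subset_union_left).trans Set.subset_union_right))
  refine h5.mono subset_rfl (by unfold GroupCircuits.lastCost; omega) ?_
  simp only [sub_eq_add_neg]
  exact subset_rfl

/-- The functions carried by the correction words of the last layer. -/
theorem comp_lastCW (hV : consts T ⊆ V) (ρ : Bits d → Bool → Fin (3 * k)) (g : Bits d → Bool)
    (items : List (Bits d × (Fin B → Gr))) (hitems : items.length ≤ k)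
    (hg : ∀ e ∈ items, ∀ f ∈ items, ρ e.1 (g e.1) = ρ f.1 (g f.1) → e = f)
    (rnd : Fin (3 * k) → Fin B → Gr)
    {sign : T → Bits d → Bool} (hsign : ∀ e ∈ items, (fun t => sign t e.1) ∈ V)
    {val : T → Bits d → Bool → Fin B → Gr}
    (hval : ∀ e ∈ items, ∀ b j, grBits R (fun t => val t e.1 b j) ⊆ V) :
    ∃ U, Comp V (k * (B * Q.lastCost)) U ∧ ∀ a j,
      grBits R (fun t => lastCW ρ g items rnd (sign t) (val t) a j) ⊆ V ∪ U := by
  have hw := Comp.list (V := V) (t := B * Q.lastCost) items (fun e => ⋃ j, grBits R (fun t =>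
    if sign t e.1 then -(e.2 j - val t e.1 false j + val t e.1 true j)
    else e.2 j - val t e.1 false j + val t e.1 true j)) (fun e he => by
      have := Comp.iUnion (fun j => grBits R (fun t =>
        if sign t e.1 then -(e.2 j - val t e.1 false j + val t e.1 true j)
        else e.2 j - val t e.1 false j + val t e.1 true j)) (fun j =>
          comp_lastWord Q hV (hsign e he) (e.2 j) (hval e he false j) (hval e he true j))
      simpa using this)
  refine ⟨_, hw.mono subset_rfl (Nat.mul_le_mul_right _ hitems) subset_rfl, ?_⟩
  intro a j
  by_cases ha : ∃ e ∈ items, ρ e.1 (g e.1) = a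
  · obtain ⟨e, he, rfl⟩ := ha
    intro f hf
    refine Or.inr ⟨e, he, Set.mem_iUnion.2 ⟨j, ?_⟩⟩
    have : (fun t => lastCW ρ g items rnd (sign t) (val t) (ρ e.1 (g e.1)) j) = fun t =>
        if sign t e.1 then -(e.2 j - val t e.1 false j + val t e.1 true j)
        else e.2 j - val t e.1 false j + val t e.1 true j := by
      funext t
      exact congrFun (foldl_update_key items (fun e => ρ e.1 (g e.1)) (fun e (j : Fin B) =>
        if sign t e.1 then -(e.2 j - val t e.1 false j + val t e.1 true j)
        else e.2 j - val t e.1 false j + val t e.1 true j) rnd hg he) j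
    rw [this] at hf
    exact hf
  · push Not at ha
    have : (fun t => lastCW ρ g items rnd (sign t) (val t) a j) = fun _ => rnd a j := by
      funext t
      exact congrFun (foldl_update_of_forall_ne items (fun e => ρ e.1 (g e.1)) (fun e (j : Fin B) =>
        if sign t e.1 then -(e.2 j - val t e.1 false j + val t e.1 true j)
        else e.2 j - val t e.1 false j + val t e.1 true j) rnd ha) j
    rw [this]
    exact (grBits_const hV _).trans Set.subset_union_left

theorem comp_blockOf {w : T → Bits (B * glen Gr)} (hw : bitsOf w ⊆ V) :
    Comp V (B * Q.conv.size) (⋃ j, grBits R (fun t => blockOf R (w t) j)) := by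
  rw [bitsOf_subset] at hw
  have := Comp.iUnion (fun j => grBits R (fun t => blockOf R (w t) j)) (fun j =>
    comp_convert (R := R) (V := V) Q (w := fun t => chunk (w t) j)
      (bitsOf_subset.2 (fun i => hw _)))
  simpa using this

/-- The coordinates of an encoded key with a further bit. -/
theorem view_subset (hV : consts T ⊆ V) {κ : T → Key lam d k B Gr}
    (h1 : bitsOf (fun t => (κ t).1) ⊆ V) (h2 : ∀ i a, cwBits (fun t => (κ t).2.1 i a) ⊆ V)
    (h3 : ∀ a j, grBits R (fun t => (κ t).2.2 a j) ⊆ V) (sel : Bool) :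
    bitsOf (fun t => (Fin.snoc (α := fun _ => Bool) (encodeKey R (κ t)) sel :
      Bits (lam + cwLen lam d k B Gr + 1))) ⊆ V := by
  rw [bitsOf_subset]
  intro i
  refine Fin.lastCases ?_ (fun i => ?_) i
  · simpa using const_mem hV sel
  simp only [Fin.snoc_castSucc, encodeKey]
  refine Fin.addCases (fun i => ?_) (fun i => ?_) i
  · simpa using bitsOf_subset.1 h1 i
  simp only [Fin.append_right]
  refine Fin.addCases (fun i => ?_) (fun i => ?_) i
  · simp only [Fin.append_left, flatten]
    generalize (finProdFinEquiv.symm i).1 = p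
    generalize finProdFinEquiv.symm (finProdFinEquiv.symm i).2 = q
    obtain ⟨hc, hm⟩ := cwBits_subset.1 (h2 p q.1)
    obtain ⟨a, r⟩ := q
    simp only [encodeCW]
    refine Fin.addCases (fun r => ?_) (fun r => ?_) r
    · simpa using bitsOf_subset.1 hc r
    · simp only [Fin.append_right]
      fin_cases r
      · exact (hm false).1
      · exact (hm false).2
      · exact (hm true).1
      · exact (hm true).2
  · simp only [Fin.append_right, flatten]
    exact bitsOf_subset.1 (h3 _ _) _

end GroupCircuits

end DPF

/-! ### Distinguishing advantages -/

section Advantage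

variable {Ω Ω' : Type} [Fintype Ω'] [Fintype Ω]

/-- The probability that the circuit `A` accepts a sample of `X`. -/
noncomputable def accept {n : ℕ} (X : Ω → Bits n) (A : Circuit 1 n) : ℝ :=
  avg (fun ω => ind (A.eval (X ω) 0 = true))

/-- Circuits of size at most `s` distinguish `X` and `Y` with advantage at most `ε`. -/
def AdvLe {n : ℕ} (X : Ω → Bits n) (Y : Ω' → Bits n) (s : ℕ) (ε : ℝ) : Prop :=
  ∀ A : Circuit 1 n, A.size ≤ s → |accept X A - accept Y A| ≤ ε

/-- Replacing independent samples of `X` by samples of `Y`, one at a time. -/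
theorem abs_avg_sub_avg_le {ι T : Type} [Fintype ι] [DecidableEq ι] [Nonempty Ω] [Nonempty Ω'] {n s : ℕ}
    {ε : ℝ} (hε : 0 ≤ ε) (enc : T → Bits n) (X : Ω → T) (Y : Ω' → T)
    (hXY : AdvLe (fun ω => enc (X ω)) (fun ω => enc (Y ω)) s ε) (F : (ι → T) → Bool) (L : List ι)
    (hL : ∀ z z' : ι → T, (∀ x ∈ L, z x = z' x) → F z = F z')
    (hF : ∀ x ∈ L, ∀ z : ι → T, ∃ A : Circuit 1 n, A.size ≤ s ∧
      ∀ w, A.eval (enc w) 0 = F (Function.update z x w)) :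
    |avg (fun ω : ι → Ω => ind (F (fun i => X (ω i)) = true)) -
      avg (fun ω : ι → Ω' => ind (F (fun i => Y (ω i)) = true))| ≤ L.length * ε := by
  -- `mix M` uses samples of `Y` on `M` and samples of `X` elsewhere. Only the coordinates in `L`
  -- are exchanged one by one. In the main applications the index type consists of all nodes of a
  -- depth, exponentially many, whereas `F` depends on at most `k` of them.
  let mix : List ι → (ι → Ω) → (ι → Ω') → ι → T := fun M ω ω' i => if i ∈ M then Y (ω' i) else X (ω i)
  let H : List ι → ℝ := fun M => avg (fun ω => avg (fun ω' => ind (F (mix M ω ω') = true)))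
  have step : ∀ x ∈ L, ∀ M, |H M - H (x :: M)| ≤ ε := by
    intro x hx M
    by_cases hxM : x ∈ M
    · have : H (x :: M) = H M := by
        have hm : ∀ ω ω', mix (x :: M) ω ω' = mix M ω ω' := by
          intro ω ω'; funext i
          by_cases hi : i = x
          · subst hi; simp [mix, hxM]
          · simp [mix, hi]
        simp only [H, hm]
      rw [this, sub_self, abs_zero]; exact hε
    -- The coordinate `x` is resampled separately. With all others fixed, `hF` turns `F` into a
    -- circuit whose input is one sample of `X` or `Y`.
    · have h1 : H M = avg (fun ω => avg (fun ω' => avg (fun v =>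
          ind (F (Function.update (mix M ω ω') x (X v)) = true)))) := by
        simp only [H]
        rw [avg_update x]
        refine congrArg avg (funext fun ω => ?_)
        rw [avg_comm]
        refine congrArg avg (funext fun ω' => congrArg avg (funext fun v => ?_))
        have : mix M (Function.update ω x v) ω' = Function.update (mix M ω ω') x (X v) := by
          funext i
          by_cases hi : i = x
          · subst hi; simp [mix, hxM]
          · simp [mix, hi]
        rw [this]
      have h2 : H (x :: M) = avg (fun ω => avg (fun ω' => avg (fun v =>
          ind (F (Function.update (mix M ω ω') x (Y v)) = true)))) := by
        simp only [H]
        refine congrArg avg (funext fun ω => ?_)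
        rw [avg_update x]
        refine congrArg avg (funext fun ω' => congrArg avg (funext fun v => ?_))
        have : mix (x :: M) ω (Function.update ω' x v) = Function.update (mix M ω ω') x (Y v) := by
          funext i
          by_cases hi : i = x
          · subst hi; simp [mix]
          · simp [mix, hi]
        rw [this]
      rw [h1, h2, ← avg_sub]
      refine avg_abs_le (fun ω => ?_)
      rw [← avg_sub]
      refine avg_abs_le (fun ω' => ?_)
      obtain ⟨A, hA, hA'⟩ := hF x hx (mix M ω ω')
      have := hXY A hA
      simp only [accept, hA'] at this
      exact this
  have all : ∀ M : List ι, M ⊆ L → |H [] - H M| ≤ M.length * ε := by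
    intro M
    induction M with
    | nil => intro _; simp
    | cons x M ih =>
      intro hM
      rw [List.cons_subset] at hM
      have h1 := ih hM.2
      have h2 := step x hM.1 M
      have h3 := abs_sub_le (H []) (H M) (H (x :: M))
      rw [List.length_cons, Nat.cast_succ, add_mul, one_mul]
      linarith
  have h0 : H [] = avg (fun ω : ι → Ω => ind (F (fun i => X (ω i)) = true)) := by
    simp only [H, mix, List.not_mem_nil, if_false]
    exact congrArg avg (funext fun ω => avg_const _)
  have hLL : H L = avg (fun ω : ι → Ω' => ind (F (fun i => Y (ω i)) = true)) := by
    have : ∀ ω ω', F (mix L ω ω') = F (fun i => Y (ω' i)) := by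
      intro ω ω'
      refine hL _ _ (fun x hx => ?_)
      simp [mix, hx]
    simp only [H, this]
    exact avg_const _
  rw [← h0, ← hLL]
  exact all L (List.Subset.refl L)

end Advantage

/-! ### Polynomial bounds and negligible functions -/

section Asymptotics

theorem PolyBounded.mono {f g : ℕ → ℕ} (hg : PolyBounded g) (h : ∀ l, f l ≤ g l) : PolyBounded f := by
  obtain ⟨p, hp⟩ := hg
  exact ⟨p, fun l => (h l).trans (hp l)⟩

theorem PolyBounded.const (c : ℕ) : PolyBounded (fun _ => c) :=
  ⟨Polynomial.C c, fun l => by simp⟩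

theorem PolyBounded.id : PolyBounded (fun l => l) :=
  ⟨Polynomial.X, fun l => by simp⟩

theorem PolyBounded.add {f g : ℕ → ℕ} (hf : PolyBounded f) (hg : PolyBounded g) :
    PolyBounded (fun l => f l + g l) := by
  obtain ⟨p, hp⟩ := hf
  obtain ⟨q, hq⟩ := hg
  exact ⟨p + q, fun l => by rw [Polynomial.eval_add]; exact add_le_add (hp l) (hq l)⟩

theorem PolyBounded.mul {f g : ℕ → ℕ} (hf : PolyBounded f) (hg : PolyBounded g) :
    PolyBounded (fun l => f l * g l) := by
  obtain ⟨p, hp⟩ := hf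
  obtain ⟨q, hq⟩ := hg
  exact ⟨p * q, fun l => by rw [Polynomial.eval_mul]; exact Nat.mul_le_mul (hp l) (hq l)⟩

theorem Negligible.mono {f g : ℕ → ℝ} (hg : Negligible g) (h : ∀ l, |f l| ≤ |g l|) : Negligible f :=
  Asymptotics.SuperpolynomialDecay.trans_abs_le hg h

theorem Negligible.polyBounded_mul {c : ℕ → ℕ} {f : ℕ → ℝ} (hc : PolyBounded c) (hf : Negligible f) :
    Negligible (fun l => c l * f l) := by
  obtain ⟨p, hp⟩ := hc
  have h := Asymptotics.SuperpolynomialDecay.polynomial_mul hf (p.map (Nat.castRingHom ℝ))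
  refine Negligible.mono h (fun l => ?_)
  have : (p.map (Nat.castRingHom ℝ)).eval (l : ℝ) = ((p.eval l : ℕ) : ℝ) := by
    simp
  simp only [this, abs_mul, Nat.abs_cast]
  gcongr
  exact hp l

/-- Indistinguishable ensembles have a negligible bound for the advantage of all circuits of a given
polynomial size. -/
theorem CompIndist.exists_advLe {n : ℕ → ℕ} {Ω Ω' : ℕ → Type} [∀ l, Fintype (Ω l)]
    [∀ l, Fintype (Ω' l)] {X : ∀ l, Ω l → Bits (n l)} {Y : ∀ l, Ω' l → Bits (n l)}
    (h : CompIndist X Y) {s : ℕ → ℕ} (hs : PolyBounded s) :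
    ∃ ε : ℕ → ℝ, Negligible ε ∧ ∀ l, 0 ≤ ε l ∧ AdvLe (X l) (Y l) (s l) (ε l) := by
  have hmax : ∀ l, ∃ A : Circuit 1 (n l), A.size ≤ s l + 1 ∧ ∀ A' : Circuit 1 (n l), A'.size ≤ s l →
      |accept (X l) A' - accept (Y l) A'| ≤ |accept (X l) A - accept (Y l) A| := by
    intro l
    -- There are finitely many functions on `n l` bits, so the largest advantage is attained. The
    -- bound is `s l + 1` because the constant circuit, of size 1, witnesses that `Z` is not empty;
    -- without input wires no circuit of size 0 exists.
    let Z : Set (Bits (n l) → Bits 1) := {f | ∃ A : Circuit 1 (n l), A.size ≤ s l + 1 ∧ A.eval = f}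
    have hZ : Z.Nonempty := ⟨_, Circuit.const false (Circuit.out (fun _ => Fin.last _)),
      by simp [Circuit.size], rfl⟩
    obtain ⟨f, ⟨A, hA, rfl⟩, hf⟩ := Set.exists_max_image Z (fun f =>
      |avg (fun ω => ind (f (X l ω) 0 = true)) - avg (fun ω => ind (f (Y l ω) 0 = true))|)
      Z.toFinite hZ
    exact ⟨A, hA, fun A' hA' => hf A'.eval ⟨A', by omega, rfl⟩⟩
  choose A hA hA' using hmax
  refine ⟨fun l => |accept (X l) (A l) - accept (Y l) (A l)|, ?_, fun l => ⟨abs_nonneg _, hA' l⟩⟩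
  have := h A ((hs.add (PolyBounded.const 1)).mono hA)
  simp only [prob_eq_avg] at this
  exact this

end Asymptotics

namespace DPF

/-! ### Replacing the randomness of one layer -/

section Parts

variable {lam : ℕ}

/-- An expanded seed consists of a seed and two bits for each child. -/
def partsEquiv (lam : ℕ) :
    Bits (2 * (lam + 2)) ≃ (Bool → Bits lam) × (Bool → Bool) × (Bool → Bool) where
  toFun w := (childSeed w, childU w, childQ w)
  invFun p := fun t =>
    let j := finTwoEquiv (finProdFinEquiv.symm t).1
    (Fin.append (p.1 j) ![p.2.1 j, p.2.2 j] : Bits (lam + 2)) (finProdFinEquiv.symm t).2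
  left_inv w := by
    funext t
    obtain ⟨⟨a, s⟩, rfl⟩ := finProdFinEquiv.surjective t
    simp only [Equiv.symm_apply_apply]
    refine Fin.addCases (fun s => ?_) (fun s => ?_) s
    · simp [childSeed, halfPos]
    · simp only [Fin.append_right]
      fin_cases s
      · simp [childU, halfPos]
      · simp [childQ, halfPos]
  right_inv p := by
    refine Prod.ext ?_ (Prod.ext ?_ ?_)
    · funext j t
      simp [childSeed, halfPos]
    · funext j
      simp only [childU, halfPos, Equiv.symm_apply_apply, Fin.append_right, Equiv.apply_symm_apply]
      rfl
    · funext j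
      simp only [childQ, halfPos, Equiv.symm_apply_apply, Fin.append_right, Equiv.apply_symm_apply]
      rfl

theorem childSeed_symm (p : (Bool → Bits lam) × (Bool → Bool) × (Bool → Bool)) (j : Bool) :
    childSeed ((partsEquiv lam).symm p) j = p.1 j :=
  congrFun (congrArg Prod.fst ((partsEquiv lam).apply_symm_apply p)) j

/-- The seeds of all children of uniformly random expansions are uniformly random. -/
theorem avg_childSeed {n : ℕ} (f : (Bits (n + 1) → Bits lam) → ℝ) :
    avg (fun W : Bits n → Bits (2 * (lam + 2)) => f (fun y => childSeed (W (par y)) (y (Fin.last n)))) =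
      avg f := by
  let e1 : (Bits n → Bits (2 * (lam + 2))) ≃
      (Bits n → Bool → Bits lam) × (Bits n → (Bool → Bool) × (Bool → Bool)) :=
    (Equiv.arrowCongr (Equiv.refl _) (partsEquiv lam)).trans (Equiv.arrowProdEquivProdArrow _ _ _)
  let e2 : (Bits n → Bool → Bits lam) ≃ (Bits (n + 1) → Bits lam) :=
    { toFun := fun s y => s (par y) (y (Fin.last n))
      invFun := fun s x j => s (app x j)
      left_inv := fun s => by funext x j; simp only [par_app, app_last]
      right_inv := fun s => by funext y; simp only [app_par] }
  have h1 := avg_equiv e2 f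
  have h2 := avg_fst (Ω' := Bits n → (Bool → Bool) × (Bool → Bool)) (fun s => f (e2 s))
  have h3 := avg_equiv e1 (fun z => f (e2 z.1))
  exact h3.trans (h2.trans h1)

end Parts

section Swap

variable {lam k i : ℕ} (b : Bool) (ρ : Bits i → Bool → Fin (3 * k)) (g : Bits i → Bool)
  (gnext : Bits (i + 1) → Bool) (L : List (Bits i)) (L' : List (Bits (i + 1)))

/-- The data of both servers from those of server `b` and of the other one. -/
def pair {X : Type} (b : Bool) (v w : X) (c : Bool) : X := if c = b then v else w

/-- The node of the other server on the path to a point: its seed is unrelated to the node `N`, and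
its control bits differ from those of `N` in the selected one. -/
def partner (N : Node lam) (gx : Bool) (s : Bits lam) : Node lam := ⟨s, xor N.u (!gx), xor N.q gx⟩

/-- The nodes of both servers on the paths. -/
def pairSt {n : ℕ} (b : Bool) (g : Bits n → Bool) (L : List (Bits n)) (N : Bits n → Node lam)
    (S : Bits n → Bits lam) (x : Bits n) : Bool → Node lam :=
  if x ∈ L then pair b (N x) (partner (N x) (g x) (S x)) else fun _ => zeroNode

variable {ρ g L} in
theorem layerCW_of_mem (hg : ∀ x ∈ L, ∀ y ∈ L, ρ x (g x) = ρ y (g y) → x = y)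
    (rnd : Fin (3 * k) → CWord lam) (E : Bits i → Bool → Bits (2 * (lam + 2))) {x : Bits i} (hx : x ∈ L) :
    layerCW ρ g gnext L L' rnd E (ρ x (g x)) =
      word x (E x) (fun j => decide (app x j ∈ L')) gnext (rnd (ρ x (g x))).1 :=
  foldl_update_key L (fun x => ρ x (g x)) _ _ hg hx

variable {ρ g L} in
theorem layerCW_of_forall_ne (rnd : Fin (3 * k) → CWord lam)
    (E : Bits i → Bool → Bits (2 * (lam + 2))) {a : Fin (3 * k)} (ha : ∀ x ∈ L, ρ x (g x) ≠ a) :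
    layerCW ρ g gnext L L' rnd E a = rnd a :=
  foldl_update_of_forall_ne L (fun x => ρ x (g x)) _ _ ha

variable (V : Bits i → Bits (2 * (lam + 2))) (N : Bits i → Node lam)

/-- Exchange of the randomness of a layer: from random correction words and random expansions of the
other server to the actual correction words and the seeds of the other server at the children; the seed
of a child off the paths and the bits of the expansions take up the correction words
that are not used. -/
def swap (z : (Fin (3 * k) → CWord lam) × (Bits i → Bits (2 * (lam + 2)))) :
    (Fin (3 * k) → CWord lam) × (Bits i → Bits (2 * (lam + 2))) :=
  let c := layerCW ρ g gnext L L' z.1 (fun x => pair b (V x) (z.2 x))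
  (c, fun x => if x ∈ L then (partsEquiv lam).symm
    (fun j => if app x j ∈ L' then
      (childNode (z.2 x) (partner (N x) (g x) (fun _ => false)) (c (ρ x false)) (c (ρ x true)) j).seed
      else (z.1 (ρ x (g x))).1, (z.1 (ρ x (g x))).2) else z.2 x)

/-- The XOR with the fixed expansion `v` can be undone. The word thus determines the listed parts of
the other expansion and of the random seed; `swap` has to keep the remaining parts elsewhere. -/
theorem word_pair_eq {x : Bits i} {v w w' : Bits (2 * (lam + 2))} {has : Bool → Bool} {r r' : Bits lam}
    (h : word x (pair b v w) has gnext r = word x (pair b v w') has gnext r') :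
    (∀ j, childU w j = childU w' j) ∧ (∀ j, childQ w j = childQ w' j) ∧
    (has false = true → has true = true → r = r') ∧
    (∀ j, has j = false → has (!j) = true → childSeed w j = childSeed w' j) := by
  refine ⟨fun j => ?_, fun j => ?_, fun h0 h1 => ?_, fun j h0 h1 => ?_⟩
  · have := congrFun (congrArg (fun c => c.2.1) h) j
    cases b <;> simpa [word, pair] using this
  · have := congrFun (congrArg (fun c => c.2.2) h) j
    cases b <;> simpa [word, pair] using this
  · have := congrArg (fun c => c.1) h
    simpa [word, h0, h1] using this
  · funext t
    have := congrFun (congrArg (fun c => c.1) h) t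
    cases j <;> simp only [Bool.not_false, Bool.not_true] at h1 <;>
      cases b <;> simpa [word, pair, h0, h1] using this

/-- The correction words determine the control bits of the expansions and either the seed of the
child off the paths or, if both children are on paths, the random seed. The second component
supplies the rest: the seeds of the children on paths up to a known correction, and the unused parts
of the random words. So the exchange preserves the uniform distribution. -/
theorem swap_injective (hg : ∀ x ∈ L, ∀ y ∈ L, ρ x (g x) = ρ y (g y) → x = y)
    (hL : ∀ x ∈ L, ∃ j, app x j ∈ L') :
    Function.Injective (swap b ρ g gnext L L' V N) := by
  rintro ⟨r, W⟩ ⟨r', W'⟩ h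
  have hc : layerCW ρ g gnext L L' r (fun x => pair b (V x) (W x)) =
    layerCW ρ g gnext L L' r' (fun x => pair b (V x) (W' x)) := congrArg Prod.fst h
  have hZ := fun x => congrFun (congrArg Prod.snd h) x
  simp only [swap, ← hc] at hZ
  have hmem : ∀ x ∈ L, W x = W' x ∧ r (ρ x (g x)) = r' (ρ x (g x)) := by
    intro x hx
    have hw := congrFun hc (ρ x (g x))
    rw [layerCW_of_mem gnext L' hg _ _ hx, layerCW_of_mem gnext L' hg _ _ hx] at hw
    obtain ⟨hU, hQ, hr, hs⟩ := word_pair_eq b gnext hw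
    have hx' := hZ x
    simp only [if_pos hx, EmbeddingLike.apply_eq_iff_eq, Prod.mk.injEq] at hx'
    obtain ⟨h1, h2⟩ := hx'
    have hseed : ∀ j, childSeed (W x) j = childSeed (W' x) j := by
      intro j
      by_cases hj : app x j ∈ L'
      · have := congrFun h1 j
        simp only [if_pos hj, childNode] at this
        funext t
        simpa using congrFun this t
      · refine hs j (by simp [hj]) ?_
        obtain ⟨j', hj'⟩ := hL x hx
        have : j' = !j := by
          cases j <;> cases j' <;> simp_all
        simp [← this, hj']
    refine ⟨?_, Prod.ext ?_ h2⟩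
    · exact (partsEquiv lam).injective (Prod.ext (funext hseed) (Prod.ext (funext hU) (funext hQ)))
    · by_cases hj : ∃ j, app x j ∉ L'
      · obtain ⟨j, hj⟩ := hj
        have := congrFun h1 j
        simpa only [if_neg hj] using this
      · push Not at hj
        exact hr (by simp [hj]) (by simp [hj])
  refine Prod.ext (funext fun a => ?_) (funext fun x => ?_)
  · by_cases ha : ∃ x ∈ L, ρ x (g x) = a
    · obtain ⟨x, hx, rfl⟩ := ha
      exact (hmem x hx).2
    · push Not at ha
      have := congrFun hc a
      rwa [layerCW_of_forall_ne gnext L' _ _ ha, layerCW_of_forall_ne gnext L' _ _ ha] at this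
  · by_cases hx : x ∈ L
    · exact (hmem x hx).1
    · have := hZ x
      simpa only [if_neg hx] using this

/-- The seed of the other server is the one stored by `swap`, and by `xor_children` its control bits
again differ from those of server `b` exactly in the bit selected by `gnext`. The form `pairSt`
therefore passes from layer to layer. -/
theorem layerSt_pairSt (hg : ∀ x ∈ L, ∀ y ∈ L, ρ x (g x) = ρ y (g y) → x = y)
    (hpar : ∀ y ∈ L', par y ∈ L) (S : Bits i → Bits lam)
    (z : (Fin (3 * k) → CWord lam) × (Bits i → Bits (2 * (lam + 2)))) :
    let c := layerCW ρ g gnext L L' z.1 (fun x => pair b (V x) (z.2 x))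
    layerSt ρ L' c (fun x => pair b (V x) (z.2 x)) (pairSt b g L N S) =
      pairSt b gnext L' (fun y => childNode (V (par y)) (N (par y)) (c (ρ (par y) false))
          (c (ρ (par y) true)) (y (Fin.last i)))
        (fun y => childSeed ((swap b ρ g gnext L L' V N z).2 (par y)) (y (Fin.last i))) := by
  intro c
  funext y e
  by_cases hy : y ∈ L'
  swap
  · simp only [layerSt, pairSt, if_neg hy]
  have hx := hpar y hy
  simp only [layerSt, pairSt, if_pos hy, if_pos hx]
  obtain ⟨r, W⟩ := z
  have hc : c (ρ (par y) (g (par y))) = _ := layerCW_of_mem gnext L' hg r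
    (fun x => pair b (V x) (W x)) hx
  have hseed : childSeed ((swap b ρ g gnext L L' V N (r, W)).2 (par y)) (y (Fin.last i)) =
      (childNode (W (par y)) (partner (N (par y)) (g (par y)) (fun _ => false)) (c (ρ (par y) false))
        (c (ρ (par y) true)) (y (Fin.last i))).seed := by
    simp only [swap, if_pos hx, childSeed_symm]
    rw [if_pos (by rw [app_par]; exact hy)]
  rw [hseed]
  have hrel := xor_children (par y) (pair b (V (par y)) (W (par y)))
    (pair b (N (par y)) (partner (N (par y)) (g (par y)) (S (par y)))) (fun a => c (ρ (par y) a)) _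
    (g (par y)) gnext _ (by cases b <;> simp [pair, partner]) (by cases b <;> simp [pair, partner])
    hc (y (Fin.last i))
  obtain ⟨-, hu, hq⟩ := hrel
  rw [app_par] at hu hq
  simp only [hy, decide_true, Bool.true_and] at hu hq
  by_cases he : e = b
  · simp only [pair, if_pos he]
  · simp only [pair, if_neg he]
    have hN : ∀ a b : Node lam, a.seed = b.seed → a.u = b.u → a.q = b.q → a = b := by
      rintro ⟨_, _, _⟩ ⟨_, _, _⟩ rfl rfl rfl; rfl
    refine hN _ _ rfl ?_ ?_
    · cases b
      · simp only [pair, if_true, Bool.true_eq_false, if_false] at hu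
        exact hu
      · simp only [pair, if_true, Bool.false_eq_true, if_false] at hu
        simp only [partner, hu, Bool.xor_assoc, Bool.xor_self, Bool.xor_false]
    · cases b
      · simp only [pair, if_true, Bool.true_eq_false, if_false] at hq
        exact hq
      · simp only [pair, if_true, Bool.false_eq_true, if_false] at hq
        simp only [partner, hq, Bool.xor_assoc, Bool.xor_self, Bool.xor_false]

/-- With random expansions of the other server, the correction words of a layer and the seeds
of the other server below it are uniformly random. -/
theorem avg_layer (hg : ∀ x ∈ L, ∀ y ∈ L, ρ x (g x) = ρ y (g y) → x = y)
    (hL : ∀ x ∈ L, ∃ j, app x j ∈ L') (hpar : ∀ y ∈ L', par y ∈ L) (S : Bits i → Bits lam)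
    (F : (Fin (3 * k) → CWord lam) → (Bits (i + 1) → Bool → Node lam) → ℝ) :
    avg (fun r => avg (fun W : Bits i → Bits (2 * (lam + 2)) => F (layerCW ρ g gnext L L' r (fun x => pair b (V x) (W x)))
      (layerSt ρ L' (layerCW ρ g gnext L L' r (fun x => pair b (V x) (W x)))
        (fun x => pair b (V x) (W x)) (pairSt b g L N S)))) =
    avg (fun c => avg (fun S' => F c (pairSt b gnext L' (fun y => childNode (V (par y)) (N (par y))
      (c (ρ (par y) false)) (c (ρ (par y) true)) (y (Fin.last i))) S'))) := by
  let f : (Fin (3 * k) → CWord lam) × (Bits i → Bits (2 * (lam + 2))) → ℝ := fun z =>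
    F z.1 (pairSt b gnext L' (fun y => childNode (V (par y)) (N (par y))
      (z.1 (ρ (par y) false)) (z.1 (ρ (par y) true)) (y (Fin.last i)))
      (fun y => childSeed (z.2 (par y)) (y (Fin.last i))))
  -- After the change of variables by `swap`, the correction words and the strings containing the
  -- other server's child seeds are independent and uniform.
  have h1 := avg_comp_injective (swap_injective b ρ g gnext L L' V N hg hL) f
  rw [avg_prod, avg_prod] at h1
  refine Eq.trans ?_ (h1.trans ?_)
  · refine congrArg avg (funext fun r => congrArg avg (funext fun W => ?_))
    have := layerSt_pairSt b ρ g gnext L L' V N hg hpar S (r, W)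
    simp only at this
    rw [this]
    rfl
  · refine congrArg avg (funext fun c => ?_)
    exact avg_childSeed (fun S' => F c (pairSt b gnext L' (fun y => childNode (V (par y)) (N (par y))
      (c (ρ (par y) false)) (c (ρ (par y) true)) (y (Fin.last i))) S'))

end Swap

end DPF

namespace DPF

open Circuit

/-! ### Uniformity of the last correction words -/

section LastLayer

variable {d k B : ℕ} {Gr : Type} [AddCommGroup Gr] [Fintype Gr] (b : Bool)
  (ρ : Bits d → Bool → Fin (3 * k)) (g : Bits d → Bool) (items : List (Bits d × (Fin B → Gr)))

/-- With random blocks of the other server, the correction words of the last layer are uniformly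
random. -/
theorem avg_lastCW (hg : ∀ e ∈ items, ∀ f ∈ items, ρ e.1 (g e.1) = ρ f.1 (g f.1) → e = f)
    (sign : Bits d → Bool) (V : Bits d → Fin B → Gr) (F : (Fin (3 * k) → Fin B → Gr) → ℝ) :
    avg (fun r => avg (fun Γ : Bits d → Fin B → Gr =>
      F (lastCW ρ g items r sign (fun x => pair b (V x) (Γ x))))) = avg F := by
  -- The correction word of a point absorbs the block of the other server; the random word it
  -- displaces is stored in place of that block.
  let φ : (Fin (3 * k) → Fin B → Gr) × (Bits d → Fin B → Gr) →
      (Fin (3 * k) → Fin B → Gr) × (Bits d → Fin B → Gr) := fun z =>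
    (lastCW ρ g items z.1 sign (fun x => pair b (V x) (z.2 x)),
      fun x => if x ∈ items.map (fun e => e.1) then z.1 (ρ x (g x)) else z.2 x)
  have hφ : Function.Injective φ := by
    rintro ⟨r, Γ⟩ ⟨r', Γ'⟩ h
    have hc := congrArg Prod.fst h
    have hZ := fun x => congrFun (congrArg Prod.snd h) x
    simp only [φ] at hc hZ
    refine Prod.ext (funext fun a => ?_) (funext fun x => ?_)
    · by_cases ha : ∃ e ∈ items, ρ e.1 (g e.1) = a
      · obtain ⟨e, he, rfl⟩ := ha
        have := hZ e.1
        rwa [if_pos (List.mem_map_of_mem he), if_pos (List.mem_map_of_mem he)] at this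
      · push Not at ha
        have := congrFun hc a
        unfold lastCW at this
        rwa [foldl_update_of_forall_ne items (fun e => ρ e.1 (g e.1)) _ _ ha,
          foldl_update_of_forall_ne items (fun e => ρ e.1 (g e.1)) _ _ ha] at this
    · by_cases hx : x ∈ items.map (fun e => e.1)
      · obtain ⟨e, he, rfl⟩ := List.mem_map.1 hx
        have := congrFun hc (ρ e.1 (g e.1))
        unfold lastCW at this
        rw [foldl_update_key items (fun e => ρ e.1 (g e.1)) (fun e (j : Fin B) =>
            if sign e.1 then -(e.2 j - pair b (V e.1) (Γ e.1) false j + pair b (V e.1) (Γ e.1) true j)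
            else e.2 j - pair b (V e.1) (Γ e.1) false j + pair b (V e.1) (Γ e.1) true j) _ hg he,
          foldl_update_key items (fun e => ρ e.1 (g e.1)) (fun e (j : Fin B) =>
            if sign e.1 then
              -(e.2 j - pair b (V e.1) (Γ' e.1) false j + pair b (V e.1) (Γ' e.1) true j)
            else e.2 j - pair b (V e.1) (Γ' e.1) false j + pair b (V e.1) (Γ' e.1) true j)
            _ hg he] at this
        funext j
        have hj := congrFun this j
        cases hs : sign e.1 <;> cases b <;> simpa [hs, pair] using hj
      · have := hZ x
        rwa [if_neg hx, if_neg hx] at this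
  have h1 := avg_comp_injective hφ (fun z => F z.1)
  rw [avg_fst, avg_prod] at h1
  exact h1

end LastLayer

/-! ### The hybrid keys and the exact identities between them -/

section Hybrids

variable {lam d k B : ℕ} {Gr : Type} [AddCommGroup Gr] [Fintype Gr]
  (G : Bits lam → Bits (2 * (lam + 2))) (G' : Bits lam → Bits (B * glen Gr)) (R : GroupRep Gr)
  (ρ : Hash k d) (g : (i : ℕ) → Bits i → Bool) (items : List (Bits d × (Fin B → Gr))) (b : Bool)

/-- The key obtained from the nodes of both servers at depth `n` by generating the remaining layers. -/
def finish (m n : ℕ) (h : n + m = d) (s : Bits lam) (cw : Fin d → Fin (3 * k) → CWord lam)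
    (st : Bits n → Bool → Node lam) (rlast : Fin (3 * k) → Fin B → Gr) : Key lam d k B Gr :=
  let lay := runFrom G ρ g (items.map (fun e => e.1)) m n h cw st
  (s, lay.1, lastCW (ρ ⟨d, Nat.lt_succ_self d⟩) (g d) items rlast (signOf (g d) lay.2)
    (fun x b => blockOf R (G' (lay.2 x b).seed)))

/-- The nodes of the server `b` with root seed `s`. -/
def ownNode (s : Bits lam) (cw : Fin d → Fin (3 * k) → CWord lam) (n : ℕ) (h : n ≤ d) :
    Bits n → Node lam :=
  nodeOf G ρ cw ⟨s, b, false⟩ n h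

/-- The key of server `b` where the layers above depth `n` are uniformly random, and the other
server holds the seeds `S` at depth `n`. -/
def hybridKey (m n : ℕ) (h : n + m = d) (κ : Key lam d k B Gr) (S : Bits n → Bits lam) :
    Key lam d k B Gr :=
  finish G G' R ρ g items m n h κ.1 κ.2.1
    (pairSt b (g n) (pfx (items.map (fun e => e.1)) n (by omega)) (ownNode G ρ b κ.1 κ.2.1 n (by omega)) S) κ.2.2

/-- As `hybridKey`, with the expansions `W` of the other server at depth `n` in place of its seeds. -/
def expandedKey (m n : ℕ) (h : n + (m + 1) = d) (κ : Key lam d k B Gr)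
    (W : Bits n → Bits (2 * (lam + 2))) : Key lam d k B Gr :=
  let N := ownNode G ρ b κ.1 κ.2.1 n (by omega)
  let L := pfx (items.map (fun e => e.1)) n (by omega)
  let L' := pfx (items.map (fun e => e.1)) (n + 1) (by omega)
  let E := fun x => pair b (G (N x).seed) (W x)
  let c := layerCW (ρ ⟨n, by omega⟩) (g n) (g (n + 1)) L L' (κ.2.1 ⟨n, by omega⟩) E
  finish G G' R ρ g items m (n + 1) (by omega) κ.1 (Function.update κ.2.1 ⟨n, by omega⟩ c)
    (layerSt (ρ ⟨n, by omega⟩) L' c E (pairSt b (g n) L N (fun _ _ => false))) κ.2.2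

theorem layerCW_congr {i : ℕ} (ρ : Bits i → Bool → Fin (3 * k)) (g : Bits i → Bool)
    (gnext : Bits (i + 1) → Bool) (L : List (Bits i)) (L' : List (Bits (i + 1)))
    (rnd : Fin (3 * k) → CWord lam) {E E' : Bits i → Bool → Bits (2 * (lam + 2))}
    (hE : ∀ x ∈ L, E x = E' x) :
    layerCW ρ g gnext L L' rnd E = layerCW ρ g gnext L L' rnd E' :=
  foldl_congr_mem _ _ _ _ (fun t x hx => by rw [hE x hx])

/-- Seeds enter only through the expansions, so of the nodes themselves just the control bits
matter. This justifies the dummy seeds in `expandedKey`. -/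
theorem layerSt_congr {i : ℕ} (ρ : Bits i → Bool → Fin (3 * k)) (L : List (Bits i))
    (L' : List (Bits (i + 1))) (hpar : ∀ y ∈ L', par y ∈ L) (cw : Fin (3 * k) → CWord lam)
    {E E' : Bits i → Bool → Bits (2 * (lam + 2))} (hE : ∀ x ∈ L, E x = E' x)
    {st st' : Bits i → Bool → Node lam}
    (hst : ∀ x ∈ L, ∀ c, (st x c).u = (st' x c).u ∧ (st x c).q = (st' x c).q) :
    layerSt ρ L' cw E st = layerSt ρ L' cw E' st' := by
  funext y c
  by_cases hy : y ∈ L'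
  · simp only [layerSt, if_pos hy, childNode, hE _ (hpar y hy), (hst _ (hpar y hy) c).1,
      (hst _ (hpar y hy) c).2]
  · simp only [layerSt, if_neg hy]

theorem expandedKey_congr (m n : ℕ) (h : n + (m + 1) = d) (κ : Key lam d k B Gr)
    {W W' : Bits n → Bits (2 * (lam + 2))}
    (hW : ∀ x ∈ pfx (items.map (fun e => e.1)) n (by omega), W x = W' x) :
    expandedKey G G' R ρ g items b m n h κ W = expandedKey G G' R ρ g items b m n h κ W' := by
  have hE : ∀ x ∈ pfx (items.map (fun e => e.1)) n (by omega),
      pair b (G (ownNode G ρ b κ.1 κ.2.1 n (by omega) x).seed) (W x) =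
      pair b (G (ownNode G ρ b κ.1 κ.2.1 n (by omega) x).seed) (W' x) := fun x hx => by rw [hW x hx]
  simp only [expandedKey]
  rw [layerCW_congr _ _ _ _ _ _ hE, layerSt_congr _ _ _ (fun y hy => par_mem_pfx hy) _ hE
    (fun _ _ _ => ⟨rfl, rfl⟩)]

/-- The other server's seeds are used for nothing but their expansions. Hence these can be isolated
as the only place where the pseudorandomness of `G` is needed. -/
theorem hybridKey_succ (m n : ℕ) (h : n + (m + 1) = d) (κ : Key lam d k B Gr)
    (S : Bits n → Bits lam) :
    hybridKey G G' R ρ g items b (m + 1) n h κ S =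
      expandedKey G G' R ρ g items b m n h κ (fun x => G (S x)) := by
  have hE : ∀ x ∈ pfx (items.map (fun e => e.1)) n (by omega),
      (fun c => G (pairSt b (g n) (pfx (items.map (fun e => e.1)) n (by omega))
        (ownNode G ρ b κ.1 κ.2.1 n (by omega)) S x c).seed) =
      pair b (G (ownNode G ρ b κ.1 κ.2.1 n (by omega) x).seed) (G (S x)) := fun x hx => by
    funext c
    simp only [pairSt, if_pos hx, pair]
    split_ifs <;> rfl
  simp only [hybridKey, expandedKey, finish, runFrom]
  rw [layerCW_congr _ _ _ _ _ _ hE, layerSt_congr _ _ _ (fun y hy => par_mem_pfx hy) _ hE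
    (st' := pairSt b (g n) (pfx (items.map (fun e => e.1)) n (by omega))
      (ownNode G ρ b κ.1 κ.2.1 n (by omega)) (fun _ _ => false))
    (fun x hx c => by
      simp only [pairSt, if_pos hx, pair]
      split_ifs <;> exact ⟨rfl, rfl⟩)]

/-- Resampling the correction words of one layer. -/
theorem avg_key_update (i : Fin d) (f : Key lam d k B Gr → ℝ) :
    avg f = avg (fun κ : Key lam d k B Gr =>
      avg (fun r => f (κ.1, Function.update κ.2.1 i r, κ.2.2))) := by
  rw [avg_prod, avg_prod]
  refine congrArg avg (funext fun s => ?_)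
  rw [avg_prod, avg_prod, avg_update i]
  refine congrArg avg (funext fun z => ?_)
  rw [avg_comm]

/-- For uniform expansions `avg_layer` makes the words of this layer uniform and hands uniform seeds
to the next depth. The layer is resampled with the rest of the key fixed, which does not affect the
nodes of server `b` at depth `n`. -/
theorem avg_expandedKey (hg : Good ρ g (items.map (fun e => e.1))) (m n : ℕ) (h : n + (m + 1) = d)
    (f : Key lam d k B Gr → ℝ) :
    avg (fun κ => avg (fun W => f (expandedKey G G' R ρ g items b m n h κ W))) =
    avg (fun κ => avg (fun S => f (hybridKey G G' R ρ g items b m (n + 1) (by omega) κ S))) := by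
  have hn : n < d := by omega
  rw [avg_key_update ⟨n, hn⟩, avg_key_update (f := fun κ =>
    avg (fun S => f (hybridKey G G' R ρ g items b m (n + 1) (by omega) κ S))) ⟨n, hn⟩]
  refine congrArg avg (funext fun κ => ?_)
  have hown : ∀ r, ownNode G ρ b κ.1 (Function.update κ.2.1 ⟨n, hn⟩ r) n hn.le =
      ownNode G ρ b κ.1 κ.2.1 n hn.le := by
    intro r
    funext x
    exact nodeOf_congr G ρ _ n hn.le (fun i hi => Function.update_of_ne (Fin.ne_of_lt hi) _ _) x
  have key := avg_layer b (ρ ⟨n, by omega⟩) (g n) (g (n + 1))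
    (pfx (items.map (fun e => e.1)) n hn.le) (pfx (items.map (fun e => e.1)) (n + 1) hn)
    (fun x => G (ownNode G ρ b κ.1 κ.2.1 n hn.le x).seed) (ownNode G ρ b κ.1 κ.2.1 n hn.le) (hg n hn.le)
    (fun x hx => exists_app_mem_pfx hn hx) (fun y hy => par_mem_pfx hy) (fun _ _ => false)
    (fun c st => f (finish G G' R ρ g items m (n + 1) (by omega) κ.1
      (Function.update κ.2.1 ⟨n, hn⟩ c) st κ.2.2))
  refine Eq.trans ?_ (key.trans ?_)
  · simp only [expandedKey, hown, Function.update_self, Function.update_idem]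
  · refine congrArg avg (funext fun c => congrArg avg (funext fun S => ?_))
    have hchild : ownNode G ρ b κ.1 (Function.update κ.2.1 ⟨n, hn⟩ c) (n + 1) hn =
        fun y => childNode (G (ownNode G ρ b κ.1 κ.2.1 n hn.le (par y)).seed) (ownNode G ρ b κ.1 κ.2.1 n hn.le (par y))
          (c (ρ ⟨n, by omega⟩ (par y) false)) (c (ρ ⟨n, by omega⟩ (par y) true)) (y (Fin.last n)) := by
      funext y
      rw [← hown c]
      simp only [ownNode, nodeOf, Function.update_self]
    simp only [hybridKey, hchild]

/-- At the leaves, the key with the blocks `Γ` of the other server. -/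
def leafKey (κ : Key lam d k B Gr) (Γ : Bits d → Fin B → Gr) : Key lam d k B Gr :=
  (κ.1, κ.2.1, lastCW (ρ ⟨d, Nat.lt_succ_self d⟩) (g d) items κ.2.2
    (signOf (g d) (pairSt b (g d) (items.map (fun e => e.1)) (ownNode G ρ b κ.1 κ.2.1 d le_rfl)
      (fun _ _ => false)))
    (fun x => pair b (blockOf R (G' (ownNode G ρ b κ.1 κ.2.1 d le_rfl x).seed)) (Γ x)))

theorem lastCW_congr (ρ : Bits d → Bool → Fin (3 * k)) (g : Bits d → Bool)
    (rnd : Fin (3 * k) → Fin B → Gr) {sign sign' : Bits d → Bool}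
    (hsign : ∀ x ∈ items.map (fun e => e.1), sign x = sign' x)
    {val val' : Bits d → Bool → Fin B → Gr}
    (hval : ∀ x ∈ items.map (fun e => e.1), val x = val' x) :
    lastCW ρ g items rnd sign val = lastCW ρ g items rnd sign' val' :=
  foldl_congr_mem _ _ _ _ (fun t e he => by
    rw [hval _ (List.mem_map_of_mem he), hsign _ (List.mem_map_of_mem he)])

theorem leafKey_congr (κ : Key lam d k B Gr) {Γ Γ' : Bits d → Fin B → Gr}
    (hΓ : ∀ x ∈ items.map (fun e => e.1), Γ x = Γ' x) :
    leafKey G G' R ρ g items b κ Γ = leafKey G G' R ρ g items b κ Γ' := by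
  unfold leafKey
  rw [lastCW_congr items _ _ _ (fun _ _ => rfl) (fun x hx => by rw [hΓ x hx])]

theorem hybridKey_zero (κ : Key lam d k B Gr) (S : Bits d → Bits lam) :
    hybridKey G G' R ρ g items b 0 d rfl κ S =
      leafKey G G' R ρ g items b κ (fun x => blockOf R (G' (S x))) := by
  simp only [hybridKey, leafKey, finish, runFrom]
  refine Prod.ext rfl (Prod.ext rfl ?_)
  dsimp only
  refine lastCW_congr items _ _ _ (fun x hx => ?_) (fun x hx => ?_)
  · have hx' := mem_pfx_self.2 hx
    simp only [signOf, pairSt, Fin.cast_refl, id, hx, hx', if_true, pair]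
    split_ifs <;> rfl
  · have hx' := mem_pfx_self.2 hx
    funext c
    simp only [pairSt, Fin.cast_refl, id, hx', if_true, pair]
    split_ifs <;> rfl

variable {ρ g items} in
theorem locations_injective (hg : Good ρ g (items.map (fun e => e.1)))
    (hitems : ∀ e ∈ items, ∀ f ∈ items, e.1 = f.1 → e = f) :
    ∀ e ∈ items, ∀ e' ∈ items, ρ ⟨d, Nat.lt_succ_self d⟩ e.1 (g d e.1) =
      ρ ⟨d, Nat.lt_succ_self d⟩ e'.1 (g d e'.1) → e = e' := fun e he e' he' hee =>
  hitems e he e' he' (hg d le_rfl _ (mem_pfx_self.2 (List.mem_map_of_mem he)) _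
    (mem_pfx_self.2 (List.mem_map_of_mem he')) hee)

/-- Whatever the root seed and the upper layers are, uniform blocks of the other server hide the
last correction words completely. The final hybrid is a uniformly random key. -/
theorem avg_leafKey (hg : Good ρ g (items.map (fun e => e.1)))
    (hitems : ∀ e ∈ items, ∀ f ∈ items, e.1 = f.1 → e = f) (f : Key lam d k B Gr → ℝ) :
    avg (fun κ => avg (fun Γ => f (leafKey G G' R ρ g items b κ Γ))) = avg f := by
  have key : ∀ s cw, avg (fun r => avg (fun Γ => f (leafKey G G' R ρ g items b (s, cw, r) Γ))) =
      avg (fun c => f (s, cw, c)) := by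
    intro s cw
    have h1 := avg_lastCW b (ρ ⟨d, Nat.lt_succ_self d⟩) (g d) items
      (locations_injective hg hitems)
      (signOf (g d) (pairSt b (g d) (items.map (fun e => e.1)) (ownNode G ρ b s cw d le_rfl)
        (fun _ _ => false)))
      (fun x => blockOf R (G' (ownNode G ρ b s cw d le_rfl x).seed)) (fun c => f (s, cw, c))
    exact h1
  rw [avg_prod, avg_prod f]
  refine congrArg avg (funext fun s => ?_)
  rw [avg_prod, avg_prod (fun z => f (s, z))]
  exact congrArg avg (funext fun cw => key s cw)

/-- The first hybrid is the real key. -/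
theorem avg_genWith (hitems : items ≠ []) (hsel : g 0 Fin.elim0 = false) (f : Key lam d k B Gr → ℝ) :
    avg (fun ω : Tape lam d k B Gr => f (((genWith R ρ g items ω).run G G').1 b)) =
    avg (fun κ => avg (fun S => f (hybridKey G G' R ρ g items b d 0 (Nat.zero_add d) κ S))) := by
  -- One root seed belongs to the key of server `b`; the other one becomes the function `S` at depth
  -- 0, where there is a single node.
  let e : Tape lam d k B Gr ≃ Key lam d k B Gr × (Bits 0 → Bits lam) :=
    { toFun := fun ω => ((if b then ω.2.1 else ω.1, ω.2.2), fun _ => if b then ω.1 else ω.2.1)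
      invFun := fun z => (if b then z.2 Fin.elim0 else z.1.1, if b then z.1.1 else z.2 Fin.elim0, z.1.2)
      left_inv := fun ω => by cases b <;> rfl
      right_inv := fun z => by
        have : ∀ x : Bits 0, x = Fin.elim0 := fun x => funext fun t => t.elim0
        refine Prod.ext (by cases b <;> rfl) (funext fun x => ?_)
        rw [this x]
        cases b <;> rfl }
  rw [← avg_prod (fun z : Key lam d k B Gr × (Bits 0 → Bits lam) =>
    f (hybridKey G G' R ρ g items b d 0 (Nat.zero_add d) z.1 z.2)), ← avg_equiv e]
  refine congrArg avg (funext fun ω => ?_)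
  have hst : rootSt g ω = pairSt b (g 0) (pfx (items.map (fun e => e.1)) 0 (Nat.zero_le d))
      (ownNode G ρ b (e ω).1.1 (e ω).1.2.1 0 (Nat.zero_le d)) (e ω).2 := by
    funext x c
    obtain rfl : x = Fin.elim0 := funext fun t => t.elim0
    rw [pfx_zero (by simpa using hitems)]
    -- The choice `false` at the root is used here: `ownNode` starts with the control bits `(b,
    -- false)`.
    cases b <;> cases c <;> simp [rootSt, pairSt, pair, partner, ownNode, nodeOf, hsel, e]
  rw [run_genWith]
  simp only [hybridKey, finish, ← hst]
  rfl

end Hybrids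

end DPF

namespace DPF

open Circuit

/-! ### From distinguishers for keys to distinguishers for the generators -/

section Distinguishers

variable {lam d k B : ℕ} {Gr : Type} [AddCommGroup Gr] [Fintype Gr]
  (G : Bits lam → Bits (2 * (lam + 2))) (G' : Bits lam → Bits (B * glen Gr)) {R : GroupRep Gr}
  (ρ : Hash k d) (g : (i : ℕ) → Bits i → Bool) (items : List (Bits d × (Fin B → Gr))) (b : Bool)

/-- The gates for the layers of a key, with circuits of sizes `sG`, `sG'` for the generators. -/
def finishCost (lam d k B sG sG' sconv slast : ℕ) : ℕ :=
  d * (k * (2 * sG) + layerCost lam k) + (k * (2 * (sG' + B * sconv)) + k * (B * slast))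

/-- Only `cw` and `st` depend on the input; all other data are constants of the circuit. The number
of remaining layers is estimated by `d`, which makes the bound independent of the depth of the
hybrid. -/
theorem comp_finish (CG : Circuit (2 * (lam + 2)) lam) (hCG : ∀ s, CG.eval s = G s)
    (CG' : Circuit (B * glen Gr) lam) (hCG' : ∀ s, CG'.eval s = G' s) (Q : GroupCircuits R)
    {T : Type} {V : Set (T → Bool)} (hV : consts T ⊆ V) (hlen : items.length ≤ k)
    (hg : Good ρ g (items.map (fun e => e.1)))
    (hitems : ∀ e ∈ items, ∀ f ∈ items, e.1 = f.1 → e = f) (m n : ℕ) (h : n + m = d) (s : Bits lam)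
    {cw : T → Fin d → Fin (3 * k) → CWord lam} (hcw : ∀ i a, cwBits (fun t => cw t i a) ⊆ V)
    {st : T → Bits n → Bool → Node lam}
    (hst : ∀ x ∈ pfx (items.map (fun e => e.1)) n (by omega), ∀ c, nodeBits (fun t => st t x c) ⊆ V)
    (rlast : Fin (3 * k) → Fin B → Gr) :
    Comp V (finishCost lam d k B CG.size CG'.size Q.conv.size Q.lastCost)
      (bitsOf (fun t => simView R (finish G G' R ρ g items m n h s (cw t) (st t) rlast))) := by
  obtain ⟨U, hU, h1, h2⟩ := comp_runFrom G CG hCG ρ g (items.map (fun e => e.1)) (by simpa using hlen)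
    hg m n h hV hcw hst
  set lay := fun t => runFrom G ρ g (items.map (fun e => e.1)) m n h (cw t) (st t) with hlay
  have hblk := Comp.list (V := V ∪ U) (t := 2 * (CG'.size + B * Q.conv.size)) items
    (fun e => ⋃ c, ⋃ j, grBits R (fun t => blockOf R (G' ((lay t).2 e.1 c).seed) j)) (fun e he => by
      have := Comp.iUnion (fun c => ⋃ j, grBits R (fun t => blockOf R (G' ((lay t).2 e.1 c).seed) j))
        (fun c => by
          have hs := (nodeBits_subset.1 (h2 e.1 (List.mem_map_of_mem he) c)).1
          have hw := Comp.circuit CG' _ hs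
          simp only [hCG'] at hw
          exact hw.seq' (comp_blockOf Q Set.subset_union_right))
      simpa using this)
  set U1 := {f | ∃ e ∈ items, f ∈ ⋃ c, ⋃ j, grBits R (fun t => blockOf R (G' ((lay t).2 e.1 c).seed) j)}
    with hU1
  have hV' : consts T ⊆ V ∪ U ∪ U1 := (hV.trans Set.subset_union_left).trans Set.subset_union_left
  obtain ⟨U2, hU2, h3⟩ := comp_lastCW Q hV' (ρ ⟨d, Nat.lt_succ_self d⟩) (g d) items hlen
    (locations_injective hg hitems) rlast (sign := fun t => signOf (g d) (lay t).2)
    (fun e he => by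
      have hb := (nodeBits_subset.1 (h2 e.1 (List.mem_map_of_mem he) true)).2
      simp only [signOf]
      split_ifs
      · exact Or.inl hb.2
      · exact Or.inl hb.1)
    (val := fun t x c => blockOf R (G' ((lay t).2 x c).seed))
    (fun e he c j f hf => Or.inr ⟨e, he, Set.mem_iUnion.2 ⟨c, Set.mem_iUnion.2 ⟨j, hf⟩⟩⟩)
  have hsub := view_subset (V := V ∪ U ∪ U1 ∪ U2) (R := R) (hV'.trans Set.subset_union_left)
    (κ := fun t => finish G G' R ρ g items m n h s (cw t) (st t) rlast)
    (bitsOf_subset.2 (fun i => const_mem (hV'.trans Set.subset_union_left) _))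
    (fun i a => ((h1 i a).trans Set.subset_union_left).trans Set.subset_union_left) h3 false
  have hall := hU.seq (hblk.seq hU2)
  have hfin := hall.seq' (Comp.of_subset (t := 0) (U := bitsOf (fun t => simView R
    (finish G G' R ρ g items m n h s (cw t) (st t) rlast))) (by
      rw [← Set.union_assoc, ← Set.union_assoc]; exact hsub))
  refine hfin.mono subset_rfl ?_ subset_rfl
  unfold finishCost
  have hm : m ≤ d := by omega
  rw [add_zero]
  gcongr

/-- A distinguisher for keys yields one for the expansions of the other server. -/
theorem exists_circuit_expandedKey (CG : Circuit (2 * (lam + 2)) lam) (hCG : ∀ s, CG.eval s = G s)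
    (CG' : Circuit (B * glen Gr) lam) (hCG' : ∀ s, CG'.eval s = G' s) (Q : GroupCircuits R)
    (hlen : items.length ≤ k)
    (hg : Good ρ g (items.map (fun e => e.1)))
    (hitems : ∀ e ∈ items, ∀ f ∈ items, e.1 = f.1 → e = f) (m n : ℕ) (h : n + (m + 1) = d)
    (κ : Key lam d k B Gr) (A : Circuit 1 (lam + cwLen lam d k B Gr + 1)) (x : Bits n)
    (W : Bits n → Bits (2 * (lam + 2))) :
    ∃ A' : Circuit 1 (2 * (lam + 2)),
      A'.size ≤ 2 + layerCost lam k + finishCost lam d k B CG.size CG'.size Q.conv.size Q.lastCost +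
        A.size ∧
      ∀ w, A'.eval w 0 =
        A.eval (simView R (expandedKey G G' R ρ g items b m n h κ (Function.update W x w))) 0 := by
  have hn : n < d := by omega
  have hlen' : (items.map (fun e => e.1)).length ≤ k := by simpa using hlen
  -- The input is the expansion at the node `x` alone. The key `κ` and the other expansions are
  -- built into the circuit.
  let V0 : Set (Bits (2 * (lam + 2)) → Bool) := bitsOf (fun w => w)
  let V1 := V0 ∪ consts (Bits (2 * (lam + 2)))
  have hV1 : consts (Bits (2 * (lam + 2))) ⊆ V1 := Set.subset_union_right
  set N := ownNode G ρ b κ.1 κ.2.1 n hn.le with hN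
  have hnode : ∀ nd : Node lam, nodeBits (fun _ : Bits (2 * (lam + 2)) => nd) ⊆ V1 := fun nd =>
    nodeBits_subset.2 ⟨bitsOf_subset.2 (fun i => const_mem hV1 _), const_mem hV1 _, const_mem hV1 _⟩
  have hword : ∀ c : CWord lam, cwBits (fun _ : Bits (2 * (lam + 2)) => c) ⊆ V1 := fun c =>
    cwBits_subset.2 ⟨bitsOf_subset.2 (fun i => const_mem hV1 _),
      fun j => ⟨const_mem hV1 _, const_mem hV1 _⟩⟩
  obtain ⟨U, hU, h1, h2⟩ := comp_layer (V := V1) hV1 (ρ ⟨n, by omega⟩) (g n) (g (n + 1))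
    (pfx (items.map (fun e => e.1)) n hn.le) (pfx (items.map (fun e => e.1)) (n + 1) hn)
    ((length_pfx_le _ _ _).trans hlen') ((length_pfx_le _ _ _).trans hlen')
    (fun y hy => par_mem_pfx hy) (hg n hn.le)
    (rnd := fun _ => κ.2.1 ⟨n, hn⟩) (fun a => hword _)
    (E := fun w y => pair b (G (N y).seed) (Function.update W x w y))
    (fun y _ c => by
      rw [bitsOf_subset]
      intro i
      by_cases hc : c = b
      · simp only [pair, if_pos hc]
        exact const_mem hV1 _
      · by_cases hy : y = x
        · subst hy
          simp only [pair, if_neg hc, Function.update_self]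
          exact Or.inl ⟨i, rfl⟩
        · simp only [pair, if_neg hc, Function.update_of_ne hy]
          exact const_mem hV1 _)
    (st := fun _ => pairSt b (g n) (pfx (items.map (fun e => e.1)) n hn.le) N (fun _ _ => false))
    (fun y _ c => hnode _)
  have h3 := comp_finish (V := V1 ∪ U) G G' ρ g items CG hCG CG' hCG' Q
    (hV1.trans Set.subset_union_left) hlen hg hitems m (n + 1) (by omega) κ.1
    (cw := fun w => Function.update κ.2.1 ⟨n, hn⟩ (layerCW (ρ ⟨n, by omega⟩) (g n) (g (n + 1))
      (pfx (items.map (fun e => e.1)) n hn.le) (pfx (items.map (fun e => e.1)) (n + 1) hn)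
      (κ.2.1 ⟨n, hn⟩) (fun y => pair b (G (N y).seed) (Function.update W x w y))))
    (fun i a => by
      by_cases hi : i = ⟨n, hn⟩
      · subst hi
        simp only [Function.update_self]
        exact h1 a
      · simp only [Function.update_of_ne hi]
        exact (hword _).trans Set.subset_union_left) h2 κ.2.2
  have h4 := (h3.seq' (Comp.circuit A _ Set.subset_union_right))
  have h5 := (Comp.consts V0).seq' (hU.seq' h4)
  obtain ⟨A', hA, hA'⟩ := Comp.exists_circuit (fun w => w) _ h5 subset_rfl
  refine ⟨A', hA.trans (by omega), fun w => ?_⟩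
  rw [hA' w]
  rfl

/-- A distinguisher for keys yields one for the blocks of the other server. -/
theorem exists_circuit_leafKey (Q : GroupCircuits R) (hlen : items.length ≤ k)
    (hg : Good ρ g (items.map (fun e => e.1)))
    (hitems : ∀ e ∈ items, ∀ f ∈ items, e.1 = f.1 → e = f) (κ : Key lam d k B Gr)
    (A : Circuit 1 (lam + cwLen lam d k B Gr + 1)) (x : Bits d) (Γ : Bits d → Fin B → Gr) :
    ∃ A' : Circuit 1 (B * glen Gr), A'.size ≤ 2 + k * (B * Q.lastCost) + A.size ∧
      ∀ γ : Fin B → Gr, A'.eval (flatten (fun j => R.enc (γ j))) 0 =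
        A.eval (simView R (leafKey G G' R ρ g items b κ (Function.update Γ x γ))) 0 := by
  let V0 : Set ((Fin B → Gr) → Bool) := bitsOf (fun γ => flatten (fun j => R.enc (γ j)))
  let V1 := V0 ∪ consts (Fin B → Gr)
  have hV1 : consts (Fin B → Gr) ⊆ V1 := Set.subset_union_right
  have hword : ∀ c : CWord lam, cwBits (fun _ : Fin B → Gr => c) ⊆ V1 := fun c =>
    cwBits_subset.2 ⟨bitsOf_subset.2 (fun i => const_mem hV1 _),
      fun j => ⟨const_mem hV1 _, const_mem hV1 _⟩⟩
  obtain ⟨U, hU, h1⟩ := comp_lastCW (V := V1) Q hV1 (ρ ⟨d, Nat.lt_succ_self d⟩) (g d) items hlen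
    (locations_injective hg hitems) κ.2.2
    (sign := fun _ => signOf (g d) (pairSt b (g d) (items.map (fun e => e.1))
      (ownNode G ρ b κ.1 κ.2.1 d le_rfl) (fun _ _ => false))) (fun e _ => const_mem hV1 _)
    (val := fun γ y => pair b (blockOf R (G' (ownNode G ρ b κ.1 κ.2.1 d le_rfl y).seed))
      (Function.update Γ x γ y))
    (fun e _ c j => by
      by_cases hc : c = b
      · simp only [pair, if_pos hc]
        exact grBits_const hV1 _
      · by_cases hy : e.1 = x
        · simp only [pair, if_neg hc, hy, Function.update_self]
          refine bitsOf_subset.2 (fun i => Or.inl ⟨finProdFinEquiv (j, i), ?_⟩)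
          funext γ
          simp [flatten]
        · simp only [pair, if_neg hc, Function.update_of_ne hy]
          exact grBits_const hV1 _)
  have hsub := view_subset (V := V1 ∪ U) (R := R) (hV1.trans Set.subset_union_left)
    (κ := fun γ => leafKey G G' R ρ g items b κ (Function.update Γ x γ))
    (bitsOf_subset.2 (fun i => const_mem (hV1.trans Set.subset_union_left) _))
    (fun i a => (hword _).trans Set.subset_union_left) h1 false
  have h4 := (Comp.consts V0).seq' (hU.seq' (Comp.circuit A _ hsub))
  obtain ⟨A', hA, hA'⟩ := Comp.exists_circuit (fun γ : Fin B → Gr => flatten (fun j => R.enc (γ j))) _ h4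
    subset_rfl
  refine ⟨A', hA.trans (by omega), fun γ => ?_⟩
  rw [hA' γ]
  rfl

end Distinguishers

end DPF

namespace DPF

open Circuit

/-! ### The hybrid argument -/

section Bounds

variable {lam d k B : ℕ} {Gr : Type} [AddCommGroup Gr] [Fintype Gr]
  (G : Bits lam → Bits (2 * (lam + 2))) (G' : Bits lam → Bits (B * glen Gr)) {R : GroupRep Gr}
  (ρ : Hash k d) (g : (i : ℕ) → Bits i → Bool) (items : List (Bits d × (Fin B → Gr))) (b : Bool)

/-- Blocks of converted pseudorandom strings are pseudorandom. -/
theorem advLe_blockOf (Q : GroupCircuits R) {s : ℕ} {ε' εc : ℝ} (hεc : 0 ≤ εc)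
    (hG' : AdvLe G' (fun w : Bits (B * glen Gr) => w) (B * Q.conv.size + s) ε')
    (hconv : AdvLe (fun w : Bits (glen Gr) => R.enc (R.convert w)) (fun a : Gr => R.enc a) (2 + s) εc) :
    AdvLe (fun t => flatten (fun j => R.enc (blockOf R (G' t) j)))
      (fun γ : Fin B → Gr => flatten (fun j => R.enc (γ j))) s (ε' + B * εc) := by
  intro A hA
  -- First the output of `G'` becomes a uniform string; the distinguisher for this is `A` preceded
  -- by the conversion of the blocks.
  obtain ⟨A1, hA1, hA1'⟩ := Comp.exists_circuit (fun w : Bits (B * glen Gr) => w) _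
    ((comp_blockOf (B := B) (V := bitsOf (fun w : Bits (B * glen Gr) => w)) Q subset_rfl).seq'
      (Comp.circuit A (fun w => flatten (fun j => R.enc (blockOf R w j)))
        (bitsOf_subset.2 (fun t => Or.inr (Set.mem_iUnion.2 ⟨_, ⟨_, rfl⟩⟩))))) subset_rfl
  have h1 := hG' A1 (hA1.trans (by omega))
  simp only [accept, hA1'] at h1
  let e : Bits (B * glen Gr) ≃ (Fin B → Bits (glen Gr)) :=
    { toFun := fun w j => chunk w j
      invFun := fun z => flatten z
      left_inv := fun w => funext fun t => congrArg w (finProdFinEquiv.apply_symm_apply t)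
      right_inv := fun z => by funext j t; simp [flatten, chunk] }
  have h2 := avg_equiv e (fun z => ind (A.eval (flatten (fun j => R.enc (R.convert (z j)))) 0 = true))
  -- Then the `B` converted strings are replaced by uniform group elements, one at a time.
  have h3 := abs_avg_sub_avg_le (ι := Fin B) hεc R.enc R.convert (fun a : Gr => a) hconv
    (fun z => A.eval (flatten (fun j => R.enc (z j))) 0) (List.finRange B)
    (fun z z' hz => by
      have : z = z' := funext fun j => hz j (List.mem_finRange j)
      rw [this])
    (fun j _ z => by
      let V0 : Set (Gr → Bool) := bitsOf (fun a => R.enc a)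
      obtain ⟨A2, hA2, hA2'⟩ := Comp.exists_circuit (fun a : Gr => R.enc a) _
        ((Comp.consts V0).seq' (Comp.circuit A
          (fun a => flatten (fun i => R.enc (Function.update z j a i)))
          (bitsOf_subset.2 (fun t => by
            by_cases ht : (finProdFinEquiv.symm t).1 = j
            · left
              refine ⟨(finProdFinEquiv.symm t).2, ?_⟩
              funext a
              simp only [flatten, ht, Function.update_self]
            · simp only [flatten, Function.update_of_ne ht]
              exact const_mem Set.subset_union_right _)))) subset_rfl
      exact ⟨A2, hA2.trans (by omega), fun a => by rw [hA2' a]⟩)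
  rw [List.length_finRange] at h3
  have h4 := abs_sub_le (accept (fun t => flatten (fun j => R.enc (blockOf R (G' t) j))) A)
    (avg (fun w : Bits (B * glen Gr) =>
      ind (A.eval (flatten (fun j => R.enc (blockOf R w j))) 0 = true)))
    (accept (fun γ : Fin B → Gr => flatten (fun j => R.enc (γ j))) A)
  refine h4.trans (add_le_add h1 ?_)
  refine le_trans (le_of_eq ?_) h3
  rw [← h2]
  rfl

/-- Circuits of size `sA` distinguish the real from the simulated key with small advantage. -/
theorem abs_genWith_sub_le (CG : Circuit (2 * (lam + 2)) lam) (hCG : ∀ s, CG.eval s = G s)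
    (CG' : Circuit (B * glen Gr) lam) (hCG' : ∀ s, CG'.eval s = G' s) (Q : GroupCircuits R)
    (hitems : items ≠ []) (hlen : items.length ≤ k) (hg : Good ρ g (items.map (fun e => e.1)))
    (hinj : ∀ e ∈ items, ∀ f ∈ items, e.1 = f.1 → e = f) (hsel : g 0 Fin.elim0 = false)
    (A : Circuit 1 (lam + cwLen lam d k B Gr + 1)) {ε δ : ℝ} (hε : 0 ≤ ε) (hδ : 0 ≤ δ)
    (hG : AdvLe G (fun w : Bits (2 * (lam + 2)) => w)
      (2 + layerCost lam k + finishCost lam d k B CG.size CG'.size Q.conv.size Q.lastCost + A.size) ε)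
    (hblock : AdvLe (fun t => flatten (fun j => R.enc (blockOf R (G' t) j)))
      (fun γ : Fin B → Gr => flatten (fun j => R.enc (γ j))) (2 + k * (B * Q.lastCost) + A.size) δ) :
    |avg (fun ω : Tape lam d k B Gr =>
        ind (A.eval (simView R (((genWith R ρ g items ω).run G G').1 b)) 0 = true)) -
      accept (simView (lam := lam) (d := d) (k := k) (B := B) R) A| ≤ d * (k * ε) + k * δ := by
  let f : Key lam d k B Gr → ℝ := fun κ => ind (A.eval (simView R κ) 0 = true)
  have hlen' : (items.map (fun e => e.1)).length ≤ k := by simpa using hlen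
  -- Induction on the number `m` of upper layers still generated from seeds. Each of them
  -- contributes `k * ε` and the leaves contribute `k * δ`.
  have key : ∀ (m n : ℕ) (h : n + m = d),
      |avg (fun κ => avg (fun S => f (hybridKey G G' R ρ g items b m n h κ S))) - avg f| ≤
        m * (k * ε) + k * δ := by
    intro m
    induction m with
    | zero =>
      intro n h
      obtain rfl : n = d := h
      rw [← avg_leafKey G G' R ρ g items b hg hinj f, ← avg_sub]
      simp only [hybridKey_zero, Nat.cast_zero, zero_mul, zero_add]
      refine avg_abs_le (fun κ => ?_)
      have h1 := abs_avg_sub_avg_le (ι := Bits n) hδ (fun γ : Fin B → Gr => flatten (fun j => R.enc (γ j)))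
        (fun t => blockOf R (G' t)) (fun γ => γ) hblock
        (fun Γ => A.eval (simView R (leafKey G G' R ρ g items b κ Γ)) 0) (items.map (fun e => e.1))
        (fun Γ Γ' hΓ => by rw [leafKey_congr G G' R ρ g items b κ hΓ])
        (fun x _ Γ => exists_circuit_leafKey G G' ρ g items b Q hlen hg hinj κ A x Γ)
      refine h1.trans ?_
      gcongr
    | succ m ih =>
      intro n h
      have h1 := ih (n + 1) (by omega)
      have h2 : |avg (fun κ => avg (fun S => f (hybridKey G G' R ρ g items b (m + 1) n h κ S))) -
          avg (fun κ => avg (fun S => f (hybridKey G G' R ρ g items b m (n + 1) (by omega) κ S)))| ≤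
          k * ε := by
        -- The next hybrid coincides on average with the one having uniform expansions. It remains
        -- to compare these with `G` on uniform seeds, at no more than `k` nodes.
        rw [← avg_expandedKey G G' R ρ g items b hg m n h f, ← avg_sub]
        simp only [hybridKey_succ]
        refine avg_abs_le (fun κ => ?_)
        have h3 := abs_avg_sub_avg_le (ι := Bits n) hε (fun w : Bits (2 * (lam + 2)) => w) G (fun w => w) hG
          (fun W => A.eval (simView R (expandedKey G G' R ρ g items b m n h κ W)) 0)
          (pfx (items.map (fun e => e.1)) n (by omega))
          (fun W W' hW => by rw [expandedKey_congr G G' R ρ g items b m n h κ hW])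
          (fun x _ W => exists_circuit_expandedKey G G' ρ g items b CG hCG CG' hCG' Q hlen hg hinj m n h
            κ A x W)
        refine h3.trans ?_
        gcongr
        exact (length_pfx_le _ _ _).trans hlen'
      have h3 := abs_sub_le (avg (fun κ => avg (fun S =>
          f (hybridKey G G' R ρ g items b (m + 1) n h κ S))))
        (avg (fun κ => avg (fun S => f (hybridKey G G' R ρ g items b m (n + 1) (by omega) κ S)))) (avg f)
      rw [Nat.cast_succ, add_mul, one_mul]
      linarith
  have h0 := key d 0 (Nat.zero_add d)
  rw [← avg_genWith G G' R ρ g items b hitems hsel f] at h0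
  exact h0

/-- The advantage for the keys produced by `Gen`. -/
theorem abs_serverView_sub_le (CG : Circuit (2 * (lam + 2)) lam) (hCG : ∀ s, CG.eval s = G s)
    (CG' : Circuit (B * glen Gr) lam) (hCG' : ∀ s, CG'.eval s = G' s) (Q : GroupCircuits R)
    (α : Fin k → Bits d) (β : Fin k → Fin B → Gr) (hα : Function.Injective α)
    (A : Circuit 1 (lam + cwLen lam d k B Gr + 1)) {ε δ : ℝ} (hε : 0 ≤ ε) (hδ : 0 ≤ δ)
    (hG : AdvLe G (fun w : Bits (2 * (lam + 2)) => w)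
      (2 + layerCost lam k + finishCost lam d k B CG.size CG'.size Q.conv.size Q.lastCost + A.size) ε)
    (hblock : AdvLe (fun t => flatten (fun j => R.enc (blockOf R (G' t) j)))
      (fun γ : Fin B → Gr => flatten (fun j => R.enc (γ j))) (2 + k * (B * Q.lastCost) + A.size) δ) :
    |accept (serverView R G G' b ρ α β) A -
      accept (simView (lam := lam) (d := d) (k := k) (B := B) R) A| ≤ d * (k * ε) + k * δ := by
  -- A hash value is an element of `Fin (3 * k)`, which forces `k` to be positive.
  have hk : 0 < k := by
    have := (ρ 0 Fin.elim0 false).pos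
    omega
  have hpts : List.ofFn α ≠ [] := by simp [List.ofFn_eq_nil_iff]; omega
  obtain ⟨h1, -⟩ := assignments_spec G G' (Gr := Gr) ρ (List.ofFn α) hpts (d + 1) le_rfl
  -- The assignment does not depend on the tape, so one branch of `gen` is taken for all tapes.
  -- After a failure the keys still come from `genWith`, with a single point, for which any choice
  -- is free of collisions.
  cases hres : (assignments ρ (List.ofFn α) (d + 1) le_rfl : P lam B Gr _).run G G' with
  | none =>
    have hview : serverView R G G' b ρ α β = fun ω => simView R
        (((genWith R ρ (fun _ _ => false) [(fun _ => false, 0)] ω).run G G').1 b) := by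
      funext ω
      simp only [serverView, gen, Prog.run_bind, hres]
      rw [run_genWith]
      rfl
    rw [hview]
    refine abs_genWith_sub_le G G' ρ _ _ b CG hCG CG' hCG' Q (by simp) (by simp; omega) ?_ ?_ rfl A
      hε hδ hG hblock
    · intro n h x hx y hy _
      obtain ⟨p, hp, rfl⟩ := mem_pfx.1 hx
      obtain ⟨q, hq, rfl⟩ := mem_pfx.1 hy
      simp only [List.map_cons, List.map_nil, List.mem_singleton] at hp hq
      rw [hp, hq]
    · intro e he f hf _
      rw [List.mem_singleton] at he hf
      rw [he, hf]
  | some g =>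
    obtain ⟨hg, hsel⟩ := h1 g hres
    have hview : serverView R G G' b ρ α β = fun ω => simView R
        (((genWith R ρ g (List.ofFn (fun ℓ => (α ℓ, β ℓ))) ω).run G G').1 b) := by
      funext ω
      simp only [serverView, gen, Prog.run_bind, hres]
      rw [run_genWith]
      simp only [simView, hsel]
    have hmap : (List.ofFn (fun ℓ => (α ℓ, β ℓ))).map (fun e => e.1) = List.ofFn α := by
      simp [List.map_ofFn, Function.comp_def]
    rw [hview]
    refine abs_genWith_sub_le G G' ρ g _ b CG hCG CG' hCG' Q (by simp [List.ofFn_eq_nil_iff]; omega)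
      (by simp) ?_ ?_ hsel A hε hδ hG hblock
    · rw [hmap]
      exact fun n h => hg n h (Nat.lt_succ_of_le h)
    · intro e he f hf hef
      obtain ⟨a, rfl⟩ := (List.mem_ofFn' _ _).1 he
      obtain ⟨c, rfl⟩ := (List.mem_ofFn' _ _).1 hf
      rw [hα hef]

end Bounds

/-- Security of the scheme. -/
theorem secure (d k B : ℕ → ℕ) (Gr : ℕ → Type) [∀ l, AddCommGroup (Gr l)] [∀ l, Fintype (Gr l)]
    (R : ∀ l, GroupRep (Gr l)) (G : ∀ l, Bits l → Bits (2 * (l + 2)))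
    (G' : ∀ l, Bits l → Bits (B l * glen (Gr l))) (hd : PolyBounded d) (hk : PolyBounded k)
    (hB : PolyBounded B) (hR : EfficientGroup Gr R) (hconv : PseudorandomConvert Gr R)
    (hG : IsPRG G) (hG' : IsPRG G') : Secure d k B Gr R G G' := by
  intro b ρ α β hα A hA
  obtain ⟨hlen, ⟨Cadd, hCadd, hCadd'⟩, ⟨Cneg, hCneg, hCneg'⟩, ⟨Cconv, hCconv, hCconv'⟩⟩ := hR
  obtain ⟨⟨CG, hCG, hCGe⟩, hGi⟩ := hG
  obtain ⟨⟨CG', hCG', hCGe'⟩, hGi'⟩ := hG'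
  let Q : ∀ l, GroupCircuits (R l) := fun l =>
    ⟨Cadd l, Cneg l, Cconv l, hCadd' l, hCneg' l, hCconv' l⟩
  have hlast : PolyBounded (fun l => (Q l).lastCost) :=
    ((((PolyBounded.const 2).mul hCadd).add ((PolyBounded.const 2).mul hCneg)).add
      (hlen.mul (PolyBounded.const 10)))
  have hlayer : PolyBounded (fun l => layerCost l (k l)) :=
    (hk.mul ((PolyBounded.id.mul (PolyBounded.const 4)).add (PolyBounded.const 32))).add
      (hk.mul ((PolyBounded.const 2).mul
        ((PolyBounded.id.add (PolyBounded.const 2)).mul (PolyBounded.const 12))))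
  have hfin : PolyBounded (fun l => finishCost l (d l) (k l) (B l) (CG l).size (CG' l).size
      (Q l).conv.size (Q l).lastCost) :=
    (hd.mul ((hk.mul ((PolyBounded.const 2).mul hCG)).add hlayer)).add
      ((hk.mul ((PolyBounded.const 2).mul (hCG'.add (hB.mul hCconv)))).add (hk.mul (hB.mul hlast)))
  have hblock : PolyBounded (fun l => 2 + k l * (B l * (Q l).lastCost) + (A l).size) :=
    ((PolyBounded.const 2).add (hk.mul (hB.mul hlast))).add hA
  obtain ⟨ε, hε, hε'⟩ := hGi.exists_advLe ((((PolyBounded.const 2).add hlayer).add hfin).add hA)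
  obtain ⟨ε', hεG, hεG'⟩ := hGi'.exists_advLe ((hB.mul hCconv).add hblock)
  obtain ⟨εc, hεc, hεc'⟩ := hconv.exists_advLe ((PolyBounded.const 2).add hblock)
  -- The total loss is `d k ε` for the expansions by `G` and `k (ε' + B εc)` for the leaf blocks,
  -- through `G'` and then `convert`.
  have hneg : Negligible (fun l => (d l * k l : ℕ) * ε l + ((k l : ℕ) * ε' l + (k l * B l : ℕ) * εc l)) :=
    (hε.polyBounded_mul (hd.mul hk)).add
      ((hεG.polyBounded_mul hk).add (hεc.polyBounded_mul (hk.mul hB)))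
  refine hneg.mono (fun l => ?_)
  have hδ := advLe_blockOf (G' l) (Q l) (hεc' l).1 (hεG' l).2 (hεc' l).2
  have := abs_serverView_sub_le (G l) (G' l) (ρ l) b (CG l) (hCGe l) (CG' l) (hCGe' l) (Q l) (α l) (β l)
    (hα l) (A l) (hε' l).1
    (add_nonneg (hεG' l).1 (mul_nonneg (Nat.cast_nonneg _) (hεc' l).1)) (hε' l).2 hδ
  rw [abs_abs, prob_eq_avg, prob_eq_avg]
  refine this.trans (le_trans (le_of_eq ?_) (le_abs_self _))
  push_cast
  ring

end DPF
/-- There is an absolute constant `C` such that the following hold.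

For all parameters and all functions `G`, `G'`: the scheme is correct with error `C * d / k`; keys are
bit strings consisting of a seed and of `3kd(λ+4) + 3kB⌈log₂|𝔾|⌉` further bits; `Gen` calls `G` at most
`kd` times and `G'` at most `k` times on the seeds of each server and is polynomial; `Eval` calls `G` at
most `d` times and `G'` once and is polynomial; the full vector is evaluated with at most `2^d` calls
of `G`, with `2^d` calls of `G'` and with `O(D)` further operations, where `D = 2^d * B`.

If `G`, `G'` are pseudorandom generators and all parameters are polynomial in the security parameter, then
the scheme is secure. -/
theorem mainTheorem2 :
    ∃ C : ℕ,
      (∀ (lam d k B : ℕ) (Gr : Type) [AddCommGroup Gr] [Fintype Gr] (R : GroupRep Gr)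
          (G : Bits lam → Bits (2 * (lam + 2))) (G' : Bits lam → Bits (B * glen Gr)),
          0 < k → 0 < B →
        -- correctness
        DPF.CorrectWithError (d := d) (k := k) R G G' ((C : ℝ) * d / k) ∧
        -- key size
        (Function.Injective (DPF.encodeKey (lam := lam) (d := d) (k := k) (B := B) R) ∧
          lam + DPF.cwLen lam d k B Gr =
            lam + (3 * k * d * (lam + 4) + 3 * k * B * Nat.clog 2 (Fintype.card Gr))) ∧
        -- cost of key generation
        (∀ (ρ : DPF.Hash k d) (α : Fin k → Bits d) (β : Fin k → Fin B → Gr)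
            (ω : DPF.Tape lam d k B Gr), Function.Injective α →
          (∀ b, (DPF.gen R ρ α β ω).callsG G G' b ≤ k * d) ∧
          (∀ b, (DPF.gen R ρ α β ω).callsG' G G' b ≤ k) ∧
          (DPF.gen R ρ α β ω).ops G G' ≤ C * (k + d + B) ^ C) ∧
        -- cost of evaluation at one input, and of the full vector
        (∀ (ρ : DPF.Hash k d) (b sel : Bool) (κ : DPF.Key lam d k B Gr),
          (∀ (x : Bits d) (j : Fin B),
            (∑ c, (DPF.eval R ρ b sel κ x j).callsG G G' c ≤ d) ∧
            (∑ c, (DPF.eval R ρ b sel κ x j).callsG' G G' c = 1) ∧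
            (DPF.eval R ρ b sel κ x j).ops G G' ≤ C * (d + B)) ∧
          (∀ (x : Bits d) (j : Fin B),
            (DPF.evalAll R ρ b sel κ).run G G' x j = (DPF.eval R ρ b sel κ x j).run G G') ∧
          (∑ c, (DPF.evalAll R ρ b sel κ).callsG G G' c ≤ 2 ^ d) ∧
          (∑ c, (DPF.evalAll R ρ b sel κ).callsG' G G' c = 2 ^ d) ∧
          (DPF.evalAll R ρ b sel κ).ops G G' ≤ C * (2 ^ d * B))) ∧
      -- security
      (∀ (d k B : ℕ → ℕ) (Gr : ℕ → Type) [∀ l, AddCommGroup (Gr l)] [∀ l, Fintype (Gr l)]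
          (R : ∀ l, GroupRep (Gr l)) (G : ∀ l, Bits l → Bits (2 * (l + 2)))
          (G' : ∀ l, Bits l → Bits (B l * glen (Gr l))),
          PolyBounded d → PolyBounded k → PolyBounded B →
          EfficientGroup Gr R → PseudorandomConvert Gr R →
          IsPRG G → IsPRG G' →
        DPF.Secure d k B Gr R G G') := by
  -- The value 1000 comes from the polynomial bound for `Gen`, where it serves as factor and as a
  -- very generous exponent. Correctness needs 7. Evaluation needs `10d + 4B + 2` operations at one
  -- input and at most `18 + 4B` per leaf for the full vector, where `0 < B` absorbs the additive
  -- constants.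
  refine ⟨1000, ?_, fun d k B Gr _ _ R G G' => DPF.secure d k B Gr R G G'⟩
  intro lam d k B Gr _ _ R G G' hk hB
  refine ⟨?_, ⟨DPF.encodeKey_injective R, DPF.cwLen_eq⟩, ?_, ?_⟩
  · intro α β hα x j
    refine le_trans ?_ (DPF.correctWithError G G' R hk α β hα x j)
    have : (7 : ℝ) * d / k ≤ (1000 : ℕ) * d / k := by
      gcongr
      norm_num
    linarith
  · intro ρ α β ω _
    have h := fun c => DPF.gen_cost G G' c R ρ α β ω hk
    have hpow : ∀ e, 5 ≤ e → 1000 * (k + d + B) ^ 5 ≤ 1000 * (k + d + B) ^ e := fun e he =>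
      Nat.mul_le_mul_left _ (Nat.pow_le_pow_right (by omega) he)
    exact ⟨fun c => (h c).2.1, fun c => (h c).2.2, (h false).1.trans (hpow 1000 (by norm_num))⟩
  · intro ρ b sel κ
    obtain ⟨h1, h2, h3⟩ := DPF.evalAll_cost G G' R ρ b sel κ
    refine ⟨fun x j => ⟨(DPF.eval_callsG G G' R ρ b sel κ x j).le, DPF.eval_callsG' G G' R ρ b sel κ x j,
      ?_⟩, fun x j => DPF.run_evalAll G G' R ρ b sel κ x j, h2, h3, h1.trans ?_⟩
    · rw [DPF.eval_ops]
      omega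
    · rw [Nat.mul_left_comm]
      exact Nat.mul_le_mul_left _ (by omega)
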